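/- **Setting.** Let $G=(V,E)$ be a countable, connected, locally finite simple graph that is transient: if $P_x$ denotes the law of simple random walk $(X_0,X_1,\dots)$ on $G$ started at $x$, then $P_x$-almost every trajectory visits each vertex only finitely often. Write $\tilde H_K=\inf\{t\ge 1: X_t\in K\}$. *Walks.* Let $\mathcal W$ be the set of all maps $w:\{i\in\mathbb Z: m\le i\le n\}\to V$ with nonempty domain, $-\infty\le m\le n\le\infty$, such that $w(i)$ and $w(i+1)$ are adjacent whenever both are defined and each vertex is visited finitely often. Let $\mathcal W[0,\infty)\subset\mathcal W$ be the countable set of walks with domain $\{0,\dots,n\}$, $0\le n<\infty$. For finite $K\subset V$ let $\mathcal W_K$ be the set of $w\in\mathcal W$ that visit $K$, and for $w\in\mathcal W_K$ let $w_K$ be the restriction of $w$ to the interval from its first to its last visit to $K$. Give $\mathcal W$ the topology generated by the sets $\{w\in\mathcal W_K: w_K=w'_K\}$ ($K$ finite, $w'\in\mathcal W_K$). Let $\pi:\mathcal W\to\mathcal W^*$ be the quotient by time shifts $w\mapsto w(\cdot+k)$, $k\in\mathbb Z$, with the quotient topology. *Point processes.* A counting measure takes values in $\{0,1,2,\dots\}\cup\{\infty\}$.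 Let $\Omega^{[0,\infty)}$ be the set of counting measures $\omega$ on $\mathcal W[0,\infty)$ with $\omega(\mathcal W_K\cap\mathcal W[0,\infty))<\infty$ for all finite $K$, and $\Omega^*$ the set of Borel counting measures $\omega$ on $\mathcal W^*$ with $\omega(\pi(\mathcal W_K))<\infty$ for all finite $K$, both with the $\sigma$-algebra generated by the evaluations $\omega\mapsto\omega(A)$, $A$ measurable. Give $\Omega^*$ the weak* topology, the coarsest one making all the maps $\omega\mapsto\omega(\pi(\{w\in\mathcal W_K: w_K=w'_K\}))$ continuous. The law of a Poisson point process with intensity $\mu$ on one of these spaces is a probability measure under which the restrictions of $\omega$ to the members of any sequence of pairwise disjoint measurable sets are independent and $\omega(A)$ is Poisson with mean $\mu(A)$ whenever $A$ is measurable with $\mu(A)<\infty$. *Finitary random interlacements.* For $T>0$ let $P^{(T)}_x$ be the law on $\mathcal W[0,\infty)$ of simple random walk started at $x$ and stopped at an independent time $N$ with $\mathbb P(N=n)=\frac1{T+1}\left(\frac T{T+1}\right)^n$, $n\ge0$, and let $\nu^{(T)}=\sum_{x\in V}\frac{\deg_x}{T+1}P_x^{(T)}$. *Random interlacements.* For finite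 $K\subset V$ let $Q_K$ be the measure on $\mathcal W$, supported on bi-infinite walks with $w(0)\in K$, such that for $x\in K$ and Borel sets $\mathcal A,\mathcal B$ of one-sided infinite walks, $$Q_K\big((w(-i))_{i\ge0}\in\mathcal A,\ w(0)=x,\ (w(i))_{i\ge0}\in\mathcal B\big)=\deg_x\,P_x(\mathcal A\cap\{\tilde H_K=\infty\})\,P_x(\mathcal B).$$ **Theorem.** There is a unique $\sigma$-finite Borel measure $Q^*$ on $\mathcal W^*$ with $Q^*(\mathcal A\cap\pi(\mathcal W_K))=Q_K(\pi^{-1}(\mathcal A))$ for all Borel $\mathcal A\subset\mathcal W^*$ and all finite $K\subset V$. Let $u>0$. There are a unique law $\mathbb P^*_u$ on $\Omega^*$ of a Poisson point process with intensity $uQ^*$ and, for each $T>0$, a unique law $\mathbb P_{u,T}$ on $\Omega^{[0,\infty)}$ of a Poisson point process with intensity $u\nu^{(T)}$. As $T\to\infty$, the image of $\mathbb P_{u,T}$ under $\Omega^{[0,\infty)}\to\Omega^*$, $\omega\mapsto\omega\circ\pi^{-1}$, converges to $\mathbb P^*_u$ in the weak* topology, that is, integrals of bounded continuous functions on $\Omega^*$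 converge. -/

import Mathlib

open MeasureTheory ProbabilityTheory Filter Topology
open scoped ENNReal

namespace Interlacement

/-! ### Walks on a graph, indexed by intervals of the integers -/

section Walks

variable {V : Type*} (G : SimpleGraph V)

/-- A partially defined function `w : ℤ → V` (the value `none` means undefined) is a walk on `G` if
its domain is a nonempty interval `{i : m ≤ i ≤ n}`, `-∞ ≤ m ≤ n ≤ ∞`, consecutive values are
adjacent, and each vertex is visited finitely often. -/
def IsWalk (w : ℤ → Option V) : Prop :=
  {i | w i ≠ none}.Nonempty ∧ {i | w i ≠ none}.OrdConnected ∧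
    (∀ i x y, w i = some x → w (i + 1) = some y → G.Adj x y) ∧
    ∀ x, {i | w i = some x}.Finite

/-- The space `𝓦` of finite, one-sided infinite and bi-infinite walks. -/
def WalkSpace : Type _ := {w : ℤ → Option V // IsWalk G w}

variable {G}

/-- `𝓦_K`: the walks that visit `K`. -/
def hit (K : Finset V) : Set (WalkSpace G) := {w | ∃ i, ∃ x ∈ K, w.1 i = some x}

/-- `w_K`: the restriction of `w` to the interval from its first to its last visit to `K`. -/
noncomputable def trunc (K : Finset V) (w : WalkSpace G) : ℤ → Option V := by
  classical
  exact fun i =>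
    if ∃ a b, a ≤ i ∧ i ≤ b ∧ (∃ x ∈ K, w.1 a = some x) ∧ (∃ y ∈ K, w.1 b = some y)
    then w.1 i else none

/-- `{w ∈ 𝓦_K : w_K = w'_K}`. -/
def cyl (K : Finset V) (w' : WalkSpace G) : Set (WalkSpace G) :=
  {w | w ∈ hit K ∧ trunc K w = trunc K w'}

instance : TopologicalSpace (WalkSpace G) :=
  TopologicalSpace.generateFrom {S | ∃ (K : Finset V) (w' : WalkSpace G), w' ∈ hit K ∧ S = cyl K w'}

instance : MeasurableSpace (WalkSpace G) := borel _

instance : BorelSpace (WalkSpace G) := ⟨rfl⟩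

/-- The time shift `(θ_k w)(i) = w (i + k)`. -/
def shift (k : ℤ) (w : WalkSpace G) : WalkSpace G :=
  ⟨fun i => w.1 (i + k), by
    obtain ⟨w, ⟨i, hi⟩, hc, ha, hf⟩ := w
    refine ⟨⟨i - k, by simpa using hi⟩, ⟨?_⟩, ?_, ?_⟩
    · intro a ha b hb c hcc
      exact hc.out (x := a + k) ha (y := b + k) hb
        ⟨by linarith [hcc.1], by linarith [hcc.2]⟩
    · intro i x y hx hy
      refine ha (i + k) x y hx ?_
      rw [← hy]
      congr 1
      ring
    · intro x
      exact (hf x).preimage (f := fun i : ℤ => i + k) (add_left_injective k).injOn⟩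

@[simp] lemma shift_apply (k : ℤ) (w : WalkSpace G) (i : ℤ) : (shift k w).1 i = w.1 (i + k) := rfl

lemma shift_zero (w : WalkSpace G) : shift 0 w = w := by
  apply Subtype.ext
  funext i
  simp

lemma shift_shift (k l : ℤ) (w : WalkSpace G) : shift k (shift l w) = shift (k + l) w := by
  apply Subtype.ext
  funext i
  simp [add_assoc]

variable (G) in
/-- Equality of walks up to a time shift. -/
def shiftSetoid : Setoid (WalkSpace G) where
  r w₁ w₂ := ∃ k, w₁ = shift k w₂
  iseqv :=
    { refl := fun w => ⟨0, (shift_zero w).symm⟩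
      symm := by
        rintro w₁ w₂ ⟨k, rfl⟩
        exact ⟨-k, by rw [shift_shift, neg_add_cancel, shift_zero]⟩
      trans := by
        rintro w₁ w₂ w₃ ⟨k, rfl⟩ ⟨l, rfl⟩
        exact ⟨k + l, shift_shift k l w₃⟩ }

variable (G) in
/-- The space `𝓦*` of walks modulo time shift. -/
def WalkSpaceMod : Type _ := Quotient (shiftSetoid G)

/-- The quotient map `π : 𝓦 → 𝓦*`. -/
def proj (w : WalkSpace G) : WalkSpaceMod G := Quotient.mk (shiftSetoid G) w

instance : TopologicalSpace (WalkSpaceMod G) :=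
  inferInstanceAs (TopologicalSpace (Quotient (shiftSetoid G)))

instance : MeasurableSpace (WalkSpaceMod G) := borel _

instance : BorelSpace (WalkSpaceMod G) := ⟨rfl⟩

/-- `π(𝓦_K)`. -/
def hitMod (K : Finset V) : Set (WalkSpaceMod G) := proj '' hit K

variable (G) in
/-- The sets `π({w ∈ 𝓦_K : w_K = w'_K})`, for `K` finite and `w' ∈ 𝓦_K`. -/
def cylMod : Set (Set (WalkSpaceMod G)) :=
  {S | ∃ (K : Finset V) (w' : WalkSpace G), w' ∈ hit K ∧ S = proj '' cyl K w'}

/-- The bi-infinite path following `p.2` at the times `i ≥ 0` and `p.1` backwards at `i < 0`. -/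
def glue (p : (ℕ → V) × (ℕ → V)) : ℤ → Option V :=
  fun i => some (if 0 ≤ i then p.2 i.toNat else p.1 (-i).toNat)

variable (G) in
/-- The pairs of one-sided paths that glue to a bi-infinite walk in `𝓦`. -/
def BiPath : Type _ := {p : (ℕ → V) × (ℕ → V) // IsWalk G (glue p)}

instance [MeasurableSpace V] : MeasurableSpace (BiPath G) :=
  inferInstanceAs (MeasurableSpace (Subtype _))

/-- The bi-infinite walk obtained by gluing. -/
def BiPath.toWalkSpace (p : BiPath G) : WalkSpace G := ⟨glue p.1, p.2⟩

/-! Helper facts: measurability and countability of these sets. -/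

lemma proj_eq_iff (w₁ w₂ : WalkSpace G) : proj w₁ = proj w₂ ↔ ∃ k, w₁ = shift k w₂ :=
  Quotient.eq (r := shiftSetoid G)

lemma shift_mem_hit {K : Finset V} {k : ℤ} {w : WalkSpace G} : shift k w ∈ hit K ↔ w ∈ hit K := by
  constructor
  · rintro ⟨i, x, hx, h⟩
    exact ⟨i + k, x, hx, h⟩
  · rintro ⟨i, x, hx, h⟩
    exact ⟨i - k, x, hx, by simpa using h⟩

lemma proj_preimage_hitMod (K : Finset V) : proj ⁻¹' (hitMod (G := G) K) = hit K := by
  ext w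
  constructor
  · rintro ⟨w₁, h₁, h⟩
    obtain ⟨k, rfl⟩ := (proj_eq_iff _ _).1 h
    exact shift_mem_hit.1 h₁
  · intro h
    exact ⟨w, h, rfl⟩

lemma trunc_shift (K : Finset V) (k : ℤ) (w : WalkSpace G) (i : ℤ) :
    trunc K (shift k w) i = trunc K w (i + k) := by
  unfold trunc
  simp only [shift_apply]
  congr 1
  apply propext
  constructor
  · rintro ⟨a, b, h₁, h₂, h₃, h₄⟩
    exact ⟨a + k, b + k, by linarith, by linarith, h₃, h₄⟩
  · rintro ⟨a, b, h₁, h₂, h₃, h₄⟩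
    exact ⟨a - k, b - k, by linarith, by linarith, by simpa using h₃, by simpa using h₄⟩

lemma isOpen_proj_cyl {K : Finset V} {w' : WalkSpace G} (hw : w' ∈ hit K) :
    IsOpen (proj '' cyl K w') := by
  have h : proj ⁻¹' (proj '' cyl K w') = ⋃ k : ℤ, cyl K (shift k w') := by
    ext w
    simp only [Set.mem_preimage, Set.mem_image, Set.mem_iUnion]
    constructor
    · rintro ⟨w₁, ⟨h₁, h₂⟩, h⟩
      obtain ⟨k, rfl⟩ := (proj_eq_iff _ _).1 h.symm
      refine ⟨k, shift_mem_hit.2 h₁, ?_⟩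
      funext i
      rw [trunc_shift, trunc_shift, h₂]
    · rintro ⟨k, h₁, h₂⟩
      refine ⟨shift (-k) w, ⟨shift_mem_hit.2 h₁, ?_⟩, (proj_eq_iff _ _).2 ⟨-k, rfl⟩⟩
      funext i
      rw [trunc_shift, h₂, trunc_shift]
      simp
  have h' : IsOpen (proj ⁻¹' (proj '' cyl K w')) := by
    rw [h]
    exact isOpen_iUnion fun k =>
      TopologicalSpace.isOpen_generateFrom_of_mem ⟨K, shift k w', shift_mem_hit.2 hw, rfl⟩
  exact h'

lemma measurableSet_of_mem_cylMod {S : Set (WalkSpaceMod G)} (hS : S ∈ cylMod G) :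
    MeasurableSet S := by
  obtain ⟨K, w', hw, rfl⟩ := hS
  exact (isOpen_proj_cyl hw).measurableSet

lemma measurableSet_hitMod (K : Finset V) : MeasurableSet (hitMod (G := G) K) := by
  have h : hitMod (G := G) K = ⋃ w' ∈ hit (G := G) K, proj '' cyl K w' := by
    ext p
    simp only [Set.mem_iUnion]
    constructor
    · rintro ⟨w, hw, rfl⟩
      exact ⟨w, hw, w, ⟨hw, rfl⟩, rfl⟩
    · rintro ⟨w', _, w, ⟨hw, _⟩, rfl⟩
      exact ⟨w, hw, rfl⟩
  rw [h]
  exact (isOpen_biUnion fun w' hw => isOpen_proj_cyl hw).measurableSet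

lemma finite_trunc (K : Finset V) (w : WalkSpace G) :
    {p : ℤ × V | trunc K w p.1 = some p.2}.Finite := by
  have hA : {i | ∃ x ∈ K, w.1 i = some x}.Finite := by
    have h : {i | ∃ x ∈ K, w.1 i = some x} = ⋃ x ∈ K, {i | w.1 i = some x} := by
      ext i
      simp
    rw [h]
    exact K.finite_toSet.biUnion fun x _ => w.2.2.2.2 x
  obtain ⟨m, hm⟩ := hA.bddBelow
  obtain ⟨n, hn⟩ := hA.bddAbove
  have hB : {i | trunc K w i ≠ none}.Finite := by
    refine (Set.finite_Icc m n).subset fun i hi => ?_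
    by_contra hc
    refine hi ?_
    unfold trunc
    rw [if_neg]
    rintro ⟨a, b, h₁, h₂, h₃, h₄⟩
    exact hc ⟨(hm h₃).trans h₁, h₂.trans (hn h₄)⟩
  refine Set.Finite.of_finite_image (f := Prod.fst) (hB.subset ?_) ?_
  · rintro _ ⟨p, hp, rfl⟩
    simp only [Set.mem_ofPred_eq] at hp ⊢
    simp [hp]
  · rintro ⟨i, x⟩ hp ⟨j, y⟩ hq h
    simp only [Set.mem_ofPred_eq] at hp hq h
    subst h
    rw [hp] at hq
    simpa using hq

instance [Countable V] : Countable (cylMod G) := by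
  have h : cylMod G ⊆ Set.range fun q : Finset V × Finset (ℤ × V) =>
      proj '' {w : WalkSpace G | w ∈ hit q.1 ∧ {p : ℤ × V | trunc q.1 w p.1 = some p.2} = q.2} := by
    rintro _ ⟨K, w', hw, rfl⟩
    refine ⟨(K, (finite_trunc K w').toFinset), ?_⟩
    refine congrArg (Set.image proj) (Set.ext fun w => ?_)
    simp only [Set.Finite.coe_toFinset, cyl, Set.mem_ofPred_eq]
    refine and_congr_right fun _ => ⟨fun h => ?_, fun h => by rw [h]⟩
    funext i
    apply Option.ext
    intro x
    exact Set.ext_iff.1 h (i, x)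
  exact ((Set.countable_range _).mono h).to_subtype

end Walks

/-! ### Locally finite counting measures and Poisson point processes -/

section PointProcesses

/-- The counting measures (measures with values in `ℕ ∪ {∞}`) on `X` that are finite on every set of
the family `B`, with the sigma-algebra generated by the evaluations at measurable sets. -/
def CountingMeasure {ι X : Type*} [MeasurableSpace X] (B : ι → Set X) : Type _ :=
  {ω : Measure X // (∀ A, MeasurableSet A → ∃ n : ℕ∞, ω A = (n : ℝ≥0∞)) ∧ ∀ i, ω (B i) < ∞}

instance {ι X : Type*} [MeasurableSpace X] (B : ι → Set X) : MeasurableSpace (CountingMeasure B) :=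
  inferInstanceAs (MeasurableSpace (Subtype _))

/-- `P` is the law of a Poisson point process with intensity measure `μ`. -/
def IsPoissonLaw {ι X : Type*} [MeasurableSpace X] {B : ι → Set X} (μ : Measure X)
    (P : Measure (CountingMeasure B)) : Prop :=
  (∀ A : ℕ → Set X, (∀ i, MeasurableSet (A i)) → Pairwise (fun i j => Disjoint (A i) (A j)) →
    iIndepFun (fun i (ω : CountingMeasure B) => ω.1.restrict (A i)) P) ∧
  ∀ A : Set X, MeasurableSet A → μ A < ∞ → ∀ n : ℕ,
    P {ω | ω.1 A = n} = ENNReal.ofReal (Real.exp (-(μ A).toReal) * (μ A).toReal ^ n / n.factorial)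

end PointProcesses

/-! ### The configuration space `Ω*` -/

section Configurations

variable {V : Type*} (G : SimpleGraph V)

/-- `Ω*`: the locally finite counting measures on `𝓦*`. -/
abbrev ConfigMod : Type _ := CountingMeasure (hitMod (G := G))

/-- The weak* topology of `Ω*`: the topology of convergence of the values at the sets
`π({w ∈ 𝓦_K : w_K = w'_K})`. -/
instance : TopologicalSpace (ConfigMod G) :=
  TopologicalSpace.induced (fun ω (S : cylMod G) => ω.1 S.1) inferInstance

instance [Countable V] : OpensMeasurableSpace (ConfigMod G) := by
  constructor
  refine MeasurableSpace.generateFrom_le ?_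
  rintro _ ⟨t, ht, rfl⟩
  have hm : Measurable fun (ω : ConfigMod G) (S : cylMod G) => ω.1 S.1 :=
    measurable_pi_iff.2 fun S =>
      (Measure.measurable_coe (measurableSet_of_mem_cylMod S.2)).comp measurable_subtype_coe
  exact hm ht.measurableSet

end Configurations

/-! ### Finite walks and finitary random interlacements -/

section Finitary

variable {V : Type*} (G : SimpleGraph V)

/-- `𝓦[0,∞)`: the finite walks with domain `{0, …, n}`, `n ∈ ℕ`, as a discrete space. -/
def FinWalk : Type _ := Σ x y : V, G.Walk x y

instance : MeasurableSpace (FinWalk G) := ⊤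

variable {G}

namespace FinWalk

/-- The length of a finite walk. -/
def len (w : FinWalk G) : ℕ := w.2.2.length

/-- The vertex at time `k` (the last vertex if `k` exceeds the length). -/
def vert (w : FinWalk G) (k : ℕ) : V := w.2.2.getVert k

/-- A finite walk as an element of `𝓦`. -/
def toWalkSpace (w : FinWalk G) : WalkSpace G :=
  ⟨fun i => if 0 ≤ i ∧ i ≤ w.len then some (w.vert i.toNat) else none, by
    refine ⟨⟨0, by simp⟩, ⟨?_⟩, ?_, ?_⟩
    · intro a ha b hb c hc
      simp only [ne_eq, ite_eq_right_iff, reduceCtorEq, imp_false, not_not,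
        Set.mem_ofPred_eq] at ha hb ⊢
      exact ⟨ha.1.trans hc.1, hc.2.trans hb.2⟩
    · intro i x y hx hy
      simp only [Option.ite_none_right_eq_some, Option.some.injEq] at hx hy
      obtain ⟨⟨h₁, h₂⟩, rfl⟩ := hx
      obtain ⟨⟨h₃, h₄⟩, rfl⟩ := hy
      lift i to ℕ using h₁
      have h : ((i : ℤ) + 1).toNat = i + 1 := by omega
      rw [h]
      refine w.2.2.adj_getVert_succ ?_
      unfold len at h₄
      simp only [Int.toNat_natCast]
      omega
    · intro x
      refine (Set.finite_Icc (0 : ℤ) w.len).subset fun i hi => ?_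
      simp only [Option.ite_none_right_eq_some, Set.mem_ofPred_eq] at hi
      exact hi.1⟩

end FinWalk

/-- The finite walks that visit `K`. -/
def hitFin (K : Finset V) : Set (FinWalk G) := FinWalk.toWalkSpace ⁻¹' hit K

variable (G) in
/-- `Ω^{[0,∞)}`: the locally finite counting measures on `𝓦[0,∞)`. -/
abbrev ConfigFin : Type _ := CountingMeasure (hitFin (G := G))

/-- Finite walks modulo time shift. -/
def projFin (w : FinWalk G) : WalkSpaceMod G := proj w.toWalkSpace

lemma measurable_projFin : Measurable (projFin (G := G)) := fun _ _ => trivial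

/-- The map `Ω^{[0,∞)} → Ω*`, `ω ↦ ω ∘ π⁻¹`. -/
noncomputable def push (ω : ConfigFin G) : ConfigMod G :=
  ⟨ω.1.map projFin, by
    refine ⟨fun A hA => ?_, fun K => ?_⟩
    · rw [Measure.map_apply measurable_projFin hA]
      exact ω.2.1 _ (measurable_projFin hA)
    · rw [Measure.map_apply measurable_projFin (measurableSet_hitMod K)]
      have h : projFin ⁻¹' hitMod (G := G) K = hitFin K := by
        change FinWalk.toWalkSpace ⁻¹' (proj ⁻¹' hitMod K) = _
        rw [proj_preimage_hitMod]
        rfl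
      rw [h]
      exact ω.2.2 K⟩

lemma measurable_push : Measurable (push (G := G)) :=
  ((Measure.measurable_map _ measurable_projFin).comp measurable_subtype_coe).subtype_mk

variable (G) [G.LocallyFinite]

open scoped Classical in
/-- `P^n_x`: the law of simple random walk started from `x` and stopped at time `n`. -/
noncomputable def stoppedLaw (n : ℕ) (x : V) : Measure (FinWalk G) :=
  Measure.sum fun w : FinWalk G =>
    (if w.len = n ∧ w.vert 0 = x then ∏ k ∈ Finset.range n, ((G.degree (w.vert k) : ℝ≥0∞))⁻¹ else 0) •
      Measure.dirac w

/-- `P^{(T)}_x`: the law of simple random walk started from `x` and stopped at an independent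
time `N` with `P(N = n) = (T + 1)⁻¹ (T / (T + 1)) ^ n`. -/
noncomputable def geomLaw (T : ℝ) (x : V) : Measure (FinWalk G) :=
  ENNReal.ofReal (1 / (T + 1)) •
    Measure.sum fun n : ℕ => ENNReal.ofReal ((T / (T + 1)) ^ n) • stoppedLaw G n x

/-- `ν^{(T)} = ∑_x deg(x) / (T + 1) P^{(T)}_x`. -/
noncomputable def finitaryIntensity (T : ℝ) : Measure (FinWalk G) :=
  Measure.sum fun x : V => ENNReal.ofReal (G.degree x / (T + 1)) • geomLaw G T x

end Finitary

/-! ### Simple random walk and the intensity measure of random interlacements -/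

section Infinite

variable {V : Type*} [Countable V] [MeasurableSpace V] [DiscreteMeasurableSpace V]
  (G : SimpleGraph V) [G.LocallyFinite]

open scoped Classical in
/-- One step of simple random walk: a uniformly random neighbour (an isolated vertex, which has
none, is absorbing). -/
noncomputable def stepPMF (x : V) : PMF V :=
  if h : (G.neighborFinset x).Nonempty then PMF.uniformOfFinset _ h else PMF.pure x

/-- The transition kernel of simple random walk. -/
noncomputable def stepKernel : Kernel V V := Kernel.ofFunOfCountable fun x => (stepPMF G x).toMeasure

instance : IsMarkovKernel (stepKernel G) :=
  ⟨fun x => inferInstanceAs (IsProbabilityMeasure (stepPMF G x).toMeasure)⟩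

/-- The law `P_x` of simple random walk `(X_0, X_1, …)` started from `x`, on `ℕ → V`. -/
noncomputable def srwLaw (x : V) : Measure (ℕ → V) :=
  Kernel.trajMeasure (X := fun _ => V) (Measure.dirac x) fun n =>
    (stepKernel G).comap (fun h => h ⟨n, Finset.mem_Iic.2 le_rfl⟩) (measurable_pi_apply _)

/-- `G` is transient: simple random walk almost surely visits each vertex finitely often. -/
def IsTransient : Prop := ∀ x y : V, ∀ᵐ a ∂(srwLaw G x), {n | a n = y}.Finite

/-- `Q_K`: for `x ∈ K`, with total mass `deg(x) P_x(H̃_K = ∞)`, the path after time `0` has law `P_x`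
and the time reversal of the path before time `0` has, independently, law `P_x` restricted to the
event `H̃_K = ∞` of not visiting `K` at times `t ≥ 1`. -/
noncomputable def hitIntensity (K : Finset V) : Measure (WalkSpace G) :=
  ∑ x ∈ K, (G.degree x : ℝ≥0∞) •
    ((((srwLaw G x).restrict {a | ∀ t : ℕ, 1 ≤ t → a t ∉ K}).prod (srwLaw G x)).comap
      (Subtype.val : BiPath G → (ℕ → V) × (ℕ → V))).map BiPath.toWalkSpace

/-- `Q` is an intensity measure of random interlacements: it is sigma-finite, and
`Q(A ∩ π(𝓦_K)) = Q_K(π⁻¹(A))` for all Borel `A ⊆ 𝓦*` and all finite `K`. -/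
def IsInterlacementIntensity (Q : Measure (WalkSpaceMod G)) : Prop :=
  SigmaFinite Q ∧ ∀ (A : Set (WalkSpaceMod G)) (K : Finset V), MeasurableSet A →
    Q (A ∩ hitMod K) = hitIntensity G K (proj ⁻¹' A)

end Infinite

end Interlacement

/-! A Poisson law is determined by the probabilities of prescribing the counts on finitely many sets
of finite intensity. Cutting the sets into the disjoint atoms of the family shows that such a
probability is a finite sum of products of Poisson weights, hence a continuous function of the
intensities of the atoms. On `Ω*` the evaluations at the sets that define the weak* topology are
integer valued, so prescribing finitely many of them is an open condition, and convergence of the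
probabilities of these events is enough for weak* convergence (`tendsto_configMod`,
`tendsto_counts`). The limit theorem thus reduces to convergence of the intensities on atoms of
cylinder sets.

A walk that hits a finite set `K` has, modulo shift, a trace: the finite walk `γ` from its first to
its last visit to `K`. The sets `traceSet K γ` form a countable open partition of `π(𝓦_K)`, and the
sets to be measured are unions of them once `K` is large (`IsSaturated`). Write `w(γ)` for the
product of `1 / deg` over all vertices of `γ` but the last, `n` for its length, and `e_K(x) =
P_x(H̃_K = ∞)`. Cutting at the first visit to `K` and reversing the first piece gives, for `K ⊆ M`
and `γ` visiting `K` with both ends in `M`, that `Q_K` gives `traceSet M γ` the mass `deg(γ_0) w(γ)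
e_M(γ_0) e_M(γ_n)` (`hitIntensity_traceSet`). The value does not involve `K`, so the measures `Q_K`
are consistent and glue to `Q*`.

On the finitary side, `ν^(T)` gives a walk `γ` the mass `deg(γ_0) w(γ) (T+1)⁻² (T/(T+1))^n`. A walk
with trace `γ` is a reversed walk `η`, then `γ`, then a walk `ξ`, where `η` and `ξ` avoid `K` at
positive times. One factor `(T+1)⁻¹` goes to each end, and summing over `η` and `ξ` produces the
escape probabilities of a geometrically stopped walk, which tend to `e_K` as `T → ∞`. This yields
lower bounds for the traces that converge to the `Q*`-masses. The total mass of walks hitting `K` is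
bounded above by a quantity that converges to the capacity `∑ deg(x) e_K(x) = Q*(π(𝓦_K))`. No mass
can therefore be gained or lost, and all unions of traces converge
(`tendsto_measure_of_isSaturated`).

Existence of Poisson laws is classical: a Poisson number of independent points for finite intensity,
then a superposition of independent pieces. Uniqueness is a π-λ argument on count events. -/

namespace Interlacement

/-! ### Counts of a point process on finite families of sets -/

section Counts

variable {ι X : Type*}

/-- The points that lie exactly in those members of the family `A` whose index is in `S`. -/
def atom {κ : Type*} (A : κ → Set X) (S : Finset κ) : Set X := {x | ∀ i, x ∈ A i ↔ i ∈ S}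

lemma atom_subset {κ : Type*} {A : κ → Set X} {S : Finset κ} {i : κ} (hi : i ∈ S) :
    atom A S ⊆ A i := fun _ hx => (hx i).2 hi

lemma disjoint_atom {κ : Type*} {A : κ → Set X} {S S' : Finset κ} (h : S ≠ S') :
    Disjoint (atom A S) (atom A S') :=
  Set.disjoint_left.2 fun _ hx hx' => h (Finset.ext fun i => (hx i).symm.trans (hx' i))

variable [MeasurableSpace X] {B : ι → Set X}

/-- The Poisson weight `exp(-a) a ^ n / n!` of an extended nonnegative mean `a`. -/
noncomputable def poissonWeight (a : ℝ≥0∞) (n : ℕ) : ℝ≥0∞ :=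
  ENNReal.ofReal (Real.exp (-a.toReal) * a.toReal ^ n / n.factorial)

lemma poissonWeight_ne_top (a : ℝ≥0∞) (n : ℕ) : poissonWeight a n ≠ ∞ := ENNReal.ofReal_ne_top

lemma measurable_count {A : Set X} (hA : MeasurableSet A) :
    Measurable fun ω : CountingMeasure B => ω.1 A :=
  (Measure.measurable_coe hA).comp measurable_subtype_coe

lemma measurableSet_count_eq {A : Set X} (hA : MeasurableSet A) (a : ℝ≥0∞) :
    MeasurableSet {ω : CountingMeasure B | ω.1 A = a} :=
  measurable_count hA (measurableSet_singleton a)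

lemma measurableSet_counts_eq {κ : Type*} [Countable κ] {A : κ → Set X}
    (hA : ∀ i, MeasurableSet (A i)) (n : κ → ℕ) :
    MeasurableSet {ω : CountingMeasure B | ∀ i, ω.1 (A i) = n i} := by
  rw [Set.ofPred_forall]
  exact MeasurableSet.iInter fun i => measurableSet_count_eq (hA i) _

lemma measurableSet_atom {κ : Type*} [Countable κ] {A : κ → Set X}
    (hA : ∀ i, MeasurableSet (A i)) (S : Finset κ) : MeasurableSet (atom A S) := by
  have h : atom A S = ⋂ i, {x | x ∈ A i ↔ i ∈ S} := by
    ext x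
    simp [atom]
  rw [h]
  exact MeasurableSet.iInter fun i => (hA i).iff (MeasurableSet.const _)

open scoped Classical in
lemma measure_eq_sum_atom {κ : Type*} [Fintype κ] {A : κ → Set X}
    (hA : ∀ i, MeasurableSet (A i)) (ω : Measure X) (i : κ) :
    ω (A i) = ∑ S : {S : Finset κ // S.Nonempty} with i ∈ S.1, ω (atom A S.1) := by
  have h : A i = ⋃ S ∈ Finset.univ.filter fun S : {S : Finset κ // S.Nonempty} => i ∈ S.1,
      atom A S.1 := by
    ext x
    simp only [Finset.mem_filter, Finset.mem_univ, true_and, Set.mem_iUnion, exists_prop]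
    constructor
    · intro hx
      exact ⟨⟨Finset.univ.filter fun j => x ∈ A j, i, by simpa using hx⟩, by simpa using hx,
        fun j => by simp⟩
    · rintro ⟨S, hi, hx⟩
      exact atom_subset hi hx
  conv_lhs => rw [h]
  exact measure_biUnion_finset
    (fun S _ S' _ hS => disjoint_atom fun h => hS (Subtype.ext h))
    fun S _ => measurableSet_atom hA S.1

open scoped Classical in
/-- The counts on the atoms of a finite family that give the counts `n` on the family. -/
noncomputable def admissible {κ : Type*} [Fintype κ] (n : κ → ℕ) :
    Finset ({S : Finset κ // S.Nonempty} → ℕ) :=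
  -- The bound only serves to make the family finite: every index set is nonempty, so a count on an
  -- atom is at most some `n i`.
  (Fintype.piFinset fun _ => Finset.range (∑ i, n i + 1)).filter
    fun c => ∀ i, ∑ S : {S : Finset κ // S.Nonempty} with i ∈ S.1, c S = n i

/-- An atom with nonempty index set lies in some `A i`, whose count is finite, so its own count is a
natural number. Points outside all `A i` are irrelevant, which is why the empty index set is left
out and why no finiteness of the whole configuration is needed. -/
lemma counts_eq_iUnion {κ : Type*} [Fintype κ] {A : κ → Set X}
    (hA : ∀ i, MeasurableSet (A i)) (n : κ → ℕ) :
    {ω : CountingMeasure B | ∀ i, ω.1 (A i) = n i} =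
      ⋃ c ∈ admissible n, {ω : CountingMeasure B | ∀ S, ω.1 (atom A S.1) = c S} := by
  classical
  ext ω
  simp only [Set.mem_ofPred_eq, Set.mem_iUnion, exists_prop]
  constructor
  · intro h
    have hle : ∀ S : {S : Finset κ // S.Nonempty}, ∃ i ∈ S.1, ω.1 (atom A S.1) ≤ n i := by
      rintro ⟨S, i, hi⟩
      exact ⟨i, hi, (measure_mono (atom_subset hi)).trans (h i).le⟩
    have hc : ∀ S : {S : Finset κ // S.Nonempty}, ∃ m : ℕ, ω.1 (atom A S.1) = m := by
      intro S
      obtain ⟨m, hm⟩ := ω.2.1 _ (measurableSet_atom hA S.1)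
      obtain ⟨i, -, hi⟩ := hle S
      rw [hm] at hi
      induction m using ENat.recTopCoe with
      | top => simp at hi
      | coe m => exact ⟨m, by simpa using hm⟩
    choose c hc using hc
    refine ⟨c, ?_, hc⟩
    refine Finset.mem_filter.2 ⟨?_, fun i => ?_⟩
    · rw [Fintype.mem_piFinset]
      intro S
      obtain ⟨i, -, hi⟩ := hle S
      rw [hc S, Nat.cast_le] at hi
      exact Finset.mem_range.2 (Nat.lt_succ_of_le
        (hi.trans (Finset.single_le_sum (f := n) (fun _ _ => Nat.zero_le _) (Finset.mem_univ i))))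
    · have := h i
      rw [measure_eq_sum_atom hA] at this
      simp only [hc] at this
      exact_mod_cast this
  · rintro ⟨c, hc, h⟩ i
    rw [measure_eq_sum_atom hA]
    simp only [h]
    exact_mod_cast (Finset.mem_filter.1 hc).2 i

lemma disjoint_counts {κ : Type*} {A : κ → Set X} {c c' : κ → ℕ} (h : c ≠ c') :
    Disjoint {ω : CountingMeasure B | ∀ i, ω.1 (A i) = c i} {ω : CountingMeasure B | ∀ i, ω.1 (A i) = c' i} := by
  refine Set.disjoint_left.2 fun ω hω hω' => h (funext fun i => ?_)
  have := (hω i).symm.trans (hω' i)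
  exact_mod_cast this

/-- The counts on finitely many disjoint sets of finite intensity are independent Poisson. -/
def HasPoissonCounts (μ : Measure X) (P : Measure (CountingMeasure B)) : Prop :=
  ∀ (m : ℕ) (C : Fin m → Set X), (∀ j, MeasurableSet (C j)) →
    Pairwise (fun i j => Disjoint (C i) (C j)) → (∀ j, μ (C j) < ∞) → ∀ c : Fin m → ℕ,
      P {ω : CountingMeasure B | ∀ j, ω.1 (C j) = c j} = ∏ j, poissonWeight (μ (C j)) (c j)

variable {μ : Measure X} {P P' : Measure (CountingMeasure B)}

lemma HasPoissonCounts.apply (h : HasPoissonCounts μ P) {J : Type*} [Fintype J] {C : J → Set X}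
    (hC : ∀ j, MeasurableSet (C j)) (hd : Pairwise (fun i j => Disjoint (C i) (C j)))
    (hf : ∀ j, μ (C j) < ∞) (c : J → ℕ) :
    P {ω : CountingMeasure B | ∀ j, ω.1 (C j) = c j} = ∏ j, poissonWeight (μ (C j)) (c j) := by
  let e := (Fintype.equivFin J).symm
  have := h _ (C ∘ e) (fun j => hC _) (fun i j hij => hd (e.injective.ne hij)) (fun j => hf _)
    (c ∘ e)
  simp only [Function.comp_apply] at this
  rw [e.prod_comp fun j => poissonWeight (μ (C j)) (c j)] at this
  rw [← this]
  congr 1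
  ext ω
  exact e.forall_congr_right.symm

lemma measure_atom_lt_top {κ : Type*} {A : κ → Set X} (hf : ∀ i, μ (A i) < ∞)
    (S : {S : Finset κ // S.Nonempty}) : μ (atom A S.1) < ∞ := by
  obtain ⟨S, i, hi⟩ := S
  exact (measure_mono (atom_subset hi)).trans_lt (hf i)

/-- The reduction from overlapping to disjoint sets. Uniqueness, independence of restrictions and
the limit theorem all rest on this formula. -/
lemma HasPoissonCounts.apply_atoms (h : HasPoissonCounts μ P) {κ : Type*} [Fintype κ]
    {A : κ → Set X} (hA : ∀ i, MeasurableSet (A i)) (hf : ∀ i, μ (A i) < ∞) (n : κ → ℕ) :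
    P {ω : CountingMeasure B | ∀ i, ω.1 (A i) = n i} =
      ∑ c ∈ admissible n, ∏ S : {S : Finset κ // S.Nonempty}, poissonWeight (μ (atom A S.1)) (c S) := by
  rw [counts_eq_iUnion hA, measure_biUnion_finset (fun c _ c' _ hc => disjoint_counts hc)
    fun c _ => measurableSet_counts_eq (fun S : {S : Finset κ // S.Nonempty} => measurableSet_atom hA S.1) _]
  exact Finset.sum_congr rfl fun c _ => h.apply (fun S => measurableSet_atom hA S.1)
    (fun S S' hS => disjoint_atom fun h => hS (Subtype.ext h)) (measure_atom_lt_top hf) c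

/-- The events that prescribe the counts on finitely many subsets of `A` of finite intensity. -/
def countEvents (B : ι → Set X) (μ : Measure X) (A : Set X) : Set (Set (CountingMeasure B)) :=
  {E | ∃ F : Finset (Set X × ℕ), (∀ p ∈ F, MeasurableSet p.1 ∧ p.1 ⊆ A ∧ μ p.1 < ∞) ∧
    E = {ω : CountingMeasure B | ∀ p : F, ω.1 p.1.1 = p.1.2}}

lemma isPiSystem_countEvents (A : Set X) : IsPiSystem (countEvents B μ A) := by
  classical
  rintro _ ⟨F, hF, rfl⟩ _ ⟨F', hF', rfl⟩ -
  refine ⟨F ∪ F', fun p hp => (Finset.mem_union.1 hp).elim (hF p) (hF' p), ?_⟩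
  ext ω
  simp [or_imp, forall_and]

lemma countEvents_mono {A A' : Set X} (h : A ⊆ A') :
    countEvents B μ A ⊆ countEvents B μ A' := by
  rintro _ ⟨F, hF, rfl⟩
  exact ⟨F, fun p hp => ⟨(hF p hp).1, (hF p hp).2.1.trans h, (hF p hp).2.2⟩, rfl⟩

/-- Count events prescribe natural numbers only. The value `∞` is recovered as the complement,
because a counting measure takes no other values, and the remaining preimages are countable unions.
-/
lemma measurable_count_countEvents {A D : Set X} (hD : MeasurableSet D) (hDA : D ⊆ A)
    (hf : μ D < ∞) :
    Measurable[MeasurableSpace.generateFrom (countEvents B μ A)]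
      fun ω : CountingMeasure B => ω.1 D := by
  have h1 : ∀ n : ℕ, MeasurableSet[MeasurableSpace.generateFrom (countEvents B μ A)]
      {ω : CountingMeasure B | ω.1 D = n} := fun n =>
    MeasurableSpace.measurableSet_generateFrom ⟨{(D, n)}, by simp [hD, hDA, hf], by simp⟩
  have h2 : ∀ n : ℕ∞, MeasurableSet[MeasurableSpace.generateFrom (countEvents B μ A)]
      {ω : CountingMeasure B | ω.1 D = n} := by
    intro n
    induction n using ENat.recTopCoe with
    | coe n => simpa using h1 n
    | top =>
      have h : {ω : CountingMeasure B | ω.1 D = ((⊤ : ℕ∞) : ℝ≥0∞)} =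
          (⋃ n : ℕ, {ω : CountingMeasure B | ω.1 D = n})ᶜ := by
        ext ω
        simp only [Set.mem_ofPred_eq, Set.mem_compl_iff, Set.mem_iUnion, not_exists]
        constructor
        · intro h n
          simp [h]
        · intro h
          obtain ⟨m, hm⟩ := ω.2.1 D hD
          induction m using ENat.recTopCoe with
          | top => exact hm
          | coe m => exact absurd (by simpa using hm) (h m)
      rw [h]
      exact (MeasurableSet.iUnion h1).compl
  intro s _
  have h : (fun ω : CountingMeasure B => ω.1 D) ⁻¹' s =
      ⋃ n : {n : ℕ∞ // (n : ℝ≥0∞) ∈ s}, {ω : CountingMeasure B | ω.1 D = (n.1 : ℝ≥0∞)} := by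
    ext ω
    simp only [Set.mem_preimage, Set.mem_iUnion, Set.mem_ofPred_eq]
    constructor
    · intro h
      obtain ⟨m, hm⟩ := ω.2.1 D hD
      exact ⟨⟨m, hm ▸ h⟩, hm⟩
    · rintro ⟨n, hn⟩
      rw [hn]
      exact n.2
  rw [h]
  exact MeasurableSet.iUnion fun n => h2 _

/-- Restricting attention to sets of finite intensity loses nothing: along a disjoint exhaustion of
`X` by sets of finite `μ`-measure, the count of any measurable set is a countable sum of counts on
sets of finite intensity. -/
lemma comap_restrict_eq [SigmaFinite μ] {A : Set X} (hA : MeasurableSet A) :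
    MeasurableSpace.comap (fun ω : CountingMeasure B => ω.1.restrict A) inferInstance =
      MeasurableSpace.generateFrom (countEvents B μ A) := by
  apply le_antisymm
  · rw [← measurable_iff_comap_le]
    let _ := MeasurableSpace.generateFrom (countEvents B μ A)
    refine Measure.measurable_of_measurable_coe _ fun E hE => ?_
    set D := disjointed (spanningSets μ) with hDdef
    have hD : ∀ n, MeasurableSet (D n) := fun n =>
      MeasurableSet.disjointed (measurableSet_spanningSets μ) n
    have h : ∀ ω : CountingMeasure B,
        ω.1.restrict A E = ∑' n, ω.1 (E ∩ A ∩ D n) := by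
      intro ω
      rw [Measure.restrict_apply hE, ← measure_iUnion, ← Set.inter_iUnion, hDdef,
        iUnion_disjointed, iUnion_spanningSets, Set.inter_univ]
      · intro i j hij
        exact (disjoint_disjointed _ hij).mono Set.inter_subset_right Set.inter_subset_right
      · exact fun n => (hE.inter hA).inter (hD n)
    simp only [h]
    refine Measurable.tsum fun n => measurable_count_countEvents ((hE.inter hA).inter (hD n))
      (Set.inter_subset_left.trans Set.inter_subset_right) ?_
    exact (measure_mono (Set.inter_subset_right.trans (disjointed_subset _ n))).trans_lt
      (measure_spanningSets_lt_top μ n)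
  · refine MeasurableSpace.generateFrom_le ?_
    rintro _ ⟨F, hF, rfl⟩
    refine ⟨{ν : Measure X | ∀ p : F, ν p.1.1 = p.1.2}, ?_, ?_⟩
    · rw [Set.ofPred_forall]
      exact MeasurableSet.iInter fun p =>
        Measure.measurable_coe (hF p p.2).1 (measurableSet_singleton _)
    · ext ω
      simp only [Set.preimage_ofPred_eq, Set.mem_ofPred_eq]
      refine forall_congr' fun p => ?_
      rw [Measure.restrict_apply (hF p p.2).1, Set.inter_eq_left.2 (hF p p.2).2.1]

lemma measurableSpace_eq_generateFrom [SigmaFinite μ] :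
    (inferInstance : MeasurableSpace (CountingMeasure B)) =
      MeasurableSpace.generateFrom (countEvents B μ Set.univ) := by
  rw [← comap_restrict_eq MeasurableSet.univ]
  simp only [Measure.restrict_univ]
  rfl

lemma HasPoissonCounts.unique [SigmaFinite μ] [IsProbabilityMeasure P] [IsProbabilityMeasure P']
    (h : HasPoissonCounts μ P) (h' : HasPoissonCounts μ P') : P = P' := by
  refine ext_of_generate_finite _ (measurableSpace_eq_generateFrom (μ := μ))
    (isPiSystem_countEvents _) ?_ (by simp)
  rintro _ ⟨F, hF, rfl⟩
  rw [h.apply_atoms (fun p : F => (hF p p.2).1) (fun p => (hF p p.2).2.2) fun p => p.1.2,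
    h'.apply_atoms (fun p : F => (hF p p.2).1) (fun p => (hF p p.2).2.2) fun p => p.1.2]

lemma IsPoissonLaw.hasPoissonCounts (h : IsPoissonLaw μ P) : HasPoissonCounts μ P := by
  intro m C hC hd hf c
  -- The definition of a Poisson law speaks of infinite sequences of disjoint sets, so the finite
  -- family is padded with empty sets.
  let A : ℕ → Set X := fun i => if hi : i < m then C ⟨i, hi⟩ else ∅
  have hA' : ∀ j : Fin m, A j = C j := fun j => by simp [A]
  have hA : ∀ i, MeasurableSet (A i) := by
    intro i
    by_cases hi : i < m
    · simpa [A, hi] using hC _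
    · simp [A, hi]
  have hAd : Pairwise (fun i j => Disjoint (A i) (A j)) := by
    intro i j hij
    by_cases hi : i < m
    · by_cases hj : j < m
      · simpa [A, hi, hj] using hd (by simpa using hij)
      · simp [A, hj]
    · simp [A, hi]
  have key := (h.1 A hA hAd).precomp (Fin.val_injective (n := m))
  have key2 := key.measure_inter_preimage_eq_mul Finset.univ
    (sets := fun j => {ν : Measure X | ν (C j) = c j})
    fun j _ => Measure.measurable_coe (hC j) (measurableSet_singleton _)
  have hset : ∀ j : Fin m, (fun ω : CountingMeasure B => ω.1.restrict (A j)) ⁻¹'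
      {ν : Measure X | ν (C j) = c j} = {ω : CountingMeasure B | ω.1 (C j) = c j} := by
    intro j
    ext ω
    simp [hA', Measure.restrict_apply (hC j)]
  rw [Set.ofPred_forall]
  simp only [Finset.mem_univ, Set.iInter_true] at key2
  refine (congrArg P (Set.iInter_congr fun j => (hset j).symm)).trans (key2.trans ?_)
  exact Finset.prod_congr rfl fun j _ => (congrArg P (hset j)).trans (h.2 _ (hC j) (hf j) _)

/-- Independence is tested on the π-systems of count events inside each `A i`. Atoms belonging to
different `A i` are disjoint, so all atoms together form one disjoint family with a product formula.
-/
lemma HasPoissonCounts.isPoissonLaw [SigmaFinite μ] (h : HasPoissonCounts μ P) :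
    IsPoissonLaw μ P := by
  classical
  constructor
  · intro A hA hAd
    rw [iIndepFun_iff_iIndep]
    refine iIndepSets.iIndep (fun i => ?_) (fun i => countEvents B μ (A i))
      (fun i => isPiSystem_countEvents _) (fun i => comap_restrict_eq (hA i)) ?_
    · rw [comap_restrict_eq (μ := μ) (hA i)]
      refine le_of_le_of_eq ?_ (measurableSpace_eq_generateFrom (μ := μ)).symm
      exact MeasurableSpace.generateFrom_mono (countEvents_mono (Set.subset_univ _))
    rw [iIndepSets_iff]
    intro s E hE
    choose! F hF hEF using hE
    let a : (i : s) → F i → Set X := fun i p => p.1.1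
    have ham : ∀ i p, MeasurableSet (a i p) := fun i p => (hF i i.2 p p.2).1
    have haf : ∀ i p, μ (a i p) < ∞ := fun i p => (hF i i.2 p p.2).2.2
    let n : (i : s) → F i → ℕ := fun i p => p.1.2
    have hE : ∀ i : s, E i = {ω : CountingMeasure B | ∀ p, ω.1 (a i p) = n i p} := fun i => hEF i i.2
    have h1 : (⋂ i ∈ s, E i) = ⋂ i : s, E i := (Set.iInter_subtype (· ∈ s) fun i => E i).symm
    let C : (Σ i : s, {S : Finset (F i) // S.Nonempty}) → Set X := fun j => atom (a j.1) j.2.1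
    -- A choice of admissible atom counts is made separately for each `i`, so the intersection is a
    -- union over the product of the index families; the sum over this product factors by
    -- distributivity.
    have h2 : (⋂ i : s, E i) = ⋃ c ∈ Fintype.piFinset fun i => admissible (n i),
        {ω : CountingMeasure B | ∀ j, ω.1 (C j) = c j.1 j.2} := by
      ext ω
      simp only [hE, counts_eq_iUnion (ham _), Set.mem_iInter, Set.mem_iUnion, exists_prop,
        Set.mem_ofPred_eq, Fintype.mem_piFinset, Sigma.forall, C]
      constructor
      · intro h
        choose c hc hc' using h
        exact ⟨c, hc, hc'⟩
      · rintro ⟨c, hc, hc'⟩ i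
        exact ⟨c i, hc i, hc' i⟩
    have hCm : ∀ j, MeasurableSet (C j) := fun j => measurableSet_atom (ham j.1) _
    have hCd : Pairwise (fun i j => Disjoint (C i) (C j)) := by
      rintro ⟨i, S⟩ ⟨j, S'⟩ hij
      by_cases hij' : i = j
      · subst hij'
        exact disjoint_atom fun h => hij (congrArg (Sigma.mk i) (Subtype.ext h))
      · obtain ⟨p, hp⟩ := S.2
        obtain ⟨p', hp'⟩ := S'.2
        exact (hAd (fun h => hij' (Subtype.ext h))).mono
          ((atom_subset hp).trans (hF i i.2 p p.2).2.1)
          ((atom_subset hp').trans (hF j j.2 p' p'.2).2.1)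
    have hCf : ∀ j, μ (C j) < ∞ := fun j => measure_atom_lt_top (haf j.1) j.2
    rw [h1, h2, measure_biUnion_finset, ← Finset.prod_coe_sort s fun i => P (E i)]
    · simp only [hE, h.apply_atoms (ham _) (haf _)]
      rw [Finset.prod_univ_sum]
      refine Finset.sum_congr rfl fun c _ => ?_
      rw [h.apply hCm hCd hCf, Fintype.prod_sigma]
    · intro c _ c' _ hc
      refine Set.disjoint_left.2 fun ω hω hω' => hc (funext fun i => funext fun S => ?_)
      have := (hω ⟨i, S⟩).symm.trans (hω' ⟨i, S⟩)
      exact_mod_cast this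
    · exact fun c _ => measurableSet_counts_eq hCm fun j => c j.1 j.2
  · intro A hA hf n
    have := h.apply (J := Unit) (C := fun _ => A) (fun _ => hA) (fun i j hij => (hij rfl).elim)
      (fun _ => hf) fun _ => n
    simpa [poissonWeight] using this

/-- A Poisson point process law is unique. -/
lemma IsPoissonLaw.unique [SigmaFinite μ] [IsProbabilityMeasure P] [IsProbabilityMeasure P']
    (h : IsPoissonLaw μ P) (h' : IsPoissonLaw μ P') : P = P' :=
  h.hasPoissonCounts.unique h'.hasPoissonCounts

end Counts

/-! ### Poisson weights -/

section Weights

lemma poissonWeight_eq {a : ℝ≥0∞} (ha : a ≠ ∞) (n : ℕ) :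
    poissonWeight a n = ENNReal.ofReal (Real.exp (-a.toReal)) * (a ^ n / n.factorial) := by
  have hn : (0 : ℝ) < n.factorial := by exact_mod_cast n.factorial_pos
  rw [poissonWeight, mul_div_assoc, ENNReal.ofReal_mul (Real.exp_pos _).le,
    ENNReal.ofReal_div_of_pos hn, ENNReal.ofReal_pow ENNReal.toReal_nonneg,
    ENNReal.ofReal_toReal ha, ENNReal.ofReal_natCast]

lemma tsum_poissonWeight (a : ℝ≥0∞) : ∑' n, poissonWeight a n = 1 := by
  have h := hasSum_one_poissonMeasure a.toNNReal
  rw [← ENNReal.ofReal_one, ← h.tsum_eq, ENNReal.ofReal_tsum_of_nonneg (fun n => by positivity)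
    h.summable]
  rfl

lemma poissonWeight_zero (n : ℕ) : poissonWeight 0 n = if n = 0 then 1 else 0 := by
  rcases eq_or_ne n 0 with rfl | hn
  · simp [poissonWeight]
  · simp [poissonWeight, hn]

/-- The sum of two independent Poisson variables is Poisson, by the binomial theorem. -/
lemma sum_poissonWeight_mul {a b : ℝ≥0∞} (ha : a ≠ ∞) (hb : b ≠ ∞) (n : ℕ) :
    ∑ k ∈ Finset.range (n + 1), poissonWeight a k * poissonWeight b (n - k) =
      poissonWeight (a + b) n := by
  simp only [poissonWeight]
  rw [ENNReal.toReal_add ha hb, add_pow, Finset.mul_sum, Finset.sum_div,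
    ENNReal.ofReal_sum_of_nonneg]
  · refine Finset.sum_congr rfl fun k hk => ?_
    rw [← ENNReal.ofReal_mul (by positivity)]
    congr 1
    have hkn : k ≤ n := Nat.lt_succ_iff.1 (Finset.mem_range.1 hk)
    have h := Nat.choose_mul_factorial_mul_factorial hkn
    have h' : (n.choose k : ℝ) * k.factorial * (n - k).factorial = n.factorial := by
      exact_mod_cast h
    have h1 : (k.factorial : ℝ) ≠ 0 := by exact_mod_cast k.factorial_ne_zero
    have h2 : ((n - k).factorial : ℝ) ≠ 0 := by exact_mod_cast (n - k).factorial_ne_zero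
    have h3 : (n.factorial : ℝ) ≠ 0 := by exact_mod_cast n.factorial_ne_zero
    rw [neg_add, Real.exp_add]
    field_simp
    rw [← h']
    ring
  · intro k _
    positivity

lemma tendsto_poissonWeight {κ : Type*} {l : Filter κ} {a : κ → ℝ≥0∞} {b : ℝ≥0∞} (hb : b ≠ ∞)
    (h : Tendsto a l (𝓝 b)) (n : ℕ) :
    Tendsto (fun i => poissonWeight (a i) n) l (𝓝 (poissonWeight b n)) := by
  -- Finiteness of the limit is needed because `toReal` sends `∞` to `0`.
  have h' := (ENNReal.tendsto_toReal hb).comp h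
  exact ENNReal.tendsto_ofReal
    ((((Real.continuous_exp.tendsto _).comp h'.neg).mul (h'.pow n)).div_const _)

end Weights

/-! ### Existence of Poisson point processes -/

section FiniteIntensity

variable {X : Type*} [MeasurableSpace X]

variable (X) in
/-- The finite counting measures. -/
abbrev FiniteCounting : Type _ := CountingMeasure (X := X) fun _ : Unit => Set.univ

instance : Zero (FiniteCounting X) := ⟨⟨0, fun _ _ => ⟨0, by simp⟩, by simp⟩⟩

lemma FiniteCounting.coe_zero : (0 : FiniteCounting X).1 = 0 := rfl

lemma FiniteCounting.exists_nat (ω : FiniteCounting X) {A : Set X} (hA : MeasurableSet A) :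
    ∃ n : ℕ, ω.1 A = n := by
  obtain ⟨n, hn⟩ := ω.2.1 A hA
  have h : ω.1 A < ∞ := (measure_mono (Set.subset_univ A)).trans_lt (ω.2.2 ())
  induction n using ENat.recTopCoe with
  | top => simp [hn] at h
  | coe n => exact ⟨n, by simpa using hn⟩

/-- Adding a point to a finite counting measure. -/
noncomputable def addPoint (p : X × FiniteCounting X) : FiniteCounting X :=
  ⟨Measure.dirac p.1 + p.2.1, fun A hA => by
    obtain ⟨n, hn⟩ := p.2.2.1 A hA
    by_cases h : p.1 ∈ A
    · exact ⟨1 + n, by simp [Measure.dirac_apply' _ hA, h, hn]⟩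
    · exact ⟨n, by simp [Measure.dirac_apply' _ hA, h, hn]⟩, fun i => by
    have := p.2.2.2 i
    simpa using this⟩

lemma addPoint_apply (p : X × FiniteCounting X) {A : Set X} (hA : MeasurableSet A) :
    (addPoint p).1 A = A.indicator 1 p.1 + p.2.1 A := by
  change (Measure.dirac p.1 + p.2.1) A = _
  rw [Measure.add_apply, Measure.dirac_apply' _ hA]

lemma measurable_addPoint : Measurable (addPoint (X := X)) := by
  refine Measurable.subtype_mk (Measure.measurable_of_measurable_coe _ fun A hA => ?_)
  have h : (fun p : X × FiniteCounting X => (Measure.dirac p.1 + p.2.1) A) =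
      fun p => A.indicator 1 p.1 + p.2.1 A := funext fun p => addPoint_apply p hA
  rw [h]
  exact ((measurable_one.indicator hA).comp measurable_fst).add
    ((measurable_count hA).comp measurable_snd)

/-- The image of `μ ^ n` under `(x_1, …, x_n) ↦ δ_{x_1} + ⋯ + δ_{x_n}`. -/
noncomputable def pointsLaw (μ : Measure X) : ℕ → Measure (FiniteCounting X)
  | 0 => Measure.dirac 0
  | n + 1 => (μ.prod (pointsLaw μ n)).map addPoint

instance (μ : Measure X) [IsFiniteMeasure μ] (n : ℕ) : IsFiniteMeasure (pointsLaw μ n) := by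
  induction n with
  | zero => exact inferInstanceAs (IsFiniteMeasure (Measure.dirac _))
  | succ n ih => exact inferInstanceAs (IsFiniteMeasure (Measure.map _ _))

lemma mul_pow_pred_div_factorial (a : ℝ≥0∞) {k : ℕ} (hk : k ≠ 0) :
    a * (a ^ (k - 1) / (k - 1).factorial) = k * (a ^ k / k.factorial) := by
  obtain ⟨m, rfl⟩ := Nat.exists_eq_succ_of_ne_zero hk
  have h1 : ((m + 1 : ℕ) : ℝ≥0∞) ≠ 0 := by exact_mod_cast hk
  have h2 : ((m + 1 : ℕ) : ℝ≥0∞) ≠ ∞ := ENNReal.natCast_ne_top _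
  simp only [Nat.succ_eq_add_one, Nat.add_sub_cancel]
  rw [Nat.factorial_succ, Nat.cast_mul, ← mul_div_assoc, ← pow_succ', ← mul_div_assoc,
    ENNReal.mul_div_mul_left _ _ h1 h2]

variable {μ : Measure X} [IsFiniteMeasure μ] {J : Type*} [Fintype J]

/-- The multinomial formula for `n` points thrown into the cells of a partition. The last point lies
in exactly one cell `C j` and lowers the required count there by one; this contributes the factor `c
j`, and `∑ c j = n + 1` turns `n!` into `(n + 1)!`. -/
lemma pointsLaw_apply {C : J → Set X} (hC : ∀ j, MeasurableSet (C j))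
    (hd : Pairwise (fun i j => Disjoint (C i) (C j))) (hu : ⋃ j, C j = Set.univ) (n : ℕ)
    (c : J → ℕ) :
    pointsLaw μ n {ω | ∀ j, ω.1 (C j) = c j} =
      if ∑ j, c j = n then n.factorial * ∏ j, (μ (C j) ^ c j / (c j).factorial) else 0 := by
  classical
  induction n generalizing c with
  | zero =>
    rw [pointsLaw, Measure.dirac_apply' _ (measurableSet_counts_eq hC c)]
    by_cases h : ∑ j, c j = 0
    · have h0 : ∀ j, c j = 0 := fun j => (Finset.sum_eq_zero_iff.1 h) j (Finset.mem_univ j)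
      have : (0 : FiniteCounting X) ∈ {ω : FiniteCounting X | ∀ j, ω.1 (C j) = c j} := by
        intro j
        simp [h0, FiniteCounting.coe_zero]
      rw [Set.indicator_of_mem this]
      simp [h0]
    · rw [if_neg h, Set.indicator_of_notMem]
      intro h'
      refine h (Finset.sum_eq_zero fun j _ => ?_)
      have := h' j
      rw [FiniteCounting.coe_zero] at this
      simpa using this.symm
  | succ n ih =>
    rw [pointsLaw, Measure.map_apply measurable_addPoint (measurableSet_counts_eq hC c),
      Measure.prod_apply (measurable_addPoint (measurableSet_counts_eq hC c))]
    -- A point in `C j` is incompatible with `c j = 0`. This case is split off because truncated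
    -- subtraction would replace `0 - 1` by `0`.
    have key : ∀ j, ∀ x ∈ C j, pointsLaw μ n
        (Prod.mk x ⁻¹' (addPoint ⁻¹' {ω : FiniteCounting X | ∀ i, ω.1 (C i) = c i})) =
        if c j = 0 then 0 else
          if ∑ i, c i = n + 1 then n.factorial * ∏ i, (μ (C i) ^ (c i - if i = j then 1 else 0) /
            (c i - if i = j then 1 else 0).factorial) else 0 := by
      intro j x hx
      have hind : ∀ i, (C i).indicator (1 : X → ℝ≥0∞) x = if i = j then 1 else 0 := by
        intro i
        by_cases hij : i = j
        · subst hij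
          simp [hx]
        · rw [if_neg hij, Set.indicator_of_notMem]
          exact Set.disjoint_right.1 (hd hij) hx
      by_cases h0 : c j = 0
      · rw [if_pos h0]
        convert! measure_empty (μ := pointsLaw μ n)
        rw [Set.eq_empty_iff_forall_notMem]
        intro ω hω
        have := hω j
        rw [addPoint_apply _ (hC j), hind, h0] at this
        simp at this
      have hset : Prod.mk x ⁻¹' (addPoint ⁻¹' {ω : FiniteCounting X | ∀ i, ω.1 (C i) = c i}) =
          {ω | ∀ i, ω.1 (C i) = ((c i - if i = j then 1 else 0 : ℕ) : ℝ≥0∞)} := by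
        ext ω
        refine forall_congr' fun i => ?_
        rw [addPoint_apply _ (hC i), hind]
        obtain ⟨m, hm⟩ := ω.exists_nat (hC i)
        simp only [hm]
        split_ifs with hij
        · subst hij
          norm_cast
          omega
        · simp
      have h1 : ∀ i, (if i = j then 1 else 0) ≤ c i := by
        intro i
        split_ifs with hij
        · subst hij
          omega
        · omega
      have h2 : c j ≤ ∑ i, c i :=
        Finset.single_le_sum (fun _ _ => Nat.zero_le _) (Finset.mem_univ j)
      have h3 : ∑ i, (c i - if i = j then 1 else 0) = n ↔ ∑ i, c i = n + 1 := by
        rw [Finset.sum_tsub_distrib _ fun i _ => h1 i]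
        simp only [Finset.sum_ite_eq', Finset.mem_univ, if_true]
        omega
      rw [hset, ih, if_neg h0]
      simp only [h3]
    have hsplit : ∀ f : X → ℝ≥0∞, ∫⁻ x, f x ∂μ = ∑ j, ∫⁻ x in C j, f x ∂μ := by
      intro f
      rw [← setLIntegral_univ, ← hu, lintegral_iUnion hC hd, tsum_fintype]
    rw [hsplit]
    have : ∀ j, ∫⁻ x in C j, pointsLaw μ n
        (Prod.mk x ⁻¹' (addPoint ⁻¹' {ω : FiniteCounting X | ∀ i, ω.1 (C i) = c i})) ∂μ =
        if ∑ i, c i = n + 1 then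
          c j * (n.factorial * ∏ i, (μ (C i) ^ c i / (c i).factorial)) else 0 := by
      intro j
      rw [setLIntegral_congr_fun (hC j) (key j), setLIntegral_const]
      split_ifs with h0 hn hn
      · simp [h0]
      · simp
      · rw [← Finset.mul_prod_erase _ _ (Finset.mem_univ j),
          ← Finset.mul_prod_erase Finset.univ (fun i => μ (C i) ^ c i / (c i).factorial)
            (Finset.mem_univ j),
          Finset.prod_congr rfl fun i hi => by rw [if_neg (Finset.ne_of_mem_erase hi), Nat.sub_zero]]
        rw [if_pos rfl]
        generalize ∏ i ∈ Finset.univ.erase j, (μ (C i) ^ c i / (c i).factorial : ℝ≥0∞) = E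
        calc _ = n.factorial * E * (μ (C j) * (μ (C j) ^ (c j - 1) / (c j - 1).factorial)) := by ring
          _ = _ := by
            rw [mul_pow_pred_div_factorial _ h0]
            ring
      · simp
    simp only [this]
    split_ifs with hn
    · rw [← Finset.sum_mul, ← Nat.cast_sum, hn, ← mul_assoc, ← Nat.cast_mul, Nat.factorial_succ]
    · simp

/-- The law of the Poisson point process with finite intensity measure `μ`. -/
noncomputable def finitePoisson (μ : Measure X) : Measure (FiniteCounting X) :=
  ENNReal.ofReal (Real.exp (-(μ Set.univ).toReal)) •
    Measure.sum fun n => (n.factorial : ℝ≥0∞)⁻¹ • pointsLaw μ n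

/-- On a partition the total number of points is `∑ c j`, so a single term of the mixture survives.
Its `n!` cancels, and the exponential of the total mass splits over the cells. -/
lemma finitePoisson_apply {C : J → Set X} (hC : ∀ j, MeasurableSet (C j))
    (hd : Pairwise (fun i j => Disjoint (C i) (C j))) (hu : ⋃ j, C j = Set.univ) (c : J → ℕ) :
    finitePoisson μ {ω | ∀ j, ω.1 (C j) = c j} = ∏ j, poissonWeight (μ (C j)) (c j) := by
  have hμ : μ Set.univ = ∑ j, μ (C j) := by
    rw [← hu, measure_iUnion hd hC, tsum_fintype]
  rw [finitePoisson, Measure.smul_apply, Measure.sum_apply _ (measurableSet_counts_eq hC c),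
    tsum_eq_single (∑ j, c j)]
  · rw [Measure.smul_apply, pointsLaw_apply hC hd hu, if_pos rfl, smul_eq_mul, smul_eq_mul,
      ← mul_assoc (_⁻¹), ENNReal.inv_mul_cancel, one_mul, hμ, ENNReal.toReal_sum,
      ← Finset.sum_neg_distrib, Real.exp_sum, ENNReal.ofReal_prod_of_nonneg,
      ← Finset.prod_mul_distrib]
    · exact Finset.prod_congr rfl fun j _ => (poissonWeight_eq (measure_ne_top μ _) _).symm
    · exact fun j _ => (Real.exp_pos _).le
    · exact fun j _ => measure_ne_top μ _
    · exact_mod_cast Nat.factorial_ne_zero _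
    · exact ENNReal.natCast_ne_top _
  · intro n hn
    rw [Measure.smul_apply, pointsLaw_apply hC hd hu, if_neg hn.symm, smul_zero]

/-- The complement of the given sets is added as a further cell, with index `none`, to make a
partition. Summing over its count removes it, since Poisson weights add up to one. -/
lemma hasPoissonCounts_finitePoisson : HasPoissonCounts μ (finitePoisson μ) := by
  intro m C hC hd _ c
  let C' : Option (Fin m) → Set X := fun o => o.elim (⋃ j, C j)ᶜ C
  have hC' : ∀ o, MeasurableSet (C' o) := by
    rintro (_ | j)
    · exact (MeasurableSet.iUnion hC).compl
    · exact hC j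
  have hd' : Pairwise (fun i j => Disjoint (C' i) (C' j)) := by
    have h : ∀ j, Disjoint (C j) (⋃ j, C j)ᶜ := fun j =>
      Set.disjoint_compl_right_iff_subset.2 (Set.subset_iUnion C j)
    rintro (_ | i) (_ | j) hij
    · exact (hij rfl).elim
    · exact (h j).symm
    · exact h i
    · exact hd fun h => hij (congrArg some h)
  have hu' : ⋃ o, C' o = Set.univ := by
    refine Set.eq_univ_of_forall fun x => ?_
    by_cases hx : x ∈ ⋃ j, C j
    · obtain ⟨j, hj⟩ := Set.mem_iUnion.1 hx
      exact Set.mem_iUnion.2 ⟨some j, hj⟩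
    · exact Set.mem_iUnion.2 ⟨none, hx⟩
  let c' : ℕ → Option (Fin m) → ℕ := fun k o => o.elim k c
  have hset : {ω : FiniteCounting X | ∀ j, ω.1 (C j) = c j} =
      ⋃ k, {ω : FiniteCounting X | ∀ o, ω.1 (C' o) = c' k o} := by
    ext ω
    simp only [Set.mem_iUnion, Set.mem_ofPred_eq, Option.forall, C', c', Option.elim_none,
      Option.elim_some]
    rw [exists_and_right, and_iff_right]
    exact ω.exists_nat (MeasurableSet.iUnion hC).compl
  rw [hset, measure_iUnion]
  · simp only [finitePoisson_apply hC' hd' hu', Fintype.prod_option, c', C', Option.elim_none,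
      Option.elim_some]
    rw [ENNReal.tsum_mul_right, tsum_poissonWeight, one_mul]
  · intro k k' hk
    exact disjoint_counts fun h => hk (congrFun h none)
  · exact fun k => measurableSet_counts_eq hC' _

instance isProbabilityMeasure_finitePoisson : IsProbabilityMeasure (finitePoisson μ) := by
  refine ⟨?_⟩
  have h := hasPoissonCounts_finitePoisson (μ := μ) 0 (fun j => j.elim0) (fun j => j.elim0)
    (fun j => j.elim0) (fun j => j.elim0) fun j => j.elim0
  simpa using h

end FiniteIntensity

/-! ### Sigma-finite intensity: superposition of independent finite processes -/

section SigmaFiniteIntensity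

variable {ι X : Type*} [MeasurableSpace X] {B : ι → Set X}

/-- A convergent series of natural numbers has only finitely many terms that are at least one, so
its sum is a natural number. -/
lemma exists_enat_tsum (a : ℕ → ℕ) : ∃ n : ℕ∞, ∑' i, (a i : ℝ≥0∞) = n := by
  by_cases h : ∑' i, (a i : ℝ≥0∞) = ∞
  · exact ⟨⊤, by simpa using h⟩
  · have hf := ENNReal.finite_const_le_of_tsum_ne_top h one_ne_zero
    refine ⟨((∑ i ∈ hf.toFinset, a i : ℕ) : ℕ∞), ?_⟩
    rw [tsum_eq_sum (s := hf.toFinset)]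
    · rw [ENat.toENNReal_coe, Nat.cast_sum]
    · intro i hi
      simpa [Nat.one_le_iff_ne_zero] using hi

open scoped Classical in
/-- The superposition of a sequence of finite counting measures, or zero if it is not locally
finite. -/
noncomputable def superpose (B : ι → Set X) (ω : ℕ → FiniteCounting X) : CountingMeasure B :=
  ⟨if ∀ i, Measure.sum (fun n => (ω n).1) (B i) < ∞ then Measure.sum fun n => (ω n).1 else 0, by
    split_ifs with h
    · refine ⟨fun A hA => ?_, h⟩
      choose a ha using fun n => (ω n).exists_nat hA
      rw [Measure.sum_apply _ hA]
      simp only [ha]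
      exact exists_enat_tsum a
    · exact ⟨fun _ _ => ⟨0, by simp⟩, by simp⟩⟩

lemma superpose_coe {ω : ℕ → FiniteCounting X}
    (h : ∀ i, Measure.sum (fun n => (ω n).1) (B i) < ∞) :
    (superpose B ω).1 = Measure.sum fun n => (ω n).1 := if_pos h

lemma measurable_sum_count {A : Set X} (hA : MeasurableSet A) :
    Measurable fun ω : ℕ → FiniteCounting X => Measure.sum (fun n => (ω n).1) A := by
  simp only [Measure.sum_apply _ hA]
  exact Measurable.tsum fun n => (measurable_count hA).comp (measurable_pi_apply n)

lemma measurable_superpose [Countable ι] (hB : ∀ i, MeasurableSet (B i)) :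
    Measurable (superpose B) := by
  have hm : MeasurableSet {ω : ℕ → FiniteCounting X |
      ∀ i, Measure.sum (fun n => (ω n).1) (B i) < ∞} := by
    rw [Set.ofPred_forall]
    exact MeasurableSet.iInter fun i => measurable_sum_count (hB i) measurableSet_Iio
  exact Measurable.subtype_mk (Measurable.ite hm
    (Measure.measurable_of_measurable_coe _ fun A hA => measurable_sum_count hA) measurable_const)

variable {m : ℕ → Measure X} [∀ n, IsFiniteMeasure (m n)] {J : Type*} [Fintype J]

/-- Induction on the number of superposed processes: the next one is independent of the partial sum,
and the convolution identity for Poisson weights applies to each set separately. -/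
lemma partial_counts {C : J → Set X} (hC : ∀ j, MeasurableSet (C j))
    (hd : Pairwise (fun i j => Disjoint (C i) (C j))) (N : ℕ) (c : J → ℕ) :
    Measure.infinitePi (fun n => finitePoisson (m n))
      {ω | ∀ j, ∑ n ∈ Finset.range N, (ω n).1 (C j) = c j} =
        ∏ j, poissonWeight (∑ n ∈ Finset.range N, m n (C j)) (c j) := by
  classical
  induction N generalizing c with
  | zero =>
    simp only [Finset.range_zero, Finset.sum_empty, poissonWeight_zero]
    by_cases h : ∀ j, c j = 0
    · simp [h]
    · have h' := h
      push Not at h'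
      obtain ⟨j, hj⟩ := h'
      rw [Finset.prod_eq_zero (Finset.mem_univ j) (if_neg hj)]
      convert! measure_empty (μ := Measure.infinitePi fun n => finitePoisson (m n))
      rw [Set.eq_empty_iff_forall_notMem]
      intro ω hω
      exact hj (by simpa using (hω j).symm)
  | succ N ih =>
    let f : ℕ → FiniteCounting X → J → ℝ≥0∞ := fun _ ω j => ω.1 (C j)
    have hf : ∀ n, Measurable (f n) := fun n => measurable_pi_iff.2 fun j => measurable_count (hC j)
    have hind := (iIndepFun_infinitePi (P := fun n => finitePoisson (m n)) hf).indepFun_finsetSum_of_notMem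
      (fun n => (hf n).comp (measurable_pi_apply n)) (s := Finset.range N) (i := N) (by simp)
    let E : (J → ℕ) → Set (J → ℝ≥0∞) := fun a => {y | ∀ j, y j = a j}
    have hE : ∀ a, MeasurableSet (E a) := fun a => by
      simp only [E, Set.ofPred_forall]
      exact MeasurableSet.iInter fun j => measurable_pi_apply j (measurableSet_singleton _)
    let F : (J → ℕ) → Set (ℕ → FiniteCounting X) := fun a =>
      {ω | ∀ j, ∑ n ∈ Finset.range N, (ω n).1 (C j) = a j} ∩ {ω | ∀ j, (ω N).1 (C j) = (c j - a j : ℕ)}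
    -- The event is split according to the counts `a j` contributed by the first `N` processes, the
    -- last one supplying `c j - a j`.
    have hset : {ω : ℕ → FiniteCounting X | ∀ j, ∑ n ∈ Finset.range (N + 1), (ω n).1 (C j) = c j} =
        ⋃ a ∈ Fintype.piFinset fun j => Finset.range (c j + 1), F a := by
      ext ω
      simp only [Set.mem_iUnion, exists_prop, Fintype.mem_piFinset, Finset.mem_range, F,
        Set.mem_inter_iff, Set.mem_ofPred_eq, Finset.sum_range_succ]
      choose b hb using fun n => fun j => (ω n).exists_nat (hC j)
      simp only [hb]
      norm_cast
      constructor
      · intro h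
        refine ⟨fun j => ∑ n ∈ Finset.range N, b n j, fun j => ?_, fun j => rfl, fun j => ?_⟩
        · have := h j
          dsimp only
          omega
        · have := h j
          dsimp only
          omega
      · rintro ⟨a, ha, h1, h2⟩ j
        have := ha j
        rw [h1, h2]
        omega
    have hF : ∀ a, F a = (∑ n ∈ Finset.range N, fun ω : ℕ → FiniteCounting X => f n (ω n)) ⁻¹' E a ∩
        (fun ω : ℕ → FiniteCounting X => f N (ω N)) ⁻¹' E fun j => c j - a j := by
      intro a
      ext ω
      simp [F, E, f, Finset.sum_apply]
    have hFm : ∀ a, MeasurableSet (F a) := by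
      intro a
      rw [hF]
      refine MeasurableSet.inter ?_ (((hf N).comp (measurable_pi_apply N)) (hE _))
      rw [Finset.sum_fn]
      exact (Finset.measurable_sum _ fun n _ => (hf n).comp (measurable_pi_apply n)) (hE _)
    rw [hset, measure_biUnion_finset _ fun a _ => hFm a]
    · have hP : ∀ a, Measure.infinitePi (fun n => finitePoisson (m n)) (F a) =
          ∏ j, (poissonWeight (∑ n ∈ Finset.range N, m n (C j)) (a j) *
            poissonWeight (m N (C j)) (c j - a j)) := by
        intro a
        rw [hF, hind.measure_inter_preimage_eq_mul _ _ (hE _) (hE _), Finset.prod_mul_distrib, ← ih]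
        congr 1
        · congr 1
          ext ω
          simp [E, f, Finset.sum_apply]
        · rw [← hasPoissonCounts_finitePoisson.apply hC hd fun j => measure_lt_top _ _,
            ← Measure.infinitePi_map_eval (fun n => finitePoisson (m n)) N,
            Measure.map_apply (measurable_pi_apply N) (measurableSet_counts_eq hC _)]
          rfl
      simp only [hP]
      rw [← Finset.prod_univ_sum (fun j => Finset.range (c j + 1)) fun j k =>
        poissonWeight (∑ n ∈ Finset.range N, m n (C j)) k * poissonWeight (m N (C j)) (c j - k)]
      refine Finset.prod_congr rfl fun j _ => ?_
      rw [sum_poissonWeight_mul _ (measure_ne_top _ _), Finset.sum_range_succ]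
      exact (ENNReal.sum_lt_top.2 fun n _ => measure_lt_top _ _).ne
    · intro a _ a' _ haa
      refine Set.disjoint_left.2 fun ω h h' => haa (funext fun j => ?_)
      have := (h.1 j).symm.trans (h'.1 j)
      exact_mod_cast this

/-- Partial counts are nondecreasing integers, so for each configuration the event that they equal
`c j` eventually agrees with the event for the total. Dominated convergence of indicators then
passes to the limit, also when some total is infinite. -/
lemma sum_counts {C : J → Set X} (hC : ∀ j, MeasurableSet (C j))
    (hd : Pairwise (fun i j => Disjoint (C i) (C j))) (hf : ∀ j, Measure.sum m (C j) < ∞)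
    (c : J → ℕ) :
    Measure.infinitePi (fun n => finitePoisson (m n))
      {ω | ∀ j, Measure.sum (fun n => (ω n).1) (C j) = c j} =
        ∏ j, poissonWeight (Measure.sum m (C j)) (c j) := by
  have hlim : Tendsto (fun N => ∏ j, poissonWeight (∑ n ∈ Finset.range N, m n (C j)) (c j)) atTop
      (𝓝 (∏ j, poissonWeight (Measure.sum m (C j)) (c j))) := by
    refine ENNReal.tendsto_finsetProd_of_ne_top _ (fun j _ => ?_) fun j _ => poissonWeight_ne_top _ _
    refine tendsto_poissonWeight (hf j).ne ?_ _
    rw [Measure.sum_apply _ (hC j)]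
    exact ENNReal.tendsto_nat_tsum _
  refine tendsto_nhds_unique ?_ hlim
  simp only [← partial_counts hC hd]
  refine tendsto_measure_of_tendsto_indicator atTop (fun N => ?_) MeasurableSet.univ
    (measure_ne_top _ _) (Eventually.of_forall fun _ => Set.subset_univ _) fun ω => ?_
  · rw [Set.ofPred_forall]
    exact MeasurableSet.iInter fun j => (Finset.measurable_sum _ fun n _ =>
      (measurable_count (hC j)).comp (measurable_pi_apply n)) (measurableSet_singleton _)
  · have h : ∀ j, ∀ᶠ N in atTop, ∑ n ∈ Finset.range N, (ω n).1 (C j) = c j ↔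
        Measure.sum (fun n => (ω n).1) (C j) = c j := by
      intro j
      rw [Measure.sum_apply _ (hC j)]
      choose b hb using fun n => (ω n).exists_nat (hC j)
      simp only [hb]
      have hT := ENNReal.tendsto_nat_tsum fun n => (b n : ℝ≥0∞)
      by_cases heq : ∑' n, (b n : ℝ≥0∞) = c j
      · have hlt : ∀ᶠ N in atTop, (c j : ℝ≥0∞) < ∑ n ∈ Finset.range N, (b n : ℝ≥0∞) + 1 := by
          refine (hT.add_const 1).eventually_const_lt ?_
          rw [heq]
          exact_mod_cast Nat.lt_succ_self _
        filter_upwards [hlt] with N hN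
        refine iff_of_true (le_antisymm (heq ▸ ENNReal.sum_le_tsum _) ?_) heq
        have : c j < ∑ n ∈ Finset.range N, b n + 1 := by exact_mod_cast hN
        exact_mod_cast Nat.lt_succ_iff.1 this
      · rcases lt_or_gt_of_ne heq with hlt | hlt
        · refine Eventually.of_forall fun N => iff_of_false (fun h => ?_) heq
          exact absurd (h ▸ ENNReal.sum_le_tsum _) (not_le.2 hlt)
        · filter_upwards [hT.eventually_const_lt hlt] with N hN
          exact iff_of_false hN.ne' heq
    filter_upwards [eventually_all.2 h] with N hN
    exact forall_congr' hN

/-- Poisson point processes exist. -/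
theorem exists_isPoissonLaw [Countable ι] (hB : ∀ i, MeasurableSet (B i)) (μ : Measure X)
    [SigmaFinite μ] (hμ : ∀ i, μ (B i) < ∞) :
    ∃ P : ProbabilityMeasure (CountingMeasure B), IsPoissonLaw μ (P : Measure (CountingMeasure B)) := by
  set D := disjointed (spanningSets μ) with hDdef
  have hD : ∀ n, MeasurableSet (D n) := fun n =>
    MeasurableSet.disjointed (measurableSet_spanningSets μ) n
  let m : ℕ → Measure X := fun n => μ.restrict (D n)
  have hm : Measure.sum m = μ := by
    rw [← Measure.restrict_iUnion (disjoint_disjointed _) hD, iUnion_disjointed,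
      iUnion_spanningSets, Measure.restrict_univ]
  have hfin : ∀ n, IsFiniteMeasure (m n) := fun n => ⟨by
    rw [Measure.restrict_apply_univ]
    exact (measure_mono (disjointed_subset _ n)).trans_lt (measure_spanningSets_lt_top μ n)⟩
  let P := Measure.infinitePi fun n => finitePoisson (m n)
  -- The default value in `superpose` is taken with probability zero: the count of `B i` is Poisson
  -- with finite mean, so the probabilities of its finite values add up to one.
  have hP : ∀ᵐ ω ∂P, ∀ i, Measure.sum (fun n => (ω n).1) (B i) < ∞ := by
    rw [ae_all_iff]
    intro i
    have h1 : P (⋃ k : ℕ, {ω | ∀ j : Unit, Measure.sum (fun n => (ω n).1) (B i) = k}) = 1 := by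
      rw [measure_iUnion]
      · have h := fun k : ℕ => sum_counts (m := m) (J := Unit) (C := fun _ => B i) (fun _ => hB i)
          (fun i j hij => (hij rfl).elim) (fun _ => hm ▸ hμ i) fun _ => k
        simp only [P, h]
        simp [tsum_poissonWeight]
      · intro k k' hk
        refine Set.disjoint_left.2 fun ω h h' => hk ?_
        have := (h ()).symm.trans (h' ())
        exact_mod_cast this
      · intro k
        simp only [forall_const]
        exact measurable_sum_count (hB i) (measurableSet_singleton _)
    have h2 := (prob_compl_eq_zero_iff₀ ?_).2 h1
    · rw [ae_iff]
      refine measure_mono_null (fun ω hω => ?_) h2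
      refine fun hk => hω ?_
      obtain ⟨k, hk⟩ := Set.mem_iUnion.1 hk
      rw [hk ()]
      exact ENNReal.natCast_lt_top k
    · refine (MeasurableSet.iUnion fun k => ?_).nullMeasurableSet
      simp only [forall_const]
      exact measurable_sum_count (hB i) (measurableSet_singleton _)
  have hS := measurable_superpose hB
  refine ⟨⟨P.map (superpose B), Measure.isProbabilityMeasure_map hS.aemeasurable⟩,
    HasPoissonCounts.isPoissonLaw fun k C hC hd hf c => ?_⟩
  rw [ProbabilityMeasure.coe_mk, Measure.map_apply hS (measurableSet_counts_eq hC c)]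
  have hsum := sum_counts (m := m) hC hd (fun j => hm ▸ hf j) c
  rw [hm] at hsum
  rw [← hsum]
  refine measure_congr ?_
  filter_upwards [hP] with ω hω
  refine propext (forall_congr' fun j => ?_)
  rw [superpose_coe hω]

end SigmaFiniteIntensity


/-! ### Images and limits of Poisson point processes -/

section MapLimit

variable {ι ι' X Y : Type*} [MeasurableSpace X] [MeasurableSpace Y] {B : ι → Set X}
  {B' : ι' → Set Y}

/-- Preimages of disjoint sets are disjoint and carry the same counts, so the product formula
transfers directly. -/
lemma HasPoissonCounts.map {μ : Measure X} {P : Measure (CountingMeasure B)}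
    (h : HasPoissonCounts μ P) {f : X → Y} (hf : Measurable f)
    {F : CountingMeasure B → CountingMeasure B'} (hF : Measurable F)
    (hFf : ∀ ω, (F ω).1 = ω.1.map f) : HasPoissonCounts (μ.map f) (P.map F) := by
  intro m C hC hd hfin c
  simp only [Measure.map_apply hf (hC _)] at hfin ⊢
  rw [Measure.map_apply hF (measurableSet_counts_eq hC c),
    ← h m (fun j => f ⁻¹' C j) (fun j => hf (hC j)) (fun i j hij => (hd hij).preimage f) hfin c]
  congr 1
  ext ω
  refine forall_congr' fun j => ?_
  rw [hFf, Measure.map_apply hf (hC j)]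

lemma tendsto_counts {T : Type*} {l : Filter T} {μ : T → Measure X} {μ₀ : Measure X}
    {P : T → Measure (CountingMeasure B)} {P₀ : Measure (CountingMeasure B)}
    (hP : ∀ᶠ t in l, HasPoissonCounts (μ t) (P t)) (hP₀ : HasPoissonCounts μ₀ P₀)
    {κ : Type*} [Fintype κ] {A : κ → Set X} (hA : ∀ i, MeasurableSet (A i))
    (hμ : ∀ᶠ t in l, ∀ i, μ t (A i) < ∞) (hμ₀ : ∀ i, μ₀ (A i) < ∞)
    (hlim : ∀ S : {S : Finset κ // S.Nonempty},
      Tendsto (fun t => μ t (atom A S.1)) l (𝓝 (μ₀ (atom A S.1)))) (n : κ → ℕ) :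
    Tendsto (fun t => P t {ω | ∀ i, ω.1 (A i) = n i}) l (𝓝 (P₀ {ω | ∀ i, ω.1 (A i) = n i})) := by
  rw [hP₀.apply_atoms hA hμ₀]
  have h : ∀ᶠ t in l, ∑ c ∈ admissible n, ∏ S : {S : Finset κ // S.Nonempty},
      poissonWeight (μ t (atom A S.1)) (c S) = P t {ω | ∀ i, ω.1 (A i) = n i} := by
    filter_upwards [hP, hμ] with t h1 h2
    rw [h1.apply_atoms hA h2]
  refine Tendsto.congr' h (tendsto_finsetSum _ fun c _ =>
    ENNReal.tendsto_finsetProd_of_ne_top _ (fun S _ => ?_) fun S _ => poissonWeight_ne_top _ _)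
  exact tendsto_poissonWeight (measure_atom_lt_top hμ₀ S).ne (hlim S) _

end MapLimit

/-! ### Convergence of laws in the weak* topology of `Ω*` -/

section WeakTopology

variable {V : Type*} {G : SimpleGraph V}

instance [Countable V] : SecondCountableTopology (ConfigMod G) :=
  TopologicalSpace.secondCountableTopology_induced _ _ _

lemma lt_top_of_mem_cylMod (ω : ConfigMod G) {S : Set (WalkSpaceMod G)} (hS : S ∈ cylMod G) :
    ω.1 S < ∞ := by
  obtain ⟨K, w', -, rfl⟩ := hS
  exact (measure_mono (Set.image_mono fun w hw => hw.1)).trans_lt (ω.2.2 K)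

lemma exists_nat_of_mem_cylMod (ω : ConfigMod G) {S : Set (WalkSpaceMod G)} (hS : S ∈ cylMod G) :
    ∃ n : ℕ, ω.1 S = n := by
  obtain ⟨n, hn⟩ := ω.2.1 S (measurableSet_of_mem_cylMod hS)
  have h := lt_top_of_mem_cylMod ω hS
  induction n using ENat.recTopCoe with
  | top => simp [hn] at h
  | coe n => exact ⟨n, by simpa using hn⟩

/-- Count events on cylinder sets form a π-system that contains arbitrarily small neighbourhoods of
every point of the second countable space `Ω*`, because the evaluations are integer valued.
Convergence of probabilities on such a π-system implies weak convergence. -/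
lemma tendsto_configMod [Countable V] {T : Type*} {l : Filter T} [l.IsCountablyGenerated]
    {P : T → ProbabilityMeasure (ConfigMod G)} {P₀ : ProbabilityMeasure (ConfigMod G)}
    (h : ∀ F : Finset (Set (WalkSpaceMod G) × ℕ), (∀ p ∈ F, p.1 ∈ cylMod G) →
      Tendsto (fun t => (P t : Measure (ConfigMod G)) {ω : ConfigMod G | ∀ p : F, ω.1 p.1.1 = p.1.2}) l
        (𝓝 ((P₀ : Measure (ConfigMod G)) {ω : ConfigMod G | ∀ p : F, ω.1 p.1.1 = p.1.2}))) :
    Tendsto P l (𝓝 P₀) := by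
  classical
  let 𝒮 : Set (Set (ConfigMod G)) := {E | ∃ F : Finset (Set (WalkSpaceMod G) × ℕ),
    (∀ p ∈ F, p.1 ∈ cylMod G) ∧ E = {ω : ConfigMod G | ∀ p : F, ω.1 p.1.1 = p.1.2}}
  have hpi : IsPiSystem 𝒮 := by
    rintro _ ⟨F, hF, rfl⟩ _ ⟨F', hF', rfl⟩ -
    refine ⟨F ∪ F', fun p hp => (Finset.mem_union.1 hp).elim (hF p) (hF' p), ?_⟩
    ext ω
    simp [or_imp, forall_and]
  refine hpi.tendsto_probabilityMeasure_of_tendsto_of_mem ?_ ?_ ?_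
  · rintro _ ⟨F, hF, rfl⟩
    exact measurableSet_counts_eq (fun p : F => measurableSet_of_mem_cylMod (hF p p.2)) _
  · intro U hU ω hω
    obtain ⟨O, hO, rfl⟩ := isOpen_induced_iff.1 hU
    obtain ⟨I, v, hv, hIv⟩ := isOpen_pi_iff.1 hO _ hω
    choose n hn using fun S : cylMod G => exists_nat_of_mem_cylMod ω S.2
    let F : Finset (Set (WalkSpaceMod G) × ℕ) := I.image fun S => (S.1, n S)
    have hF : ∀ p ∈ F, p.1 ∈ cylMod G := by
      intro p hp
      obtain ⟨S, -, rfl⟩ := Finset.mem_image.1 hp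
      exact S.2
    have hFI : {ω : ConfigMod G | ∀ p : F, ω.1 p.1.1 = p.1.2} = ⋂ S ∈ I, {ω : ConfigMod G | ω.1 S.1 = n S} := by
      ext ω'
      simp only [Set.mem_ofPred_eq, Set.mem_iInter]
      constructor
      · exact fun h S hS => h ⟨(S.1, n S), Finset.mem_image_of_mem _ hS⟩
      · rintro h ⟨p, hp⟩
        obtain ⟨S, hS, rfl⟩ := Finset.mem_image.1 hp
        exact h S hS
    refine ⟨_, ⟨F, hF, rfl⟩, ?_, ?_⟩
    · rw [hFI, Filter.biInter_finset_mem]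
      intro S _
      have hcont : Continuous fun ω : ConfigMod G => ω.1 S.1 :=
        (continuous_apply S).comp (continuous_induced_dom (f := fun (ω : ConfigMod G) (S : cylMod G) => ω.1 S.1))
      have hT : Tendsto (fun ω' : ConfigMod G => ω'.1 S.1) (𝓝 ω) (𝓝 (n S)) := by
        have := hcont.tendsto ω
        simp only [hn S] at this
        exact this
      -- An integer less than one away from `n S` on both sides equals it, so `{ω | ω(S) = n S}` is
      -- a neighbourhood of `ω`.
      have hlt : ∀ᶠ ω' : ConfigMod G in 𝓝 ω, ω'.1 S.1 < (n S : ℝ≥0∞) + 1 :=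
        hT.eventually_lt_const (by exact_mod_cast Nat.lt_succ_self _)
      have hgt : ∀ᶠ ω' : ConfigMod G in 𝓝 ω, (n S : ℝ≥0∞) < ω'.1 S.1 + 1 :=
        (hT.add_const 1).eventually_const_lt (by exact_mod_cast Nat.lt_succ_self _)
      filter_upwards [hlt, hgt] with ω' h1 h2
      obtain ⟨m, hm⟩ := exists_nat_of_mem_cylMod ω' S.2
      rw [hm] at h1 h2
      have h1' : m < n S + 1 := by exact_mod_cast h1
      have h2' : n S < m + 1 := by exact_mod_cast h2
      have : m = n S := by omega
      change ω'.1 S.1 = n S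
      rw [hm, this]
    · intro ω' hω'
      rw [hFI] at hω'
      refine hIv fun S hS => ?_
      have h1 : ω'.1 S.1 = n S := Set.mem_iInter₂.1 hω' S hS
      have h2 : ω.1 S.1 ∈ v S := (hv S hS).2
      rw [hn S] at h2
      change ω'.1 S.1 ∈ v S
      rwa [h1]
  · rintro _ ⟨F, hF, rfl⟩
    exact (ENNReal.tendsto_toNNReal (measure_ne_top _ _)).comp (h F hF)

end WeakTopology

/-! ### Simple random walk -/

section Paths

variable {V : Type*}

/-- The paths that follow `γ` up to time `n`. -/
def pathCyl (γ : ℕ → V) (n : ℕ) : Set (ℕ → V) := {a | ∀ k ≤ n, a k = γ k}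

lemma isPiSystem_pathCyl : IsPiSystem {S : Set (ℕ → V) | ∃ γ n, S = pathCyl γ n} := by
  rintro _ ⟨γ, n, rfl⟩ _ ⟨γ', n', rfl⟩ ⟨b, hb, hb'⟩
  refine ⟨b, max n n', Set.ext fun a => ⟨fun h k hk => ?_, fun h => ⟨fun k hk => ?_, fun k hk => ?_⟩⟩⟩
  · rcases le_max_iff.1 hk with hk | hk
    · rw [h.1 k hk, hb k hk]
    · rw [h.2 k hk, hb' k hk]
  · rw [h k (le_max_of_le_left hk), hb k hk]
  · rw [h k (le_max_of_le_right hk), hb' k hk]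

variable [MeasurableSpace V]

lemma measurable_pathShift : Measurable fun (a : ℕ → V) n => a (n + 1) :=
  measurable_pi_iff.2 fun n => measurable_pi_apply (n + 1)

lemma measurableSet_coord [DiscreteMeasurableSpace V] (k : ℕ) (S : Set V) : MeasurableSet {a : ℕ → V | a k ∈ S} :=
  measurable_pi_apply k (MeasurableSet.of_discrete (s := S))

lemma measurableSet_pathCyl [DiscreteMeasurableSpace V] (γ : ℕ → V) (n : ℕ) : MeasurableSet (pathCyl γ n) := by
  simp only [pathCyl, Set.ofPred_forall]
  exact MeasurableSet.iInter fun k => MeasurableSet.iInter fun _ => measurableSet_coord k {γ k}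

/-- The paths that follow `γ` up to time `n` and avoid `K` afterwards. -/
def pathAvoid (K : Finset V) (γ : ℕ → V) (n : ℕ) : Set (ℕ → V) :=
  {a | (∀ k ≤ n, a k = γ k) ∧ ∀ k, n < k → a k ∉ K}

lemma measurableSet_pathAvoid [DiscreteMeasurableSpace V] (K : Finset V) (γ : ℕ → V) (n : ℕ) :
    MeasurableSet (pathAvoid K γ n) := by
  have h : MeasurableSet {a : ℕ → V | ∀ k, n < k → a k ∉ K} := by
    simp only [Set.ofPred_forall]
    exact MeasurableSet.iInter fun k => MeasurableSet.iInter fun _ =>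
      measurableSet_coord k {v | v ∉ K}
  exact (measurableSet_pathCyl γ n).inter h

lemma measurableSet_avoidUntil [DiscreteMeasurableSpace V] (K : Finset V) (n : ℕ) :
    MeasurableSet {a : ℕ → V | ∀ t : ℕ, 1 ≤ t → t ≤ n → a t ∉ K} := by
  simp only [Set.ofPred_forall]
  exact MeasurableSet.iInter fun k => MeasurableSet.iInter fun _ => MeasurableSet.iInter fun _ =>
    measurableSet_coord k {v | v ∉ K}

end Paths

/-! ### Path probabilities, the Markov property and escape probabilities -/

section RandomWalk

variable {V : Type*} [Countable V] [MeasurableSpace V] [DiscreteMeasurableSpace V]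
  (G : SimpleGraph V) [G.LocallyFinite]

open scoped Classical in
lemma stepKernel_singleton {x : V} (hx : 0 < G.degree x) (y : V) :
    stepKernel G x {y} = if G.Adj x y then ((G.degree x : ℝ≥0∞))⁻¹ else 0 := by
  have h : (G.neighborFinset x).Nonempty := by
    rwa [← Finset.card_pos, SimpleGraph.card_neighborFinset_eq_degree]
  change (stepPMF G x).toMeasure {y} = _
  rw [PMF.toMeasure_apply_singleton _ _ (measurableSet_singleton y), stepPMF, dif_pos h,
    PMF.uniformOfFinset_apply, SimpleGraph.card_neighborFinset_eq_degree]
  simp only [SimpleGraph.mem_neighborFinset]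

instance isProbabilityMeasure_srwLaw (x : V) : IsProbabilityMeasure (srwLaw G x) :=
  inferInstanceAs (IsProbabilityMeasure (Kernel.trajMeasure _ _))

lemma generateFrom_pathCyl :
    (inferInstance : MeasurableSpace (ℕ → V)) =
      MeasurableSpace.generateFrom {S : Set (ℕ → V) | ∃ γ n, S = pathCyl γ n} := by
  apply le_antisymm
  · refine iSup_le fun k => ?_
    rw [← measurable_iff_comap_le]
    refine @measurable_to_countable' _ _ _ _ (MeasurableSpace.generateFrom _) _ fun v => ?_
    -- The event is a countable union over the initial segments that end at `v`. `Fin.ofNat` wraps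
    -- around only at times beyond `k`, which the cylinder does not see.
    have h : (fun a : ℕ → V => a k) ⁻¹' {v} = ⋃ η : {η : Fin (k + 1) → V // η (Fin.last k) = v},
        pathCyl (fun i => η.1 (Fin.ofNat (k + 1) i)) k := by
      ext a
      simp only [Set.mem_preimage, Set.mem_singleton_iff, Set.mem_iUnion]
      constructor
      · intro ha
        refine ⟨⟨fun i => a i, by simpa using ha⟩, fun i hi => ?_⟩
        simp [Nat.mod_eq_of_lt (Nat.lt_succ_of_le hi)]
      · rintro ⟨⟨η, hη⟩, ha⟩
        rw [ha k le_rfl]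
        refine Eq.trans (congrArg η ?_) hη
        ext
        simp
    rw [h]
    exact MeasurableSet.iUnion fun η => MeasurableSpace.measurableSet_generateFrom ⟨_, k, rfl⟩
  · refine MeasurableSpace.generateFrom_le ?_
    rintro _ ⟨γ, n, rfl⟩
    exact measurableSet_pathCyl γ n

lemma map_frestrictLe_zero_srwLaw (x : V) :
    (srwLaw G x).map (Preorder.frestrictLe (π := fun _ => V) 0) =
      (Measure.dirac x).map (MeasurableEquiv.piUnique fun _ : Finset.Iic 0 => V).symm := by
  rw [srwLaw, Kernel.trajMeasure, Measure.map_comp _ _ (by fun_prop), Kernel.traj_map_frestrictLe,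
    Kernel.partialTraj_self, Measure.id_comp]

open scoped Classical in
lemma srwLaw_pathCyl (x : V) (γ : ℕ → V) (n : ℕ) :
    srwLaw G x (pathCyl γ n) =
      (if x = γ 0 then 1 else 0) * ∏ k ∈ Finset.range n, stepKernel G (γ k) {γ (k + 1)} := by
  have hpre : ∀ n, Preorder.frestrictLe (π := fun _ => V) n ⁻¹'
      {Preorder.frestrictLe (π := fun _ => V) n γ} = pathCyl γ n := by
    intro n
    ext a
    simp only [Set.mem_preimage, Set.mem_singleton_iff, funext_iff, Subtype.forall, Finset.mem_Iic,
      Preorder.frestrictLe_apply]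
    rfl
  have hmap : ∀ n, (srwLaw G x).map (Preorder.frestrictLe (π := fun _ => V) n)
      {Preorder.frestrictLe (π := fun _ => V) n γ} = srwLaw G x (pathCyl γ n) := fun n => by
    rw [Measure.map_apply (by fun_prop) (measurableSet_singleton _), hpre]
  induction n with
  | zero =>
    rw [← hmap, map_frestrictLe_zero_srwLaw, Measure.map_apply (by fun_prop) (measurableSet_singleton _),
      Measure.dirac_apply' _ ((MeasurableEquiv.measurable _) (measurableSet_singleton _))]
    simp only [Finset.range_zero, Finset.prod_empty, mul_one, Set.indicator_apply, Pi.one_apply]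
    congr 1
    rw [Set.mem_preimage, Set.mem_singleton_iff, MeasurableEquiv.symm_apply_eq]
    rfl
  | succ n ih =>
    -- The joint law of the past up to time `n` and the next position is a composition-product with
    -- the step kernel; evaluating it on a singleton produces one more factor.
    have h := congrArg (fun m => m ({Preorder.frestrictLe (π := fun _ => V) n γ} ×ˢ {γ (n + 1)}))
      (Kernel.map_frestrictLe_trajMeasure_compProd_eq_map_trajMeasure (X := fun _ => V)
        (μ₀ := Measure.dirac x) (a := n) (κ := fun n =>
          (stepKernel G).comap (fun h => h ⟨n, Finset.mem_Iic.2 le_rfl⟩) (measurable_pi_apply _)))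
    rw [Measure.compProd_apply_prod (measurableSet_singleton _) (measurableSet_singleton _),
      lintegral_singleton, Measure.map_apply (by fun_prop)
        ((measurableSet_singleton _).prod (measurableSet_singleton _))] at h
    change stepKernel G (γ n) {γ (n + 1)} * (srwLaw G x).map (Preorder.frestrictLe (π := fun _ => V) n)
      {Preorder.frestrictLe (π := fun _ => V) n γ} = srwLaw G x _ at h
    rw [hmap, ih] at h
    rw [Finset.prod_range_succ, ← mul_assoc, mul_comm, h]
    congr 1
    ext a
    rw [Set.mk_preimage_prod, hpre]
    simp only [Set.mem_inter_iff, Set.mem_preimage, Set.mem_singleton_iff, pathCyl,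
      Set.mem_ofPred_eq, Nat.le_succ_iff, or_imp, forall_and, forall_eq]

lemma srwLaw_ae_start (x : V) : ∀ᵐ a ∂srwLaw G x, a 0 = x := by
  have h := srwLaw_pathCyl G x (fun _ => x) 0
  rw [Finset.range_zero, Finset.prod_empty, mul_one, if_pos rfl] at h
  have h' := (prob_compl_eq_zero_iff (measurableSet_pathCyl (fun _ => x) 0)).2 h
  rw [ae_iff]
  exact measure_mono_null (fun a ha (hc : a ∈ pathCyl _ _) => ha (hc 0 le_rfl)) h'

/-- The Markov property of simple random walk at time one. -/
lemma srwLaw_map_shift (x : V) :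
    (srwLaw G x).map (fun a n => a (n + 1)) = Measure.sum fun y => stepKernel G x {y} • srwLaw G y := by
  classical
  have : IsProbabilityMeasure ((srwLaw G x).map fun (a : ℕ → V) n => a (n + 1)) :=
    Measure.isProbabilityMeasure_map measurable_pathShift.aemeasurable
  refine ext_of_generate_finite _ generateFrom_pathCyl isPiSystem_pathCyl ?_ ?_
  · rintro _ ⟨γ, n, rfl⟩
    -- Since the walk starts at `x` almost surely, following `γ` after the shift is the same as
    -- following `x, γ 0, γ 1, …` from time zero.
    have h1 : (srwLaw G x).map (fun a n => a (n + 1)) (pathCyl γ n) =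
        srwLaw G x (pathCyl (fun k => Nat.casesOn k x γ) (n + 1)) := by
      rw [Measure.map_apply measurable_pathShift (measurableSet_pathCyl γ n)]
      refine measure_congr ?_
      filter_upwards [srwLaw_ae_start G x] with a ha
      refine propext ⟨fun h k hk => ?_, fun h k hk => h (k + 1) (Nat.succ_le_succ hk)⟩
      cases k with
      | zero => exact ha
      | succ k => exact h k (Nat.le_of_succ_le_succ hk)
    rw [h1, srwLaw_pathCyl, Measure.sum_apply _ (measurableSet_pathCyl γ n), Finset.prod_range_succ',
      tsum_eq_single (γ 0)]
    · rw [Measure.smul_apply, srwLaw_pathCyl, smul_eq_mul]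
      simp
      rw [mul_comm]
    · intro y hy
      rw [Measure.smul_apply, srwLaw_pathCyl, if_neg hy]
      simp
  · rw [measure_univ, Measure.sum_apply _ MeasurableSet.univ]
    simp only [Measure.smul_apply, measure_univ, smul_eq_mul, mul_one]
    have h := Measure.tsum_indicator_apply_singleton (stepKernel G x) Set.univ MeasurableSet.univ
    simpa using h.symm

lemma srwLaw_shift_preimage (x : V) {S : Set (ℕ → V)} (hS : MeasurableSet S) :
    srwLaw G x {a | (fun n => a (n + 1)) ∈ S} = ∑' y, stepKernel G x {y} * srwLaw G y S := by
  have h := congrArg (fun m => m S) (srwLaw_map_shift G x)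
  rw [Measure.map_apply measurable_pathShift hS, Measure.sum_apply _ hS] at h
  simp only [Measure.smul_apply, smul_eq_mul] at h
  exact h

lemma srwLaw_ae_adj (hdeg : ∀ x, 0 < G.degree x) (x : V) :
    ∀ᵐ a ∂srwLaw G x, ∀ n, G.Adj (a n) (a (n + 1)) := by
  classical
  rw [ae_all_iff]
  intro n
  have hm : ∀ n, MeasurableSet {a : ℕ → V | ¬ G.Adj (a n) (a (n + 1))} := fun n =>
    (show Measurable fun a : ℕ → V => (a n, a (n + 1)) by fun_prop)
      (MeasurableSet.of_discrete (s := {p : V × V | ¬ G.Adj p.1 p.2}))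
  induction n generalizing x with
  | zero =>
    have h : srwLaw G x {a | (fun n => a (n + 1)) ∈ {b : ℕ → V | ¬ G.Adj x (b 0)}} = 0 := by
      refine (srwLaw_shift_preimage G x (measurableSet_coord 0 {v | ¬ G.Adj x v})).trans ?_
      refine ENNReal.tsum_eq_zero.2 fun y => ?_
      rw [stepKernel_singleton G (hdeg x)]
      split_ifs with hxy
      · refine mul_eq_zero_of_right _ ?_
        have := srwLaw_ae_start G y
        rw [ae_iff] at this
        refine measure_mono_null ?_ this
        intro b hb hb0
        exact hb (hb0 ▸ hxy)
      · simp
    filter_upwards [srwLaw_ae_start G x, measure_eq_zero_iff_ae_notMem.1 h] with a ha hb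
    simpa [ha] using hb
  | succ n ih =>
    rw [ae_iff]
    refine (srwLaw_shift_preimage G x (hm n)).trans ?_
    refine ENNReal.tsum_eq_zero.2 fun y => mul_eq_zero_of_right _ ?_
    exact ae_iff.1 (ih y)

/-- The probability `P_x(H̃_K = ∞)` of never visiting `K` at a positive time. -/
noncomputable def escape (K : Finset V) (x : V) : ℝ≥0∞ :=
  srwLaw G x {a | ∀ t : ℕ, 1 ≤ t → a t ∉ K}

/-- The Markov property at time `n`, obtained by iterating the one-step shift. The prescribed
vertices themselves are allowed to lie in `K`; only later visits are forbidden. -/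
lemma srwLaw_pathAvoid (K : Finset V) (γ : ℕ → V) (n : ℕ) :
    srwLaw G (γ 0) (pathAvoid K γ n) =
      (∏ k ∈ Finset.range n, stepKernel G (γ k) {γ (k + 1)}) * escape G K (γ n) := by
  induction n generalizing γ with
  | zero =>
    rw [Finset.range_zero, Finset.prod_empty, one_mul, escape]
    refine measure_congr ?_
    filter_upwards [srwLaw_ae_start G (γ 0)] with a ha
    refine propext ⟨fun h k hk => h.2 k hk, fun h => ⟨fun k hk => ?_, fun k hk => h k hk⟩⟩
    rw [Nat.le_zero.1 hk, ha]
  | succ n ih =>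
    have h : srwLaw G (γ 0) (pathAvoid K γ (n + 1)) =
        srwLaw G (γ 0) {a | (fun n => a (n + 1)) ∈ pathAvoid K (fun k => γ (k + 1)) n} := by
      refine measure_congr ?_
      filter_upwards [srwLaw_ae_start G (γ 0)] with a ha
      refine propext ⟨fun h => ⟨fun k hk => h.1 (k + 1) (Nat.succ_le_succ hk),
        fun k hk => h.2 (k + 1) (Nat.succ_lt_succ hk)⟩, fun h => ⟨fun k hk => ?_, fun k hk => ?_⟩⟩
      · cases k with
        | zero => exact ha
        | succ k => exact h.1 k (Nat.le_of_succ_le_succ hk)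
      · cases k with
        | zero => simp at hk
        | succ k => exact h.2 k (Nat.lt_of_succ_lt_succ hk)
    rw [h, srwLaw_shift_preimage G _ (measurableSet_pathAvoid _ _ _), tsum_eq_single (γ 1)]
    · rw [ih fun k => γ (k + 1), Finset.prod_range_succ']
      ring
    · intro y hy
      refine mul_eq_zero_of_right _ ?_
      have := srwLaw_ae_start G y
      rw [ae_iff] at this
      refine measure_mono_null ?_ this
      intro a ha ha0
      exact hy (ha0.symm.trans (ha.1 0 (Nat.zero_le n)))

/-- The probability of not visiting `K` at the times `1, …, n`. -/
noncomputable def escapeUntil (K : Finset V) (n : ℕ) (x : V) : ℝ≥0∞ :=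
  srwLaw G x {a | ∀ t : ℕ, 1 ≤ t → t ≤ n → a t ∉ K}

lemma escape_le_escapeUntil (K : Finset V) (n : ℕ) (x : V) : escape G K x ≤ escapeUntil G K n x :=
  measure_mono fun _ ha t ht _ => ha t ht

lemma antitone_escapeUntil (K : Finset V) (x : V) : Antitone fun n => escapeUntil G K n x :=
  fun _ _ hmn => measure_mono fun _ ha t ht htm => ha t ht (htm.trans hmn)

lemma tendsto_escapeUntil (K : Finset V) (x : V) :
    Tendsto (fun n => escapeUntil G K n x) atTop (𝓝 (escape G K x)) := by
  have h : {a : ℕ → V | ∀ t : ℕ, 1 ≤ t → a t ∉ K} =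
      ⋂ n : ℕ, {a : ℕ → V | ∀ t : ℕ, 1 ≤ t → t ≤ n → a t ∉ K} := by
    ext a
    simp only [Set.mem_ofPred_eq, Set.mem_iInter]
    exact ⟨fun h n t ht _ => h t ht, fun h t ht => h t t ht le_rfl⟩
  rw [escape, h]
  exact tendsto_measure_iInter_atTop (fun n => (measurableSet_avoidUntil K n).nullMeasurableSet)
    (fun m n hmn _ ha t ht htm => ha t ht (htm.trans hmn)) ⟨0, measure_ne_top _ _⟩

lemma escape_le_one (K : Finset V) (x : V) : escape G K x ≤ 1 := prob_le_one

lemma escapeUntil_le_one (K : Finset V) (n : ℕ) (x : V) : escapeUntil G K n x ≤ 1 := prob_le_one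

lemma escapeUntil_empty (n : ℕ) (x : V) : escapeUntil G ∅ n x = 1 := by
  simp [escapeUntil]

variable {G}

/-- In a connected graph an isolated vertex is the only vertex, and the path that stays there
forever contradicts transience. -/
lemma IsTransient.degree_pos (h : IsTransient G) (hc : G.Connected) (x : V) : 0 < G.degree x := by
  classical
  by_contra h0
  have hn : ¬ (G.neighborFinset x).Nonempty := by
    rw [← Finset.card_pos, SimpleGraph.card_neighborFinset_eq_degree]
    exact h0
  have hsub : ∀ y, y = x := by
    intro y
    by_contra hy
    obtain ⟨w⟩ := hc.preconnected x y
    cases w with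
    | nil => exact hy rfl
    | cons hadj _ => exact hn ⟨_, (SimpleGraph.mem_neighborFinset ..).2 hadj⟩
  obtain ⟨a, ha⟩ := (h x x).exists
  refine Set.infinite_univ (ha.subset fun n _ => ?_)
  exact hsub (a n)

end RandomWalk

/-! ### Traces of walks on finite sets -/

section FiniteWalks

variable {V : Type*} {G : SimpleGraph V}

lemma exists_walk_of_adj (f : ℕ → V) (n : ℕ) (h : ∀ k < n, G.Adj (f k) (f (k + 1))) :
    ∃ p : G.Walk (f 0) (f n), p.length = n ∧ ∀ k ≤ n, p.getVert k = f k := by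
  induction n generalizing f with
  | zero =>
    refine ⟨SimpleGraph.Walk.nil, rfl, fun k hk => ?_⟩
    rw [Nat.le_zero.1 hk]
    rfl
  | succ n ih =>
    obtain ⟨p, hp, hpf⟩ := ih (fun k => f (k + 1)) fun k hk => h (k + 1) (Nat.succ_lt_succ hk)
    refine ⟨SimpleGraph.Walk.cons (h 0 n.succ_pos) p, by simp [hp], fun k hk => ?_⟩
    cases k with
    | zero => rfl
    | succ k =>
      rw [SimpleGraph.Walk.getVert_cons_succ]
      exact hpf k (Nat.le_of_succ_le_succ hk)

namespace FinWalk

lemma ext {γ δ : FinWalk G} (hl : γ.len = δ.len) (hv : ∀ k ≤ γ.len, γ.vert k = δ.vert k) :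
    γ = δ := by
  obtain ⟨x, y, p⟩ := γ
  obtain ⟨x', y', q⟩ := δ
  change p.length = q.length at hl
  change ∀ k ≤ p.length, p.getVert k = q.getVert k at hv
  obtain rfl : x = x' := by simpa using hv 0 (Nat.zero_le _)
  obtain rfl : y = y' := by
    have := hv p.length le_rfl
    rwa [SimpleGraph.Walk.getVert_length, hl, SimpleGraph.Walk.getVert_length] at this
  rw [SimpleGraph.Walk.ext_getVert_le_length hl hv]

lemma exists_of_adj (f : ℕ → V) (n : ℕ) (h : ∀ k < n, G.Adj (f k) (f (k + 1))) :
    ∃ γ : FinWalk G, γ.len = n ∧ ∀ k ≤ n, γ.vert k = f k := by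
  obtain ⟨p, hp⟩ := exists_walk_of_adj f n h
  exact ⟨⟨_, _, p⟩, hp⟩

lemma adj_vert (γ : FinWalk G) {k : ℕ} (hk : k < γ.len) : G.Adj (γ.vert k) (γ.vert (k + 1)) :=
  γ.2.2.adj_getVert_succ hk

instance [Countable V] : Countable (FinWalk G) := by
  refine Function.Injective.countable
    (f := fun γ : FinWalk G => (List.range (γ.len + 1)).map γ.vert) fun γ δ h => ?_
  have hl : γ.len = δ.len := by simpa using congrArg List.length h
  refine ext hl fun k hk => ?_
  have := List.map_eq_map_iff.1 (h.trans (by dsimp only; rw [hl]) :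
    (List.range (γ.len + 1)).map γ.vert = (List.range (γ.len + 1)).map δ.vert)
  exact this k (by simpa using Nat.lt_succ_of_le hk)

end FinWalk

end FiniteWalks

/-! ### Traces, saturated sets and the Borel structure of `𝓦*` -/

section Traces

variable {V : Type*} {G : SimpleGraph V}

lemma eq_some_of_trunc {K : Finset V} {w : WalkSpace G} {i : ℤ} {x : V}
    (h : trunc K w i = some x) : w.1 i = some x := by
  unfold trunc at h
  split_ifs at h
  exact h

lemma trunc_eq_of_between {K : Finset V} {w : WalkSpace G} {a i b : ℤ} (ha : a ≤ i) (hb : i ≤ b)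
    {x y : V} (hx : x ∈ K) (hax : w.1 a = some x) (hy : y ∈ K) (hby : w.1 b = some y) :
    trunc K w i = w.1 i := if_pos ⟨a, b, ha, hb, ⟨x, hx, hax⟩, ⟨y, hy, hby⟩⟩

lemma trunc_of_mem {K : Finset V} {w : WalkSpace G} {i : ℤ} {x : V} (hx : x ∈ K)
    (h : w.1 i = some x) : trunc K w i = some x :=
  (trunc_eq_of_between le_rfl le_rfl hx h hx h).trans h

lemma visit_of_trunc_eq {K M : Finset V} (hKM : K ⊆ M) {w w' : WalkSpace G}
    (h : trunc M w = trunc M w') {i : ℤ} {x : V} (hx : x ∈ K) (hi : w.1 i = some x) :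
    w'.1 i = some x := by
  refine eq_some_of_trunc (K := M) ?_
  rw [← h]
  exact trunc_of_mem (hKM hx) hi

lemma mem_hit_of_trunc_eq {K M : Finset V} (hKM : K ⊆ M) {w w' : WalkSpace G}
    (h : trunc M w = trunc M w') (hw : w ∈ hit K) : w' ∈ hit K := by
  obtain ⟨i, x, hx, hi⟩ := hw
  exact ⟨i, x, hx, visit_of_trunc_eq hKM h hx hi⟩

/-- All visits to `K` are visits to `M`, hence are recorded by the restriction to the time span of
`M`. Enlarging the finite set refines the information. -/
lemma trunc_congr {K M : Finset V} (hKM : K ⊆ M) {w w' : WalkSpace G}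
    (h : trunc M w = trunc M w') : trunc K w = trunc K w' := by
  funext i
  by_cases hi : ∃ a b, a ≤ i ∧ i ≤ b ∧ (∃ x ∈ K, w.1 a = some x) ∧ (∃ y ∈ K, w.1 b = some y)
  · obtain ⟨a, b, ha, hb, ⟨x, hx, hax⟩, y, hy, hby⟩ := hi
    have hax' := visit_of_trunc_eq hKM h hx hax
    have hby' := visit_of_trunc_eq hKM h hy hby
    rw [trunc_eq_of_between ha hb hx hax hy hby, trunc_eq_of_between ha hb hx hax' hy hby',
      ← trunc_eq_of_between ha hb (hKM hx) hax (hKM hy) hby, h,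
      trunc_eq_of_between ha hb (hKM hx) hax' (hKM hy) hby']
  · have hi' : ¬ ∃ a b, a ≤ i ∧ i ≤ b ∧ (∃ x ∈ K, w'.1 a = some x) ∧ (∃ y ∈ K, w'.1 b = some y) := by
      rintro ⟨a, b, ha, hb, ⟨x, hx, hax⟩, y, hy, hby⟩
      exact hi ⟨a, b, ha, hb, ⟨x, hx, visit_of_trunc_eq hKM h.symm hx hax⟩, y, hy,
        visit_of_trunc_eq hKM h.symm hy hby⟩
    exact (if_neg hi).trans (if_neg hi').symm

/-- The part of `w` from its first to its last visit to `K` is `γ`, and starts at time `0`. -/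
def IsTrace (K : Finset V) (γ : FinWalk G) (w : WalkSpace G) : Prop :=
  (γ.vert 0 ∈ K ∧ γ.vert γ.len ∈ K) ∧ (∀ k : ℕ, k ≤ γ.len → w.1 k = some (γ.vert k)) ∧
    ∀ i : ℤ, i < 0 ∨ (γ.len : ℤ) < i → ∀ x ∈ K, w.1 i ≠ some x

lemma IsTrace.mem_Icc {K : Finset V} {γ : FinWalk G} {w : WalkSpace G} (h : IsTrace K γ w) {i : ℤ}
    {x : V} (hx : x ∈ K) (hi : w.1 i = some x) : 0 ≤ i ∧ i ≤ γ.len := by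
  by_contra hc
  exact h.2.2 i (by omega) x hx hi

lemma IsTrace.zero_eq {K : Finset V} {γ : FinWalk G} {w : WalkSpace G} (h : IsTrace K γ w) :
    w.1 0 = some (γ.vert 0) := h.2.1 0 (Nat.zero_le _)

lemma IsTrace.mem_hit {K : Finset V} {γ : FinWalk G} {w : WalkSpace G} (h : IsTrace K γ w) :
    w ∈ hit K := ⟨0, _, h.1.1, h.zero_eq⟩

/-- The set `K` is visited at finitely many times, so first and last visits exist, and the walk is
defined between them because its domain is an interval. The shift moves the first visit to time
zero. -/
lemma exists_isTrace {K : Finset V} {w : WalkSpace G} (hw : w ∈ hit K) :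
    ∃ (k : ℤ) (γ : FinWalk G), IsTrace K γ (shift k w) := by
  classical
  have hA : {i | ∃ x ∈ K, w.1 i = some x}.Finite := by
    have h : {i | ∃ x ∈ K, w.1 i = some x} = ⋃ x ∈ K, {i | w.1 i = some x} := by
      ext i
      simp
    rw [h]
    exact K.finite_toSet.biUnion fun x _ => w.2.2.2.2 x
  have hne : hA.toFinset.Nonempty := by
    obtain ⟨i, hi⟩ := hw
    exact ⟨i, hA.mem_toFinset.2 hi⟩
  set a := hA.toFinset.min' hne
  set b := hA.toFinset.max' hne
  obtain ⟨x, hx, hax⟩ := hA.mem_toFinset.1 (hA.toFinset.min'_mem hne)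
  obtain ⟨y, hy, hby⟩ := hA.mem_toFinset.1 (hA.toFinset.max'_mem hne)
  have hmin : ∀ i, ∀ x ∈ K, w.1 i = some x → a ≤ i ∧ i ≤ b := fun i x hx hi =>
    ⟨hA.toFinset.min'_le i (hA.mem_toFinset.2 ⟨x, hx, hi⟩),
      hA.toFinset.le_max' i (hA.mem_toFinset.2 ⟨x, hx, hi⟩)⟩
  have hab : a ≤ b := (hmin b y hy hby).1
  have hdef : ∀ k : ℕ, k ≤ (b - a).toNat → ∃ z, w.1 (k + a) = some z := by
    intro k hk
    refine Option.ne_none_iff_exists'.1 (w.2.2.1.out (x := a) (y := b) ?_ ?_ ⟨?_, ?_⟩)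
    · change w.1 a ≠ none
      rw [hax]
      simp
    · change w.1 b ≠ none
      rw [hby]
      simp
    · omega
    · omega
  have : Nonempty V := ⟨x⟩
  choose! f hf using hdef
  obtain ⟨γ, hγ, hγf⟩ := FinWalk.exists_of_adj (G := G) f (b - a).toNat fun k hk =>
    w.2.2.2.1 (k + a) _ _ (hf k hk.le) (by
      have := hf (k + 1) hk
      rwa [show ((k + 1 : ℕ) : ℤ) + a = k + a + 1 by push_cast; ring] at this)
  refine ⟨a, γ, ⟨?_, ?_⟩, fun k hk => ?_, fun i hi z hz hiz => ?_⟩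
  · rw [hγf 0 (Nat.zero_le _)]
    have := hf 0 (Nat.zero_le _)
    rw [Nat.cast_zero, zero_add, hax] at this
    exact Option.some.inj this ▸ hx
  · rw [hγ, hγf _ le_rfl]
    have := hf _ le_rfl
    rw [Int.toNat_of_nonneg (by omega), sub_add_cancel, hby] at this
    exact Option.some.inj this ▸ hy
  · rw [hγ] at hk
    rw [shift_apply, hf k hk, hγf k hk]
  · have := hmin (i + a) z hz hiz
    omega

/-- Time zero is the first visit to `K` for both the walk and its shift, which gives `0 ≤ k` and `0
≤ -k`; the last visits then fix the length. -/
lemma IsTrace.unique {K : Finset V} {γ δ : FinWalk G} {w : WalkSpace G} {k : ℤ}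
    (h : IsTrace K γ w) (h' : IsTrace K δ (shift k w)) : k = 0 ∧ γ = δ := by
  have h1 : 0 ≤ k := (h.mem_Icc h'.1.1 (by simpa using h'.zero_eq)).1
  have h2 : 0 ≤ -k := (h'.mem_Icc h.1.1 (by simpa using h.zero_eq)).1
  obtain rfl : k = 0 := by omega
  rw [shift_zero] at h'
  have h3 := (h'.mem_Icc h.1.2 (h.2.1 _ le_rfl)).2
  have h4 := (h.mem_Icc h'.1.2 (h'.2.1 _ le_rfl)).2
  have hl : γ.len = δ.len := by omega
  refine ⟨rfl, FinWalk.ext hl fun k hk => ?_⟩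
  have := (h.2.1 k hk).symm.trans (h'.2.1 k (hl ▸ hk))
  exact Option.some.inj this

lemma IsTrace.of_mem_cyl {K : Finset V} {γ : FinWalk G} {w w' : WalkSpace G} (h : IsTrace K γ w)
    (h' : w' ∈ cyl K w) : IsTrace K γ w' := by
  refine ⟨h.1, fun k hk => ?_, fun i hi x hx hix => ?_⟩
  · refine eq_some_of_trunc (K := K) ?_
    rw [h'.2, ← h.2.1 k hk]
    exact trunc_eq_of_between (by omega) (by exact_mod_cast hk) h.1.1 h.zero_eq h.1.2
      (h.2.1 _ le_rfl)
  · exact h.2.2 i hi x hx (visit_of_trunc_eq (Finset.Subset.refl K) h'.2 hx hix)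

lemma IsTrace.trunc_eq {K : Finset V} {γ : FinWalk G} {w w' : WalkSpace G} (h : IsTrace K γ w)
    (h' : IsTrace K γ w') : trunc K w = trunc K w' := by
  funext i
  by_cases hi : 0 ≤ i ∧ i ≤ γ.len
  · rw [trunc_eq_of_between hi.1 hi.2 h.1.1 h.zero_eq h.1.2 (h.2.1 _ le_rfl),
      trunc_eq_of_between hi.1 hi.2 h'.1.1 h'.zero_eq h'.1.2 (h'.2.1 _ le_rfl)]
    lift i to ℕ using hi.1
    rw [h.2.1 i (by omega), h'.2.1 i (by omega)]
  · have : ∀ {v : WalkSpace G}, IsTrace K γ v → trunc K v i = none := by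
      intro v hv
      refine if_neg ?_
      rintro ⟨a, b, ha, hb, ⟨x, hx, hax⟩, y, hy, hby⟩
      have h1 := hv.mem_Icc hx hax
      have h2 := hv.mem_Icc hy hby
      omega
    rw [this h, this h']

/-- The walks modulo shift whose part from the first to the last visit to `K` is `γ`. -/
def traceSet (K : Finset V) (γ : FinWalk G) : Set (WalkSpaceMod G) := proj '' {w | IsTrace K γ w}

lemma proj_shift (k : ℤ) (w : WalkSpace G) : proj (shift k w) = proj w :=
  (proj_eq_iff _ _).2 ⟨k, rfl⟩

lemma proj_mem_traceSet {K : Finset V} {γ : FinWalk G} {w : WalkSpace G} :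
    proj w ∈ traceSet K γ ↔ ∃ k, IsTrace K γ (shift k w) := by
  constructor
  · rintro ⟨w', hw', h⟩
    obtain ⟨k, rfl⟩ := (proj_eq_iff _ _).1 h
    exact ⟨k, hw'⟩
  · rintro ⟨k, hk⟩
    exact ⟨_, hk, proj_shift k w⟩

lemma proj_mem_hitMod {K : Finset V} {w : WalkSpace G} : proj w ∈ hitMod K ↔ w ∈ hit K := by
  rw [← Set.mem_preimage, proj_preimage_hitMod]

lemma traceSet_subset_hitMod (K : Finset V) (γ : FinWalk G) : traceSet K γ ⊆ hitMod K := by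
  rintro _ ⟨w, hw, rfl⟩
  exact proj_mem_hitMod.2 hw.mem_hit

lemma disjoint_traceSet {K : Finset V} {γ δ : FinWalk G} (h : γ ≠ δ) :
    Disjoint (traceSet K γ) (traceSet K δ) := by
  refine Set.disjoint_left.2 ?_
  rintro _ ⟨w, hw, rfl⟩ hδ
  obtain ⟨k, hk⟩ := proj_mem_traceSet.1 hδ
  exact h (hw.unique hk).2

lemma isOpen_traceSet (K : Finset V) (γ : FinWalk G) : IsOpen (traceSet K γ) := by
  have h : traceSet K γ = ⋃ w ∈ {w : WalkSpace G | IsTrace K γ w}, proj '' cyl K w := by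
    ext p
    simp only [Set.mem_iUnion, exists_prop]
    constructor
    · rintro ⟨w, hw, rfl⟩
      exact ⟨w, hw, w, ⟨IsTrace.mem_hit hw, rfl⟩, rfl⟩
    · rintro ⟨w, hw, w', hw', rfl⟩
      exact ⟨w', IsTrace.of_mem_cyl hw hw', rfl⟩
  rw [h]
  exact isOpen_biUnion fun w hw => isOpen_proj_cyl (IsTrace.mem_hit hw)

lemma measurableSet_traceSet (K : Finset V) (γ : FinWalk G) : MeasurableSet (traceSet K γ) :=
  (isOpen_traceSet K γ).measurableSet

/-- `U` is a union of sets of the form `traceSet K γ`. -/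
def IsSaturated (K : Finset V) (U : Set (WalkSpaceMod G)) : Prop :=
  U ⊆ hitMod K ∧ ∀ γ w w', IsTrace K γ w → IsTrace K γ w' → proj w ∈ U → proj w' ∈ U

/-- The trace on `M` determines the trace on `K`. This allows finitely many sets, saturated over
different finite sets, to be treated over their union. -/
lemma IsSaturated.mono {K M : Finset V} {U : Set (WalkSpaceMod G)} (h : IsSaturated K U)
    (hKM : K ⊆ M) : IsSaturated M U := by
  refine ⟨h.1.trans (Set.image_mono ?_), fun γ w w' hw hw' hU => ?_⟩
  · rintro w ⟨i, x, hx, hi⟩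
    exact ⟨i, x, hKM hx, hi⟩
  · have hK : w ∈ hit K := proj_mem_hitMod.1 (h.1 hU)
    obtain ⟨k, δ, hδ⟩ := exists_isTrace hK
    have ht := hw.trunc_eq hw'
    have hcyl : shift k w' ∈ cyl K (shift k w) := by
      refine ⟨shift_mem_hit.2 (mem_hit_of_trunc_eq hKM ht hK), ?_⟩
      funext i
      rw [trunc_shift, trunc_shift, trunc_congr hKM ht]
    rw [← proj_shift k w']
    refine h.2 δ _ _ hδ (hδ.of_mem_cyl hcyl) ?_
    rwa [proj_shift]

lemma isSaturated_hitMod (K : Finset V) : IsSaturated K (hitMod (G := G) K) :=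
  ⟨subset_rfl, fun _ _ _ _ hw' _ => proj_mem_hitMod.2 hw'.mem_hit⟩

lemma isSaturated_proj_cyl (K : Finset V) (v : WalkSpace G) :
    IsSaturated K (proj '' cyl K v) := by
  refine ⟨Set.image_mono fun w hw => hw.1, fun γ w w' hw hw' => ?_⟩
  rintro ⟨w₁, hw₁, h⟩
  obtain ⟨k, rfl⟩ := (proj_eq_iff _ _).1 h
  refine ⟨shift k w', ⟨shift_mem_hit.2 hw'.mem_hit, ?_⟩, proj_shift k w'⟩
  rw [← hw₁.2]
  funext i
  rw [trunc_shift, trunc_shift, hw.trunc_eq hw']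

lemma IsSaturated.inter {K : Finset V} {U U' : Set (WalkSpaceMod G)} (h : IsSaturated K U)
    (h' : IsSaturated K U') : IsSaturated K (U ∩ U') :=
  ⟨Set.inter_subset_left.trans h.1, fun γ w w' hw hw' hU =>
    ⟨h.2 γ w w' hw hw' hU.1, h'.2 γ w w' hw hw' hU.2⟩⟩

lemma IsSaturated.diff {K : Finset V} {U U' : Set (WalkSpaceMod G)} (h : IsSaturated K U)
    (h' : IsSaturated K U') : IsSaturated K (U \ U') :=
  ⟨Set.sdiff_subset.trans h.1, fun γ w w' hw hw' hU =>
    ⟨h.2 γ w w' hw hw' hU.1, fun hU' => hU.2 (h'.2 γ w' w hw' hw hU')⟩⟩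

lemma IsSaturated.atom {K : Finset V} {κ : Type*} {A : κ → Set (WalkSpaceMod G)}
    (hA : ∀ i, IsSaturated K (A i)) {S : Finset κ} (hS : S.Nonempty) :
    IsSaturated K (atom A S) := by
  obtain ⟨i, hi⟩ := hS
  refine ⟨(atom_subset hi).trans (hA i).1, fun γ w w' hw hw' hU j => ?_⟩
  rw [← hU j]
  exact ⟨(hA j).2 γ w' w hw' hw, (hA j).2 γ w w' hw hw'⟩

lemma IsSaturated.eq_iUnion {K : Finset V} {U : Set (WalkSpaceMod G)} (h : IsSaturated K U) :
    U = ⋃ γ : {γ : FinWalk G // traceSet K γ ⊆ U}, traceSet K γ.1 := by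
  refine Set.Subset.antisymm (fun p hp => ?_) (Set.iUnion_subset fun γ => γ.2)
  obtain ⟨w, hw, rfl⟩ := h.1 hp
  obtain ⟨k, γ, hγ⟩ := exists_isTrace hw
  refine Set.mem_iUnion.2 ⟨⟨γ, ?_⟩, proj_mem_traceSet.2 ⟨k, hγ⟩⟩
  rintro _ ⟨w', hw', rfl⟩
  exact h.2 γ _ _ hγ hw' (by rwa [proj_shift])

lemma IsSaturated.measurableSet {K : Finset V} {U : Set (WalkSpaceMod G)} (h : IsSaturated K U) :
    MeasurableSet U := by
  have ho : IsOpen (⋃ γ : {γ : FinWalk G // traceSet K γ ⊆ U}, traceSet K γ.1) :=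
    isOpen_iUnion fun γ => isOpen_traceSet K γ.1
  rw [h.eq_iUnion]
  exact ho.measurableSet

/-- There are only countably many finite walks, so on saturated sets a measure is determined by a
countable list of trace masses. -/
lemma IsSaturated.measure_eq [Countable V] {K : Finset V} {U : Set (WalkSpaceMod G)}
    (h : IsSaturated K U) (μ : Measure (WalkSpaceMod G)) :
    μ U = ∑' γ : {γ : FinWalk G // traceSet K γ ⊆ U}, μ (traceSet K γ.1) := by
  have : Countable {γ : FinWalk G // traceSet K γ ⊆ U} := Subtype.countable
  have hd : Pairwise fun γ δ : {γ : FinWalk G // traceSet K γ ⊆ U} =>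
      Disjoint (traceSet K γ.1) (traceSet K δ.1) :=
    fun γ δ hγδ => disjoint_traceSet fun h => hγδ (Subtype.ext h)
  exact (congrArg μ h.eq_iUnion).trans
    (measure_iUnion hd fun γ => measurableSet_traceSet K γ.1)

/-- The generating sets of the topology are a base and not merely a subbase: two cylinders around
`w` are refined by the one for the union of their finite sets. -/
lemma exists_cyl_subset {O : Set (WalkSpace G)} (hO : IsOpen O) {w : WalkSpace G} (hw : w ∈ O) :
    ∃ K : Finset V, w ∈ hit K ∧ cyl K w ⊆ O := by
  classical
  induction hO with
  | basic s hs =>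
    obtain ⟨K, w', -, rfl⟩ := hs
    exact ⟨K, hw.1, fun v hv => ⟨hv.1, hv.2.trans hw.2⟩⟩
  | univ =>
    obtain ⟨i, hi⟩ := w.2.1
    obtain ⟨x, hx⟩ := Option.ne_none_iff_exists'.1 hi
    exact ⟨{x}, ⟨i, x, Finset.mem_singleton_self x, hx⟩, Set.subset_univ _⟩
  | inter s t _ _ hs ht =>
    obtain ⟨K, hK, hKs⟩ := hs hw.1
    obtain ⟨M, hM, hMt⟩ := ht hw.2
    have key : ∀ {L : Finset V}, L ⊆ K ∪ M → w ∈ hit L → cyl (K ∪ M) w ⊆ cyl L w :=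
      fun hL hw v hv => ⟨mem_hit_of_trunc_eq hL hv.2.symm hw, trunc_congr hL hv.2⟩
    refine ⟨K ∪ M, ?_, fun v hv => ⟨hKs (key Finset.subset_union_left hK hv),
      hMt (key Finset.subset_union_right hM hv)⟩⟩
    obtain ⟨i, x, hx, hi⟩ := hK
    exact ⟨i, x, Finset.mem_union_left _ hx, hi⟩
  | sUnion S _ hS =>
    obtain ⟨s, hs, hws⟩ := hw
    obtain ⟨K, hK, hKs⟩ := hS s hs hws
    exact ⟨K, hK, hKs.trans (Set.subset_sUnion_of_mem hs)⟩

lemma continuous_proj : Continuous (proj (G := G)) := continuous_quot_mk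

lemma measurable_proj : Measurable (proj (G := G)) := continuous_proj.measurable

/-- Only sets saturated over some `M ⊇ L` are admitted, because the trace formula for `Q_L` is
available for such `M` only. Monotonicity of saturation shows that these still generate, and there
are countably many cylinder sets. -/
lemma borel_eq_generateFrom_saturated [Countable V] (L : Finset V) :
    (inferInstance : MeasurableSpace (WalkSpaceMod G)) = MeasurableSpace.generateFrom
      {U | ∃ M : Finset V, L ⊆ M ∧ IsSaturated M U} := by
  classical
  apply le_antisymm
  · refine MeasurableSpace.generateFrom_le fun U hU => ?_
    have h : U = ⋃ S : {S : cylMod G // S.1 ⊆ U}, S.1.1 := by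
      refine Set.Subset.antisymm (fun p hp => ?_) (Set.iUnion_subset fun S => S.2)
      obtain ⟨w, rfl⟩ : ∃ w, proj w = p := Quotient.exists_rep p
      obtain ⟨K, hK, hKU⟩ := exists_cyl_subset (continuous_proj.isOpen_preimage U hU) hp
      exact Set.mem_iUnion.2 ⟨⟨⟨_, K, w, hK, rfl⟩, Set.image_subset_iff.2 hKU⟩, w, ⟨hK, rfl⟩, rfl⟩
    rw [h]
    have : Countable {S : cylMod G // S.1 ⊆ U} := Subtype.countable
    refine MeasurableSet.iUnion fun S => MeasurableSpace.measurableSet_generateFrom ?_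
    obtain ⟨K, w', -, hS⟩ := S.1.2
    refine ⟨L ∪ K, Finset.subset_union_left, ?_⟩
    rw [hS]
    exact (isSaturated_proj_cyl K w').mono Finset.subset_union_right
  · refine MeasurableSpace.generateFrom_le ?_
    rintro U ⟨M, -, hM⟩
    exact hM.measurableSet

lemma isPiSystem_saturated (L : Finset V) :
    IsPiSystem {U : Set (WalkSpaceMod G) | ∃ M : Finset V, L ⊆ M ∧ IsSaturated M U} := by
  classical
  rintro U ⟨M, hM, hU⟩ U' ⟨M', hM', hU'⟩ -
  exact ⟨M ∪ M', hM.trans Finset.subset_union_left, (hU.mono Finset.subset_union_left).inter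
    (hU'.mono Finset.subset_union_right)⟩

/-- Finite measures of equal mass on `𝓦*` are determined by their values on the sets
`traceSet M γ` with `M` large. -/
lemma measure_ext_of_traceSet [Countable V] {μ ν : Measure (WalkSpaceMod G)} [IsFiniteMeasure μ]
    (L : Finset V) (h : ∀ M : Finset V, L ⊆ M → ∀ γ, μ (traceSet M γ) = ν (traceSet M γ))
    (huniv : μ Set.univ = ν Set.univ) : μ = ν := by
  refine ext_of_generate_finite _ (borel_eq_generateFrom_saturated L) (isPiSystem_saturated L)
    ?_ huniv
  rintro U ⟨M, hM, hU⟩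
  rw [hU.measure_eq, hU.measure_eq]
  exact tsum_congr fun γ => h M hM γ.1

end Traces

/-! ### The intensity measure of random interlacements -/

section Glue

variable {V : Type*} {G : SimpleGraph V}

/-- The vertex of the glued path at time `i`. -/
def glueVert (p : (ℕ → V) × (ℕ → V)) (i : ℤ) : V := if 0 ≤ i then p.2 i.toNat else p.1 (-i).toNat

lemma glue_eq (p : (ℕ → V) × (ℕ → V)) (i : ℤ) : glue p i = some (glueVert p i) := rfl

lemma glueVert_natCast (p : (ℕ → V) × (ℕ → V)) (n : ℕ) : glueVert p n = p.2 n := by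
  simp [glueVert]

lemma glueVert_neg_natCast {p : (ℕ → V) × (ℕ → V)} (h : p.1 0 = p.2 0) (n : ℕ) :
    glueVert p (-n) = p.1 n := by
  cases n with
  | zero => simpa [glueVert] using h.symm
  | succ n => rw [glueVert, if_neg (by omega), neg_neg, Int.toNat_natCast]

/-- Finiteness of the visits to `x` is expressed by a bound `N` on the visiting times, so that the
condition becomes a countable combination of coordinate events. -/
lemma isWalk_glue_iff (p : (ℕ → V) × (ℕ → V)) :
    IsWalk G (glue p) ↔ (∀ i, G.Adj (glueVert p i) (glueVert p (i + 1))) ∧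
      ∀ x, ∃ N : ℕ, ∀ i : ℤ, N < i.natAbs → glueVert p i ≠ x := by
  have h : ∀ x, {i | glue p i = some x} = {i | glueVert p i = x} := fun x => by
    ext i
    simp [glue_eq]
  constructor
  · rintro ⟨-, -, h1, h2⟩
    refine ⟨fun i => h1 i _ _ rfl rfl, fun x => ?_⟩
    have hf := h2 x
    rw [h] at hf
    obtain ⟨a, ha⟩ := hf.bddBelow
    obtain ⟨b, hb⟩ := hf.bddAbove
    refine ⟨max a.natAbs b.natAbs, fun i hi hix => ?_⟩
    have h3 : a ≤ i := ha hix
    have h4 : i ≤ b := hb hix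
    omega
  · rintro ⟨h1, h2⟩
    refine ⟨⟨0, by simp [glue_eq]⟩, ?_, fun i x y hx hy => ?_, fun x => ?_⟩
    · convert! Set.ordConnected_univ
      ext i
      simp [glue_eq]
    · rw [glue_eq, Option.some.injEq] at hx hy
      rw [← hx, ← hy]
      exact h1 i
    · obtain ⟨N, hN⟩ := h2 x
      rw [h]
      refine (Set.finite_Icc (-(N : ℤ)) N).subset fun i hi => ?_
      by_contra hc
      rw [Set.mem_Icc] at hc
      exact hN i (by omega) hi

lemma isWalk_glue {p : (ℕ → V) × (ℕ → V)} (h0 : p.1 0 = p.2 0)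
    (h1 : ∀ n, G.Adj (p.1 n) (p.1 (n + 1))) (h2 : ∀ n, G.Adj (p.2 n) (p.2 (n + 1)))
    (hf1 : ∀ x, {n | p.1 n = x}.Finite) (hf2 : ∀ x, {n | p.2 n = x}.Finite) :
    IsWalk G (glue p) := by
  rw [isWalk_glue_iff]
  refine ⟨fun i => ?_, fun x => ?_⟩
  · rcases le_or_gt 0 i with hi | hi
    · lift i to ℕ using hi
      rw [glueVert_natCast, show (i : ℤ) + 1 = (i + 1 : ℕ) by push_cast; rfl, glueVert_natCast]
      exact h2 i
    · obtain ⟨n, rfl⟩ : ∃ n : ℕ, i = -(n + 1 : ℕ) := ⟨(-i - 1).toNat, by omega⟩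
      rw [glueVert_neg_natCast h0, show -((n + 1 : ℕ) : ℤ) + 1 = -(n : ℤ) by push_cast; ring,
        glueVert_neg_natCast h0]
      exact (h1 n).symm
  · obtain ⟨a, ha⟩ := (hf1 x).bddAbove
    obtain ⟨b, hb⟩ := (hf2 x).bddAbove
    refine ⟨max a b, fun i hi hix => ?_⟩
    rcases le_or_gt 0 i with hi' | hi'
    · lift i to ℕ using hi'
      rw [glueVert_natCast] at hix
      have : i ≤ b := hb hix
      omega
    · obtain ⟨n, rfl⟩ : ∃ n : ℕ, i = -(n : ℤ) := ⟨(-i).toNat, by omega⟩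
      rw [glueVert_neg_natCast h0] at hix
      have : n ≤ a := ha hix
      omega

/-- The index `j` is the position in `γ` of time zero of the glued path, that is, of its first visit
to `K`. Backwards from there the path retraces `γ` and then avoids `M`; forwards it completes `γ`
and then avoids `M`. -/
lemma exists_pathAvoid_of_mem_traceSet {K M : Finset V} (hKM : K ⊆ M)
    {p : (ℕ → V) × (ℕ → V)} (hp : IsWalk G (glue p)) {x : V} (hx : x ∈ K) (h1 : p.1 0 = x)
    (h2 : p.2 0 = x) (hK : ∀ t : ℕ, 1 ≤ t → p.1 t ∉ K) {γ : FinWalk G}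
    (h : proj ⟨glue p, hp⟩ ∈ traceSet M γ) :
    ∃ j ≤ γ.len, γ.vert j = x ∧ (∀ i < j, γ.vert i ∉ K) ∧
      p.1 ∈ pathAvoid M (fun t => γ.vert (j - t)) j ∧
      p.2 ∈ pathAvoid M (fun t => γ.vert (j + t)) (γ.len - j) := by
  have h0 : p.1 0 = p.2 0 := h1.trans h2.symm
  obtain ⟨k, hk⟩ := proj_mem_traceSet.1 h
  have hw : ∀ i, (shift k ⟨glue p, hp⟩ : WalkSpace G).1 i = some (glueVert p (i + k)) := fun i => rfl
  have hj := hk.mem_Icc (i := -k) (hKM hx) (by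
    rw [hw, neg_add_cancel]
    exact congrArg some h2)
  obtain ⟨j, rfl⟩ : ∃ j : ℕ, k = -(j : ℤ) := ⟨(-k).toNat, by omega⟩
  have hin : ∀ i : ℕ, i ≤ γ.len → glueVert p (i + -(j : ℤ)) = γ.vert i := fun i hi =>
    Option.some.inj ((hw i).symm.trans (hk.2.1 i hi))
  have hout : ∀ i : ℤ, i < 0 ∨ (γ.len : ℤ) < i → glueVert p (i + -(j : ℤ)) ∉ M := fun i hi hM =>
    hk.2.2 i hi _ hM (hw i)
  have hjl : j ≤ γ.len := by omega
  have ha : ∀ t ≤ j, p.1 t = γ.vert (j - t) := by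
    intro t ht
    rw [← hin (j - t) (by omega), ← glueVert_neg_natCast h0]
    congr 1
    omega
  refine ⟨j, hjl, ?_, fun i hi => ?_, ⟨ha, fun t ht hM => ?_⟩, fun t ht => ?_, fun t ht hM => ?_⟩
  · have := ha 0 (Nat.zero_le _)
    rw [← h1, this, Nat.sub_zero]
  · have := ha (j - i) (by omega)
    rw [show j - (j - i) = i by omega] at this
    rw [← this]
    exact hK _ (by omega)
  · refine hout (j - t) (by omega) ?_
    rw [show (j : ℤ) - t + -j = -(t : ℤ) by ring, glueVert_neg_natCast h0]
    exact hM
  · change p.2 t = γ.vert (j + t)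
    rw [← hin (j + t) (by omega), ← glueVert_natCast]
    congr 1
    push_cast
    ring
  · refine hout (j + t) (by omega) ?_
    rw [show (j : ℤ) + t + -j = t by ring, glueVert_natCast]
    exact hM

lemma mem_traceSet_of_pathAvoid {M : Finset V} {p : (ℕ → V) × (ℕ → V)} (hp : IsWalk G (glue p))
    (h0 : p.1 0 = p.2 0) {γ : FinWalk G} (hγ : γ.vert 0 ∈ M ∧ γ.vert γ.len ∈ M) {j : ℕ}
    (hj : j ≤ γ.len) (h1 : p.1 ∈ pathAvoid M (fun t => γ.vert (j - t)) j)
    (h2 : p.2 ∈ pathAvoid M (fun t => γ.vert (j + t)) (γ.len - j)) :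
    proj ⟨glue p, hp⟩ ∈ traceSet M γ := by
  refine proj_mem_traceSet.2 ⟨-(j : ℤ), hγ, fun k hk => ?_, fun i hi x hx hix => ?_⟩
  · change some (glueVert p (k + -(j : ℤ))) = some (γ.vert k)
    rcases le_or_gt j k with hjk | hjk
    · rw [show (k : ℤ) + -(j : ℤ) = (k - j : ℕ) by omega, glueVert_natCast, h2.1 _ (by omega)]
      dsimp only
      rw [show j + (k - j) = k by omega]
    · rw [show (k : ℤ) + -(j : ℤ) = -((j - k : ℕ) : ℤ) by omega, glueVert_neg_natCast h0,
        h1.1 _ (by omega)]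
      dsimp only
      rw [show j - (j - k) = k by omega]
  · have hix' : glueVert p (i + -(j : ℤ)) = x := Option.some.inj hix
    subst hix'
    rcases hi with hi | hi
    · rw [show i + -(j : ℤ) = -((j - i).toNat : ℤ) by omega, glueVert_neg_natCast h0] at hx
      exact h1.2 _ (by omega) hx
    · rw [show i + -(j : ℤ) = ((i - j).toNat : ℤ) by omega, glueVert_natCast] at hx
      exact h2.2 _ (by omega) hx

end Glue

/-! ### Measurability of gluing -/

section GlueMeasurable

lemma measurable_glueVert {V : Type*} [MeasurableSpace V] (i : ℤ) :
    Measurable fun p : (ℕ → V) × (ℕ → V) => glueVert p i := by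
  unfold glueVert
  split_ifs
  · exact (measurable_pi_apply _).comp measurable_snd
  · exact (measurable_pi_apply _).comp measurable_fst

variable {V : Type*} [Countable V] [MeasurableSpace V] [DiscreteMeasurableSpace V]
  {G : SimpleGraph V}

lemma measurableSet_glueVert {V : Type*} [MeasurableSpace V] [DiscreteMeasurableSpace V]
    (i : ℤ) (S : Set V) :
    MeasurableSet {p : (ℕ → V) × (ℕ → V) | glueVert p i ∈ S} :=
  measurable_glueVert i (MeasurableSet.of_discrete (s := S))

lemma measurableSet_isWalk_glue :
    MeasurableSet {p : (ℕ → V) × (ℕ → V) | IsWalk G (glue p)} := by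
  have h : {p : (ℕ → V) × (ℕ → V) | IsWalk G (glue p)} =
      (⋂ i : ℤ, {p | G.Adj (glueVert p i) (glueVert p (i + 1))}) ∩
        ⋂ x : V, ⋃ N : ℕ, ⋂ i : ℤ, ⋂ _ : N < i.natAbs, {p | glueVert p i ∈ {v | v ≠ x}} := by
    ext p
    simp only [Set.mem_ofPred_eq, isWalk_glue_iff, Set.mem_inter_iff, Set.mem_iInter,
      Set.mem_iUnion]
  rw [h]
  refine MeasurableSet.inter (MeasurableSet.iInter fun i => ?_) (MeasurableSet.iInter fun x =>
    MeasurableSet.iUnion fun N => MeasurableSet.iInter fun i => MeasurableSet.iInter fun _ =>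
      measurableSet_glueVert i {v | v ≠ x})
  exact (show Measurable fun p : (ℕ → V) × (ℕ → V) => (glueVert p i, glueVert p (i + 1)) from
    (measurable_glueVert i).prodMk (measurable_glueVert (i + 1)))
    (MeasurableSet.of_discrete (s := {q : V × V | G.Adj q.1 q.2}))

/-- The events that a shift of the walk has a given trace are countable in number and form a base of
the topology, and each is a countable intersection of conditions on single coordinates. -/
lemma measurable_toWalkSpace : Measurable (BiPath.toWalkSpace (G := G)) := by
  refine measurable_of_isOpen fun O hO => ?_
  have h : O = ⋃ q : {q : Finset V × FinWalk G × ℤ //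
      {w | IsTrace q.1 q.2.1 (shift q.2.2 w)} ⊆ O}, {w | IsTrace q.1.1 q.1.2.1 (shift q.1.2.2 w)} := by
    refine Set.Subset.antisymm (fun w hw => ?_) (Set.iUnion_subset fun q => q.2)
    obtain ⟨K, hK, hKO⟩ := exists_cyl_subset hO hw
    obtain ⟨k, γ, hγ⟩ := exists_isTrace hK
    refine Set.mem_iUnion.2 ⟨⟨(K, γ, k), fun w' hw' => hKO ⟨shift_mem_hit.1 (IsTrace.mem_hit hw'), ?_⟩⟩, hγ⟩
    have ht := IsTrace.trunc_eq hw' hγ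
    funext i
    have := congrFun ht (i - k)
    simpa [trunc_shift] using this
  rw [h, Set.preimage_iUnion]
  refine MeasurableSet.iUnion fun q => ?_
  obtain ⟨⟨K, γ, k⟩, -⟩ := q
  have hc : ∀ (i : ℤ) (S : Set V), MeasurableSet {p : BiPath G | glueVert p.1 i ∈ S} := fun i S =>
    measurable_subtype_coe (measurableSet_glueVert i S)
  have hset : BiPath.toWalkSpace (G := G) ⁻¹' {w | IsTrace K γ (shift k w)} =
      {_p | γ.vert 0 ∈ K ∧ γ.vert γ.len ∈ K} ∩
        ((⋂ n : ℕ, ⋂ _ : n ≤ γ.len, {p : BiPath G | glueVert p.1 (n + k) ∈ ({γ.vert n} : Set V)}) ∩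
        ⋂ i : ℤ, ⋂ _ : i < 0 ∨ (γ.len : ℤ) < i, {p : BiPath G | glueVert p.1 (i + k) ∈ {v | v ∉ K}}) := by
    ext p
    simp only [Set.mem_preimage, Set.mem_ofPred_eq, Set.mem_inter_iff, Set.mem_iInter,
      Set.mem_singleton_iff]
    have hw : ∀ i : ℤ, (shift k p.toWalkSpace).1 i = some (glueVert p.1 (i + k)) := fun i => rfl
    unfold IsTrace
    simp only [hw, Option.some.injEq]
    refine and_congr_right fun _ => and_congr_right fun _ => forall_congr' fun i =>
      forall_congr' fun _ => ?_
    exact ⟨fun h hm => h _ hm rfl, fun h x hx hxe => h (Option.some.inj hxe ▸ hx)⟩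
  rw [hset]
  exact (MeasurableSet.const _).inter ((MeasurableSet.iInter fun n => MeasurableSet.iInter fun _ =>
    hc _ _).inter (MeasurableSet.iInter fun n => MeasurableSet.iInter fun _ => hc _ _))

end GlueMeasurable

/-! ### Trace masses under `Q_K` and consistency in `K` -/

section HitIntensity

lemma measurableSet_avoid {V : Type*} [MeasurableSpace V] [DiscreteMeasurableSpace V]
    (K : Finset V) :
    MeasurableSet {a : ℕ → V | ∀ t : ℕ, 1 ≤ t → a t ∉ K} := by
  simp only [Set.ofPred_forall]
  exact MeasurableSet.iInter fun k => MeasurableSet.iInter fun _ =>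
    measurableSet_coord k {v | v ∉ K}

/-- Reversibility of simple random walk. -/
lemma degree_mul_prod_reverse {V : Type*} {G : SimpleGraph V} [G.LocallyFinite]
    (hdeg : ∀ x, 0 < G.degree x) (f : ℕ → V) (n : ℕ) :
    (G.degree (f n) : ℝ≥0∞) * ∏ k ∈ Finset.range n, (G.degree (f (n - k)) : ℝ≥0∞)⁻¹ =
      G.degree (f 0) * ∏ k ∈ Finset.range n, (G.degree (f k) : ℝ≥0∞)⁻¹ := by
  have h1 : ∏ k ∈ Finset.range n, (G.degree (f (n - k)) : ℝ≥0∞)⁻¹ =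
      ∏ k ∈ Finset.range n, (G.degree (f (k + 1)) : ℝ≥0∞)⁻¹ := by
    rw [← Finset.prod_range_reflect]
    refine Finset.prod_congr rfl fun k hk => ?_
    rw [Finset.mem_range] at hk
    rw [show n - (n - 1 - k) = k + 1 by omega]
  have hc : ∀ x, (G.degree x : ℝ≥0∞) * (G.degree x : ℝ≥0∞)⁻¹ = 1 := fun x =>
    ENNReal.mul_inv_cancel (by exact_mod_cast (hdeg x).ne') (ENNReal.natCast_ne_top _)
  rw [h1]
  induction n with
  | zero => simp
  | succ n ih =>
    rw [Finset.prod_range_succ, mul_left_comm, hc, mul_one, Finset.prod_range_succ,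
      ← mul_assoc, ← ih ?_, mul_right_comm, hc, one_mul]
    rw [← Finset.prod_range_reflect]
    refine Finset.prod_congr rfl fun k hk => ?_
    rw [Finset.mem_range] at hk
    rw [show n - (n - 1 - k) = k + 1 by omega]

variable {V : Type*} [Countable V] [MeasurableSpace V] [DiscreteMeasurableSpace V]
  {G : SimpleGraph V} [G.LocallyFinite]

variable (G) in
/-- The law of the pair of one-sided paths from `x` used to build `Q_K`. -/
noncomputable def biLaw (K : Finset V) (x : V) : Measure ((ℕ → V) × (ℕ → V)) :=
  ((srwLaw G x).restrict {a | ∀ t : ℕ, 1 ≤ t → a t ∉ K}).prod (srwLaw G x)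

lemma biLaw_univ (K : Finset V) (x : V) : biLaw G K x Set.univ = escape G K x := by
  rw [biLaw, ← Set.univ_prod_univ, Measure.prod_prod, Measure.restrict_apply_univ,
    measure_univ (μ := srwLaw G x), mul_one, escape]

/-- Transience enters here: both halves visit each vertex finitely often, so that the glued path is
a walk. -/
lemma biLaw_ae (htrans : IsTransient G) (hdeg : ∀ x, 0 < G.degree x) (K : Finset V) (x : V) :
    ∀ᵐ p ∂biLaw G K x, p.1 0 = x ∧ p.2 0 = x ∧ (∀ t : ℕ, 1 ≤ t → p.1 t ∉ K) ∧
      IsWalk G (glue p) := by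
  have hall : ∀ᵐ a ∂srwLaw G x, a 0 = x ∧ (∀ n, G.Adj (a n) (a (n + 1))) ∧
      ∀ y, {n | a n = y}.Finite :=
    (srwLaw_ae_start G x).and ((srwLaw_ae_adj G hdeg x).and (ae_all_iff.2 fun y => htrans x y))
  have h1 : ∀ᵐ p ∂biLaw G K x, p.1 0 = x ∧ (∀ n, G.Adj (p.1 n) (p.1 (n + 1))) ∧
      ∀ y, {n | p.1 n = y}.Finite :=
    Measure.quasiMeasurePreserving_fst.ae (ae_restrict_of_ae hall)
  have h2 : ∀ᵐ p ∂biLaw G K x, p.2 0 = x ∧ (∀ n, G.Adj (p.2 n) (p.2 (n + 1))) ∧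
      ∀ y, {n | p.2 n = y}.Finite :=
    Measure.quasiMeasurePreserving_snd.ae hall
  have h3 : ∀ᵐ p ∂biLaw G K x, ∀ t : ℕ, 1 ≤ t → p.1 t ∉ K :=
    Measure.quasiMeasurePreserving_fst.ae (ae_restrict_mem (measurableSet_avoid K))
  filter_upwards [h1, h2, h3] with p h1 h2 h3
  exact ⟨h1.1, h2.1, h3, isWalk_glue (h1.1.trans h2.1.symm) h1.2.1 h2.2.1 h1.2.2 h2.2.2⟩

lemma hitIntensity_apply (K : Finset V) {A : Set (WalkSpace G)} (hA : MeasurableSet A) :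
    hitIntensity G K A = ∑ x ∈ K, (G.degree x : ℝ≥0∞) *
      biLaw G K x {p | ∃ hp : IsWalk G (glue p), (⟨glue p, hp⟩ : WalkSpace G) ∈ A} := by
  rw [hitIntensity, Measure.finsetSum_apply]
  refine Finset.sum_congr rfl fun x _ => ?_
  rw [Measure.smul_apply, smul_eq_mul]
  refine congrArg _ ((Measure.map_apply measurable_toWalkSpace hA).trans ?_)
  have he : MeasurableEmbedding (Subtype.val : BiPath G → (ℕ → V) × (ℕ → V)) :=
    MeasurableEmbedding.subtype_coe measurableSet_isWalk_glue
  refine (he.comap_apply _ _).trans ?_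
  rw [biLaw]
  congr 1
  ext p
  constructor
  · rintro ⟨q, hq, rfl⟩
    exact ⟨q.2, hq⟩
  · rintro ⟨hp, h⟩
    exact ⟨⟨p, hp⟩, h, rfl⟩

/-- The reciprocal of the product of the degrees along a walk, without its last vertex. -/
noncomputable def FinWalk.weight (γ : FinWalk G) : ℝ≥0∞ :=
  ∏ k ∈ Finset.range γ.len, (G.degree (γ.vert k) : ℝ≥0∞)⁻¹

lemma prod_stepKernel (hdeg : ∀ x, 0 < G.degree x) (f : ℕ → V) (n : ℕ)
    (h : ∀ k < n, G.Adj (f k) (f (k + 1))) :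
    ∏ k ∈ Finset.range n, stepKernel G (f k) {f (k + 1)} =
      ∏ k ∈ Finset.range n, (G.degree (f k) : ℝ≥0∞)⁻¹ := by
  refine Finset.prod_congr rfl fun k hk => ?_
  rw [stepKernel_singleton G (hdeg _), if_pos (h k (Finset.mem_range.1 hk))]

-- Under `Q_K` time zero is the first visit to `K`, so only the starting point `x = γ_j`
-- contributes, with `j` the first index for which `γ_j ∈ K`. The two independent halves give a
-- product of steps and one escape probability from `M` each; reversibility moves the degree from
-- `γ_j` to `γ_0`. The resulting value depends on `K` only through whether `γ` meets it.
open scoped Classical in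
lemma hitIntensity_traceSet (htrans : IsTransient G) (hdeg : ∀ x, 0 < G.degree x)
    {K M : Finset V} (hKM : K ⊆ M) (γ : FinWalk G) :
    hitIntensity G K (proj ⁻¹' traceSet M γ) =
      if (∃ j ≤ γ.len, γ.vert j ∈ K) ∧ γ.vert 0 ∈ M ∧ γ.vert γ.len ∈ M then
        G.degree (γ.vert 0) * γ.weight * escape G M (γ.vert 0) * escape G M (γ.vert γ.len)
      else 0 := by
  rw [hitIntensity_apply K (measurable_proj (measurableSet_traceSet M γ))]
  have hzero : ∀ x ∈ K, (¬ ∃ j ≤ γ.len, γ.vert j = x ∧ ∀ i < j, γ.vert i ∉ K) →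
      biLaw G K x {p | ∃ hp : IsWalk G (glue p),
        (⟨glue p, hp⟩ : WalkSpace G) ∈ proj ⁻¹' traceSet M γ} = 0 := by
    intro x hx hn
    rw [measure_eq_zero_iff_ae_notMem]
    filter_upwards [biLaw_ae htrans hdeg K x] with p hp
    rintro ⟨hw, h⟩
    obtain ⟨j, hj, hjx, hji, -⟩ :=
      exists_pathAvoid_of_mem_traceSet hKM hw hx hp.1 hp.2.1 hp.2.2.1 h
    exact hn ⟨j, hj, hjx, hji⟩
  split_ifs with hc
  · obtain ⟨hv, hγ⟩ := hc
    set j := Nat.find hv with hjdef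
    obtain ⟨hj, hjK⟩ : j ≤ γ.len ∧ γ.vert j ∈ K := Nat.find_spec hv
    have hmin : ∀ i < j, γ.vert i ∉ K := fun i hi hiK =>
      Nat.find_min hv hi ⟨by omega, hiK⟩
    rw [Finset.sum_eq_single_of_mem _ hjK]
    · have hset : biLaw G K (γ.vert j) {p | ∃ hp : IsWalk G (glue p),
          (⟨glue p, hp⟩ : WalkSpace G) ∈ proj ⁻¹' traceSet M γ} =
          biLaw G K (γ.vert j) (pathAvoid M (fun t => γ.vert (j - t)) j ×ˢ
            pathAvoid M (fun t => γ.vert (j + t)) (γ.len - j)) := by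
        refine measure_congr ?_
        filter_upwards [biLaw_ae htrans hdeg K (γ.vert j)] with p hp
        refine propext ⟨fun ⟨hw, h⟩ => ?_, fun h => ⟨hp.2.2.2, ?_⟩⟩
        · obtain ⟨i, hi, hij, hii, h1, h2⟩ :=
            exists_pathAvoid_of_mem_traceSet hKM hw hjK hp.1 hp.2.1 hp.2.2.1 h
          have : i = j := by
            rcases lt_trichotomy i j with h | h | h
            · exact absurd (hij ▸ hjK) (hmin i h)
            · exact h
            · exact absurd hjK (hii j h)
          subst this
          exact ⟨h1, h2⟩
        · exact mem_traceSet_of_pathAvoid hp.2.2.2 (hp.1.trans hp.2.1.symm) hγ hj h.1 h.2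
      -- The conditioning on not returning to `K` is automatic: up to time `j` by minimality of `j`,
      -- and later because `M` contains `K`.
      have hsub : pathAvoid M (fun t => γ.vert (j - t)) j ⊆
          {a : ℕ → V | ∀ t : ℕ, 1 ≤ t → a t ∉ K} := by
        intro a ha t ht
        rcases le_or_gt t j with htj | htj
        · rw [ha.1 t htj]
          exact hmin _ (by omega)
        · exact fun h => ha.2 t htj (hKM h)
      have e1 := srwLaw_pathAvoid G M (fun t => γ.vert (j - t)) j
      have e2 := srwLaw_pathAvoid G M (fun t => γ.vert (j + t)) (γ.len - j)
      simp only [Nat.sub_zero, Nat.add_zero, Nat.sub_self] at e1 e2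
      rw [prod_stepKernel hdeg (fun t => γ.vert (j - t)) j fun k hk => by
        have := γ.adj_vert (k := j - (k + 1)) (by omega)
        rw [show j - (k + 1) + 1 = j - k by omega] at this
        exact this.symm] at e1
      rw [prod_stepKernel hdeg (fun t => γ.vert (j + t)) (γ.len - j) fun k hk =>
        γ.adj_vert (by omega)] at e2
      rw [hset, biLaw, Measure.prod_prod, Measure.restrict_apply (measurableSet_pathAvoid _ _ _),
        Set.inter_eq_left.2 hsub, e1, e2, FinWalk.weight]
      have hr := degree_mul_prod_reverse hdeg γ.vert j
      have hs : ∏ k ∈ Finset.range γ.len, (G.degree (γ.vert k) : ℝ≥0∞)⁻¹ =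
          (∏ k ∈ Finset.range j, (G.degree (γ.vert k) : ℝ≥0∞)⁻¹) *
            ∏ k ∈ Finset.range (γ.len - j), (G.degree (γ.vert (j + k)) : ℝ≥0∞)⁻¹ := by
        rw [← Finset.prod_range_add, Nat.add_sub_cancel' hj]
      rw [hs, Nat.add_sub_cancel' hj, mul_mul_mul_comm, ← mul_assoc (G.degree (γ.vert j) : ℝ≥0∞),
        ← mul_assoc (G.degree (γ.vert j) : ℝ≥0∞), hr]
      ring
    · intro x hx hxj
      rw [hzero x hx, mul_zero]
      rintro ⟨i, hi, hix, hii⟩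
      rcases lt_trichotomy i j with h | h | h
      · exact hmin i h (hix ▸ hx)
      · exact hxj (h ▸ hix.symm)
      · exact hii j h hjK
  · refine Finset.sum_eq_zero fun x hx => ?_
    by_cases hv : ∃ j ≤ γ.len, γ.vert j ∈ K
    · have hem : traceSet M γ = ∅ := by
        rw [traceSet, Set.image_eq_empty, Set.eq_empty_iff_forall_notMem]
        exact fun w hw => hc ⟨hv, hw.1⟩
      have hem' : {p | ∃ hp : IsWalk G (glue p), (⟨glue p, hp⟩ : WalkSpace G) ∈
          proj ⁻¹' traceSet M γ} = ∅ :=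
        Set.eq_empty_of_forall_notMem fun p ⟨hp, h⟩ => by rwa [hem] at h
      rw [hem', measure_empty, mul_zero]
    · rw [hzero x hx, mul_zero]
      rintro ⟨i, hi, hix, -⟩
      exact hv ⟨i, hi, hix ▸ hx⟩

variable (G) in
/-- The image of `Q_K` on `𝓦*`. -/
noncomputable def hitIntensityMod (K : Finset V) : Measure (WalkSpaceMod G) :=
  (hitIntensity G K).map proj

lemma hitIntensityMod_apply (K : Finset V) {A : Set (WalkSpaceMod G)} (hA : MeasurableSet A) :
    hitIntensityMod G K A = hitIntensity G K (proj ⁻¹' A) :=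
  Measure.map_apply measurable_proj hA

lemma hitIntensityMod_hitMod (htrans : IsTransient G) (hdeg : ∀ x, 0 < G.degree x) (K : Finset V) :
    hitIntensityMod G K (hitMod K) = ∑ x ∈ K, (G.degree x : ℝ≥0∞) * escape G K x := by
  rw [hitIntensityMod_apply K (measurableSet_hitMod K),
    hitIntensity_apply K (measurable_proj (measurableSet_hitMod K))]
  refine Finset.sum_congr rfl fun x hx => ?_
  rw [← biLaw_univ]
  congr 1
  refine measure_congr ?_
  filter_upwards [biLaw_ae htrans hdeg K x] with p hp
  refine propext ⟨fun _ => trivial, fun _ => ⟨hp.2.2.2, ?_⟩⟩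
  refine proj_mem_hitMod.2 ⟨0, x, hx, ?_⟩
  change some (p.2 0) = some x
  rw [hp.2.1]

lemma hitIntensityMod_univ (htrans : IsTransient G) (hdeg : ∀ x, 0 < G.degree x) (K : Finset V) :
    hitIntensityMod G K Set.univ = hitIntensityMod G K (hitMod K) := by
  rw [hitIntensityMod_hitMod htrans hdeg, hitIntensityMod_apply K MeasurableSet.univ,
    hitIntensity_apply K (measurable_proj MeasurableSet.univ)]
  refine Finset.sum_congr rfl fun x hx => ?_
  rw [← biLaw_univ]
  congr 1
  refine measure_congr ?_
  filter_upwards [biLaw_ae htrans hdeg K x] with p hp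
  exact propext ⟨fun _ => trivial, fun _ => ⟨hp.2.2.2, trivial⟩⟩

lemma hitIntensityMod_hitMod_lt_top (htrans : IsTransient G) (hdeg : ∀ x, 0 < G.degree x)
    (K : Finset V) : hitIntensityMod G K (hitMod K) < ∞ := by
  rw [hitIntensityMod_hitMod htrans hdeg]
  exact ENNReal.sum_lt_top.2 fun x _ =>
    ENNReal.mul_lt_top (ENNReal.natCast_lt_top _) ((escape_le_one G K x).trans_lt ENNReal.one_lt_top)

/-- For `K ⊆ M` the trace on `M` shows whether `K` is visited, so a trace set lies inside `π(𝓦_K)`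
or is disjoint from it. In the first case the trace formulas for `K` and `L` coincide. -/
lemma hitIntensityMod_traceSet_inter (htrans : IsTransient G) (hdeg : ∀ x, 0 < G.degree x)
    {K L M : Finset V} (hKL : K ⊆ L) (hLM : L ⊆ M) (γ : FinWalk G) :
    hitIntensityMod G L (traceSet M γ ∩ hitMod K) = hitIntensityMod G K (traceSet M γ) := by
  classical
  rw [hitIntensityMod_apply K (measurableSet_traceSet M γ),
    hitIntensity_traceSet htrans hdeg (hKL.trans hLM)]
  by_cases hv : ∃ j ≤ γ.len, γ.vert j ∈ K
  · have hsub : traceSet M γ ⊆ hitMod K := by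
      rintro _ ⟨w, hw, rfl⟩
      obtain ⟨j, hj, hjK⟩ := hv
      exact proj_mem_hitMod.2 ⟨j, _, hjK, hw.2.1 j hj⟩
    obtain ⟨j, hj, hjK⟩ := id hv
    rw [Set.inter_eq_left.2 hsub, hitIntensityMod_apply L (measurableSet_traceSet M γ),
      hitIntensity_traceSet htrans hdeg hLM]
    have hv' : ∃ j ≤ γ.len, γ.vert j ∈ L := ⟨j, hj, hKL hjK⟩
    simp only [hv, hv', true_and]
  · have hem : traceSet M γ ∩ hitMod K = ∅ := by
      rw [Set.eq_empty_iff_forall_notMem]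
      rintro _ ⟨⟨w, hw, rfl⟩, hK⟩
      obtain ⟨i, x, hx, hi⟩ := proj_mem_hitMod.1 hK
      have hi' := hw.mem_Icc (hLM (hKL hx)) hi
      lift i to ℕ using hi'.1
      have := hw.2.1 i (by omega)
      rw [hi, Option.some.injEq] at this
      exact hv ⟨i, by omega, this ▸ hx⟩
    rw [hem, measure_empty, if_neg fun h => hv h.1]

lemma restrict_hitIntensityMod (htrans : IsTransient G) (hdeg : ∀ x, 0 < G.degree x)
    {K L : Finset V} (hKL : K ⊆ L) :
    (hitIntensityMod G L).restrict (hitMod K) = hitIntensityMod G K := by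
  have hfin : IsFiniteMeasure (hitIntensityMod G L) :=
    ⟨by rw [hitIntensityMod_univ htrans hdeg]; exact hitIntensityMod_hitMod_lt_top htrans hdeg L⟩
  have hsat : IsSaturated L (hitMod (G := G) K) := (isSaturated_hitMod K).mono hKL
  refine measure_ext_of_traceSet L (fun M hM γ => ?_) ?_
  · rw [Measure.restrict_apply (measurableSet_traceSet M γ),
      hitIntensityMod_traceSet_inter htrans hdeg hKL hM]
  -- Total masses are compared by splitting `π(𝓦_K)` into traces on `L`.
  · rw [Measure.restrict_apply_univ, hitIntensityMod_univ htrans hdeg, hsat.measure_eq,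
      hsat.measure_eq]
    refine tsum_congr fun γ => ?_
    have h := hitIntensityMod_traceSet_inter htrans hdeg hKL subset_rfl γ.1
    rwa [Set.inter_eq_left.2 γ.2] at h

lemma hitIntensityMod_inter (htrans : IsTransient G) (hdeg : ∀ x, 0 < G.degree x)
    {K L : Finset V} (hKL : K ⊆ L) {A : Set (WalkSpaceMod G)} (hA : MeasurableSet A) :
    hitIntensityMod G L (A ∩ hitMod K) = hitIntensityMod G K A := by
  rw [← restrict_hitIntensityMod htrans hdeg hKL, Measure.restrict_apply hA]

end HitIntensity

/-! ### Existence and uniqueness of the measure `Q*` -/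

section Intensity

variable {V : Type*} [Countable V] {G : SimpleGraph V}

variable (V) in
lemma exists_finset_enumeration : ∃ K : ℕ → Finset V, Function.Surjective K :=
  exists_surjective_nat _

lemma iUnion_hitMod {V : Type*} {G : SimpleGraph V} {K : ℕ → Finset V} (hK : Function.Surjective K) :
    ⋃ n, hitMod (G := G) (K n) = Set.univ := by
  refine Set.eq_univ_of_forall fun p => ?_
  obtain ⟨w, rfl⟩ := Quotient.exists_rep p
  obtain ⟨i, hi⟩ := w.2.1
  obtain ⟨x, hx⟩ := Option.ne_none_iff_exists'.1 hi
  obtain ⟨n, hn⟩ := hK {x}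
  exact Set.mem_iUnion.2 ⟨n, proj_mem_hitMod.2 ⟨i, x, by simp [hn], hx⟩⟩

lemma sigmaFinite_of_hitMod {μ : Measure (WalkSpaceMod G)} (h : ∀ K, μ (hitMod K) < ∞) :
    SigmaFinite μ := by
  obtain ⟨K, hK⟩ := exists_finset_enumeration V
  exact ⟨⟨{ set := fun n => hitMod (K n)
            set_mem := fun _ => trivial
            finite := fun n => h (K n)
            spanning := iUnion_hitMod hK }⟩⟩

lemma measure_eq_tsum_disjointed_hitMod {V : Type*} {G : SimpleGraph V} {K : ℕ → Finset V} (hK : Function.Surjective K)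
    (μ : Measure (WalkSpaceMod G)) {A : Set (WalkSpaceMod G)} (hA : MeasurableSet A) :
    μ A = ∑' n, μ (A ∩ disjointed (fun n => hitMod (K n)) n) := by
  rw [← measure_iUnion, ← Set.inter_iUnion, iUnion_disjointed, iUnion_hitMod hK, Set.inter_univ]
  · exact fun i j hij => ((disjoint_disjointed _) hij).mono Set.inter_subset_right Set.inter_subset_right
  · exact fun n => hA.inter (MeasurableSet.disjointed (fun n => measurableSet_hitMod (K n)) n)

variable [MeasurableSpace V] [DiscreteMeasurableSpace V] [G.LocallyFinite]

lemma IsInterlacementIntensity.apply {Q : Measure (WalkSpaceMod G)}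
    (h : IsInterlacementIntensity G Q) {A : Set (WalkSpaceMod G)} {K : Finset V}
    (hA : MeasurableSet A) : Q (A ∩ hitMod K) = hitIntensityMod G K A :=
  (h.2 A K hA).trans (hitIntensityMod_apply K hA).symm

lemma IsInterlacementIntensity.hitMod_lt_top (htrans : IsTransient G) (hdeg : ∀ x, 0 < G.degree x)
    {Q : Measure (WalkSpaceMod G)} (h : IsInterlacementIntensity G Q) (K : Finset V) :
    Q (hitMod K) < ∞ := by
  have := h.apply (K := K) (measurableSet_hitMod K)
  rw [Set.inter_self] at this
  rw [this]
  exact hitIntensityMod_hitMod_lt_top htrans hdeg K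

lemma IsInterlacementIntensity.unique {Q Q' : Measure (WalkSpaceMod G)}
    (h : IsInterlacementIntensity G Q) (h' : IsInterlacementIntensity G Q') : Q = Q' := by
  obtain ⟨K, hK⟩ := exists_finset_enumeration V
  refine Measure.ext fun A hA => ?_
  rw [measure_eq_tsum_disjointed_hitMod hK Q hA, measure_eq_tsum_disjointed_hitMod hK Q' hA]
  refine tsum_congr fun n => ?_
  have hm := hA.inter (MeasurableSet.disjointed (fun n => measurableSet_hitMod (G := G) (K n)) n)
  have hs : A ∩ disjointed (fun n => hitMod (G := G) (K n)) n ⊆ hitMod (K n) :=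
    Set.inter_subset_right.trans (disjointed_subset _ n)
  rw [← Set.inter_eq_left.2 hs, h.apply hm, h'.apply hm]

/-- The sets `π(𝓦_K)` for an enumeration of the finite sets `K` cover `𝓦*`. They are made disjoint
and each piece is given the corresponding `Q_K`; by consistency the choice of piece does not matter.
-/
lemma exists_isInterlacementIntensity (htrans : IsTransient G) (hdeg : ∀ x, 0 < G.degree x) :
    ∃ Q, IsInterlacementIntensity G Q := by
  classical
  obtain ⟨K, hK⟩ := exists_finset_enumeration V
  let D := disjointed fun n => hitMod (G := G) (K n)
  have hD : ∀ n, MeasurableSet (D n) :=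
    fun n => MeasurableSet.disjointed (fun n => measurableSet_hitMod (K n)) n
  let Q := Measure.sum fun n => (hitIntensityMod G (K n)).restrict (D n)
  have hQ : ∀ (A : Set (WalkSpaceMod G)) (L : Finset V), MeasurableSet A →
      Q (A ∩ hitMod L) = hitIntensityMod G L A := by
    intro A L hA
    have hAL := hA.inter (measurableSet_hitMod L)
    rw [Measure.sum_apply _ hAL, measure_eq_tsum_disjointed_hitMod hK (hitIntensityMod G L) hA]
    refine tsum_congr fun n => ?_
    rw [Measure.restrict_apply hAL]
    have hDn : D n ⊆ hitMod (K n) := disjointed_subset _ n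
    -- The measures for `K n` and for `L` need not be comparable directly, so both are compared with
    -- the one for `K n ∪ L`.
    have e1 := hitIntensityMod_inter htrans hdeg (Finset.subset_union_left (s₁ := K n) (s₂ := L))
      (hAL.inter (hD n))
    have e2 := hitIntensityMod_inter htrans hdeg (Finset.subset_union_right (s₁ := K n) (s₂ := L))
      (hA.inter (hD n))
    rw [Set.inter_eq_left.2 (Set.inter_subset_right.trans hDn)] at e1
    rw [← e1, ← e2, Set.inter_right_comm]
  refine ⟨Q, sigmaFinite_of_hitMod fun L => ?_, fun A L hA => ?_⟩
  · rw [← Set.inter_self (hitMod L), hQ _ _ (measurableSet_hitMod L)]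
    exact hitIntensityMod_hitMod_lt_top htrans hdeg L
  · rw [hQ A L hA, hitIntensityMod_apply L hA]

end Intensity

/-! ### Finitary random interlacements -/

section Geometric

/-- The success probability `1 / (T + 1)` of the geometric distribution of mean `T`. -/
noncomputable def geomStop (T : ℝ) : ℝ≥0∞ := ENNReal.ofReal (1 / (T + 1))

/-- The failure probability `T / (T + 1)` of the geometric distribution of mean `T`. -/
noncomputable def geomRatio (T : ℝ) : ℝ≥0∞ := ENNReal.ofReal (T / (T + 1))

lemma geomStop_mul_tsum {T : ℝ} (hT : 0 < T) : geomStop T * ∑' n, geomRatio T ^ n = 1 := by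
  have h : 1 - geomRatio T = geomStop T := by
    rw [geomRatio, geomStop, ← ENNReal.ofReal_one, ← ENNReal.ofReal_sub _ (by positivity)]
    congr 1
    field_simp
    ring
  rw [ENNReal.tsum_geometric, h]
  exact ENNReal.mul_inv_cancel (ENNReal.ofReal_pos.2 (by positivity)).ne' ENNReal.ofReal_ne_top

lemma geomRatio_le_one {T : ℝ} (hT : 0 < T) : geomRatio T ≤ 1 := by
  rw [geomRatio, ENNReal.ofReal_le_one, div_le_one (by positivity)]
  linarith

lemma tendsto_geomStop : Tendsto geomStop atTop (𝓝 0) := by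
  have h : Tendsto (fun T : ℝ => 1 / (T + 1)) atTop (𝓝 0) :=
    tendsto_const_nhds.div_atTop (tendsto_atTop_add_const_right _ _ tendsto_id)
  have := ENNReal.tendsto_ofReal h
  rwa [ENNReal.ofReal_zero] at this

lemma tendsto_geomRatio : Tendsto geomRatio atTop (𝓝 1) := by
  have h : Tendsto (fun T : ℝ => 1 / (T + 1)) atTop (𝓝 0) :=
    tendsto_const_nhds.div_atTop (tendsto_atTop_add_const_right _ _ tendsto_id)
  have h' : Tendsto (fun T : ℝ => T / (T + 1)) atTop (𝓝 1) := by
    have h1 : Tendsto (fun T : ℝ => 1 - 1 / (T + 1)) atTop (𝓝 (1 - 0)) := h.const_sub 1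
    rw [sub_zero] at h1
    refine h1.congr' ?_
    filter_upwards [eventually_gt_atTop 0] with T hT
    field_simp
    ring
  have := ENNReal.tendsto_ofReal h'
  rwa [ENNReal.ofReal_one] at this

end Geometric

/-! ### The mass of a single finite walk -/

section Singleton

variable {V : Type*} {G : SimpleGraph V} [G.LocallyFinite]

lemma FinWalk.measurableSet {V : Type*} {G : SimpleGraph V} (A : Set (FinWalk G)) : MeasurableSet A := trivial

open scoped Classical in
lemma stoppedLaw_singleton (n : ℕ) (x : V) (γ : FinWalk G) :
    stoppedLaw G n x {γ} = if γ.len = n ∧ γ.vert 0 = x then γ.weight else 0 := by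
  rw [stoppedLaw, Measure.sum_apply _ (FinWalk.measurableSet _), tsum_eq_single γ]
  · rw [Measure.smul_apply, Measure.dirac_apply' _ (FinWalk.measurableSet _), Set.indicator_of_mem (Set.mem_singleton γ), Pi.one_apply,
      smul_eq_mul, mul_one, FinWalk.weight]
    split_ifs with h
    · rw [h.1]
    · rfl
  · intro w hw
    rw [Measure.smul_apply, Measure.dirac_apply' _ (FinWalk.measurableSet _), 
      Set.indicator_of_notMem (show w ∉ ({γ} : Set (FinWalk G)) from hw), smul_zero]

/-- One factor `geomStop T` is the normalisation in `ν^(T)`, the other is the probability of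
stopping. Having two of them makes the mass invariant under reversal and leaves one for each end of
the walk. -/
lemma finitaryIntensity_singleton {T : ℝ} (hT : 0 < T) (γ : FinWalk G) :
    finitaryIntensity G T {γ} =
      G.degree (γ.vert 0) * γ.weight * (geomStop T * geomStop T * geomRatio T ^ γ.len) := by
  classical
  have hg : ∀ x, geomLaw G T x {γ} =
      if γ.vert 0 = x then geomStop T * (geomRatio T ^ γ.len * γ.weight) else 0 := by
    intro x
    rw [geomLaw, Measure.smul_apply, Measure.sum_apply _ (FinWalk.measurableSet _), tsum_eq_single γ.len]
    · rw [Measure.smul_apply, stoppedLaw_singleton, smul_eq_mul, smul_eq_mul,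
        ENNReal.ofReal_pow (by positivity)]
      simp only [true_and, geomStop, geomRatio]
      split_ifs <;> simp
    · intro n hn
      rw [Measure.smul_apply, stoppedLaw_singleton, if_neg fun h => hn h.1.symm, smul_zero]
  rw [finitaryIntensity, Measure.sum_apply _ (FinWalk.measurableSet _), tsum_eq_single (γ.vert 0)]
  · rw [Measure.smul_apply, hg, if_pos rfl, smul_eq_mul, div_eq_mul_one_div,
      ENNReal.ofReal_mul (by positivity), ENNReal.ofReal_natCast]
    change _ * geomStop T * _ = _
    ring
  · intro x hx
    rw [Measure.smul_apply, hg, if_neg hx.symm, smul_zero]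

end Singleton

/-! ### Decomposing finite walks into two excursions and a middle part -/

section Join

variable {V : Type*} {G : SimpleGraph V}

/-- `J` is the concatenation of the reversal of `η`, of `γ` and of `ξ`. -/
def IsJoin (η γ ξ J : FinWalk G) : Prop :=
  J.len = η.len + γ.len + ξ.len ∧ (∀ k ≤ η.len, J.vert (η.len - k) = η.vert k) ∧
    (∀ k ≤ γ.len, J.vert (η.len + k) = γ.vert k) ∧
    ∀ k ≤ ξ.len, J.vert (η.len + γ.len + k) = ξ.vert k

lemma exists_isJoin {η γ ξ : FinWalk G} (h0 : η.vert 0 = γ.vert 0)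
    (h1 : ξ.vert 0 = γ.vert γ.len) : ∃ J, IsJoin η γ ξ J := by
  -- The two hypotheses on endpoints make the three formulas agree at the seams, including when a
  -- piece has length zero.
  let f : ℕ → V := fun k => if k < η.len then η.vert (η.len - k) else
    if k < η.len + γ.len then γ.vert (k - η.len) else ξ.vert (k - (η.len + γ.len))
  have f1 : ∀ k ≤ η.len, f (η.len - k) = η.vert k := by
    intro k hk
    by_cases hk0 : k = 0
    · subst hk0
      simp only [f]
      rw [if_neg (by omega)]
      split_ifs with h
      · simp [h0]
      · have : γ.len = 0 := by omega
        simp [this, h0, h1]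
    · simp only [f]
      rw [if_pos (by omega)]
      congr 1
      omega
  have f2 : ∀ k ≤ γ.len, f (η.len + k) = γ.vert k := by
    intro k hk
    simp only [f]
    rw [if_neg (by omega)]
    split_ifs with h
    · congr 1
      omega
    · have : k = γ.len := by omega
      simp [this, h1]
  have f3 : ∀ k, f (η.len + γ.len + k) = ξ.vert k := by
    intro k
    simp only [f]
    rw [if_neg (by omega), if_neg (by omega)]
    congr 1
    omega
  obtain ⟨J, hJ, hJf⟩ := FinWalk.exists_of_adj (G := G) f (η.len + γ.len + ξ.len) (by
    intro k hk
    rcases lt_or_ge k η.len with h | h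
    · have e1 := f1 (η.len - k) (by omega)
      have e2 := f1 (η.len - (k + 1)) (by omega)
      rw [show η.len - (η.len - k) = k by omega] at e1
      rw [show η.len - (η.len - (k + 1)) = k + 1 by omega] at e2
      rw [e1, e2]
      have := η.adj_vert (k := η.len - (k + 1)) (by omega)
      rw [show η.len - (k + 1) + 1 = η.len - k by omega] at this
      exact this.symm
    rcases lt_or_ge k (η.len + γ.len) with h' | h'
    · obtain ⟨i, rfl⟩ := Nat.exists_eq_add_of_le h
      rw [f2 i (by omega), add_assoc, f2 (i + 1) (by omega)]
      exact γ.adj_vert (by omega)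
    · obtain ⟨i, rfl⟩ := Nat.exists_eq_add_of_le h'
      rw [f3, add_assoc, f3]
      exact ξ.adj_vert (by omega))
  refine ⟨J, hJ, fun k hk => ?_, fun k hk => ?_, fun k hk => ?_⟩
  · rw [hJf _ (by omega), f1 k hk]
  · rw [hJf _ (by omega), f2 k hk]
  · rw [hJf _ (by omega), f3 k]

/-- Reversibility along the initial segment replaces the degree at the start of `J` by the degree at
the start of `γ`. -/
lemma IsJoin.weight [G.LocallyFinite] (hdeg : ∀ x, 0 < G.degree x) {η γ ξ J : FinWalk G}
    (h : IsJoin η γ ξ J) :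
    G.degree (J.vert 0) * J.weight = G.degree (γ.vert 0) * η.weight * γ.weight * ξ.weight := by
  have hr := degree_mul_prod_reverse hdeg J.vert η.len
  have e1 : ∏ k ∈ Finset.range η.len, (G.degree (J.vert (η.len - k)) : ℝ≥0∞)⁻¹ = η.weight :=
    Finset.prod_congr rfl fun k hk => by rw [h.2.1 k (Finset.mem_range.1 hk).le]
  have e2 : ∏ k ∈ Finset.range γ.len, (G.degree (J.vert (η.len + k)) : ℝ≥0∞)⁻¹ = γ.weight :=
    Finset.prod_congr rfl fun k hk => by rw [h.2.2.1 k (Finset.mem_range.1 hk).le]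
  have e3 : ∏ k ∈ Finset.range ξ.len, (G.degree (J.vert (η.len + γ.len + k)) : ℝ≥0∞)⁻¹ =
      ξ.weight :=
    Finset.prod_congr rfl fun k hk => by rw [h.2.2.2 k (Finset.mem_range.1 hk).le]
  have e0 : J.vert η.len = γ.vert 0 := h.2.2.1 0 (Nat.zero_le _)
  rw [e1, e0] at hr
  rw [FinWalk.weight, h.1, Finset.prod_range_add, Finset.prod_range_add, e2, e3, ← mul_assoc,
    ← mul_assoc, ← hr]

lemma finitaryIntensity_isJoin [G.LocallyFinite] (hdeg : ∀ x, 0 < G.degree x) {T : ℝ} (hT : 0 < T)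
    {η γ ξ J : FinWalk G} (h : IsJoin η γ ξ J) :
    finitaryIntensity G T {J} = G.degree (γ.vert 0) * γ.weight * geomRatio T ^ γ.len *
      ((geomStop T * (geomRatio T ^ η.len * η.weight)) *
        (geomStop T * (geomRatio T ^ ξ.len * ξ.weight))) := by
  rw [finitaryIntensity_singleton hT, h.weight hdeg, h.1, pow_add, pow_add]
  ring

/-- The finite walks from `x` that avoid `K` at positive times. -/
def avoidWalks (G : SimpleGraph V) (K : Finset V) (x : V) : Set (FinWalk G) :=
  {η | η.vert 0 = x ∧ ∀ t, 1 ≤ t → t ≤ η.len → η.vert t ∉ K}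

lemma IsJoin.isTrace {K : Finset V} {η γ ξ J : FinWalk G} (h : IsJoin η γ ξ J)
    (hγ : γ.vert 0 ∈ K ∧ γ.vert γ.len ∈ K) (hη : η ∈ avoidWalks G K (γ.vert 0))
    (hξ : ξ ∈ avoidWalks G K (γ.vert γ.len)) : IsTrace K γ (shift η.len J.toWalkSpace) := by
  have hJ : ∀ i : ℤ, (shift η.len J.toWalkSpace).1 i =
      if 0 ≤ i + η.len ∧ i + η.len ≤ J.len then some (J.vert (i + η.len).toNat) else none :=
    fun i => rfl
  obtain ⟨hl, h1, h2, h3⟩ := h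
  refine ⟨hγ, fun k hk => ?_, fun i hi x hx hix => ?_⟩
  · rw [hJ, if_pos (by omega), show ((k : ℤ) + η.len).toNat = η.len + k by omega, h2 k hk]
  · rw [hJ] at hix
    split_ifs at hix with hc
    rw [Option.some.injEq] at hix
    rcases hi with hi | hi
    · have := h1 (-i).toNat (by omega)
      rw [show η.len - (-i).toNat = (i + η.len).toNat by omega, hix] at this
      exact hη.2 _ (by omega) (by omega) (this ▸ hx)
    · have := h3 (i - γ.len).toNat (by omega)
      rw [show η.len + γ.len + (i - γ.len).toNat = (i + η.len).toNat by omega, hix] at this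
      exact hξ.2 _ (by omega) (by omega) (this ▸ hx)

lemma IsJoin.unique {η γ ξ η' ξ' J : FinWalk G} (h : IsJoin η γ ξ J) (h' : IsJoin η' γ ξ' J)
    (hl : η.len = η'.len) : η = η' ∧ ξ = ξ' := by
  obtain ⟨hl1, h1, -, h3⟩ := h
  obtain ⟨hl1', h1', -, h3'⟩ := h'
  refine ⟨FinWalk.ext hl fun k hk => ?_, FinWalk.ext (by omega) fun k hk => ?_⟩
  · rw [← h1 k hk, ← h1' k (by omega), hl]
  · rw [← h3 k hk, ← h3' k (by omega), hl]

/-- The walk is cut at its first visit to `K`. The middle part is that single vertex, and the future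
is unconstrained, which is expressed as avoiding `∅`. -/
lemma exists_isJoin_of_mem_hitFin {K : Finset V} {w : FinWalk G} (hw : w ∈ hitFin K) :
    ∃ γ η ξ : FinWalk G, γ.vert 0 ∈ K ∧ γ.len = 0 ∧ η ∈ avoidWalks G K (γ.vert 0) ∧
      ξ ∈ avoidWalks G ∅ (γ.vert 0) ∧ IsJoin η γ ξ w := by
  classical
  have hv : ∃ j ≤ w.len, w.vert j ∈ K := by
    obtain ⟨i, x, hx, hi⟩ := hw
    change (if 0 ≤ i ∧ i ≤ w.len then some (w.vert i.toNat) else none) = some x at hi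
    split_ifs at hi with hc
    exact ⟨i.toNat, by omega, Option.some.inj hi ▸ hx⟩
  set j := Nat.find hv
  obtain ⟨hj, hjK⟩ : j ≤ w.len ∧ w.vert j ∈ K := Nat.find_spec hv
  have hmin : ∀ i < j, w.vert i ∉ K := fun i hi hiK => Nat.find_min hv hi ⟨by omega, hiK⟩
  obtain ⟨γ, hγ, hγv⟩ := FinWalk.exists_of_adj (G := G) (fun _ => w.vert j) 0 (by simp)
  obtain ⟨η, hη, hηv⟩ := FinWalk.exists_of_adj (G := G) (fun k => w.vert (j - k)) j (by
    intro k hk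
    have := w.adj_vert (k := j - (k + 1)) (by omega)
    rw [show j - (k + 1) + 1 = j - k by omega] at this
    exact this.symm)
  obtain ⟨ξ, hξ, hξv⟩ := FinWalk.exists_of_adj (G := G) (fun k => w.vert (j + k)) (w.len - j)
    fun k hk => w.adj_vert (by omega)
  have hγ0 : γ.vert 0 = w.vert j := hγv 0 le_rfl
  refine ⟨γ, η, ξ, hγ0 ▸ hjK, hγ, ⟨?_, fun t ht htl => ?_⟩, ⟨?_, by simp⟩, ?_, fun k hk => ?_,
    fun k hk => ?_, fun k hk => ?_⟩
  · rw [hηv 0 (Nat.zero_le _), hγ0, Nat.sub_zero]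
  · rw [hηv t (by omega)]
    exact hmin _ (by omega)
  · rw [hξv 0 (Nat.zero_le _), hγ0, Nat.add_zero]
  · omega
  · rw [hηv k (by omega), hη]
  · rw [hγv k (by omega), hη, show k = 0 by omega, Nat.add_zero]
  · rw [hξv k (by omega), hη, hγ, Nat.add_zero]

/-- The probability that simple random walk from `x`, stopped at an independent geometric time of
mean `T`, does not visit `K` at a positive time. -/
noncomputable def escapeGeom (G : SimpleGraph V) [G.LocallyFinite] (T : ℝ) (K : Finset V) (x : V) : ℝ≥0∞ :=
  ∑' η : avoidWalks G K x, geomStop T * (geomRatio T ^ η.1.len * η.1.weight)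

lemma tsum_join [G.LocallyFinite] (T : ℝ) (K L : Finset V) (x y : V) (c : ℝ≥0∞) :
    ∑' p : avoidWalks G K x × avoidWalks G L y,
      c * ((geomStop T * (geomRatio T ^ p.1.1.len * p.1.1.weight)) *
        (geomStop T * (geomRatio T ^ p.2.1.len * p.2.1.weight))) =
      c * (escapeGeom G T K x * escapeGeom G T L y) := by
  rw [ENNReal.tsum_mul_left, ENNReal.tsum_prod (f := fun (η : avoidWalks G K x)
    (ξ : avoidWalks G L y) => (geomStop T * (geomRatio T ^ η.1.len * η.1.weight)) *
        (geomStop T * (geomRatio T ^ ξ.1.len * ξ.1.weight)))]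
  simp only [ENNReal.tsum_mul_left, ENNReal.tsum_mul_right, escapeGeom]

end Join

/-! ### Escape probabilities of the stopped walk and bounds for `ν^(T)` -/

section Escape

variable {V : Type*} [Countable V] [MeasurableSpace V] [DiscreteMeasurableSpace V]
  {G : SimpleGraph V} [G.LocallyFinite]

lemma escapeUntil_eq_tsum (hdeg : ∀ x, 0 < G.degree x) (K : Finset V) (n : ℕ) (x : V) :
    escapeUntil G K n x =
      ∑' η : {η : avoidWalks G K x // η.1.len = n}, η.1.1.weight := by
  have : Countable {η : avoidWalks G K x // η.1.len = n} := Subtype.countable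
  have h : escapeUntil G K n x = srwLaw G x
      (⋃ η : {η : avoidWalks G K x // η.1.len = n}, pathCyl η.1.1.vert n) := by
    refine measure_congr ?_
    filter_upwards [srwLaw_ae_start G x, srwLaw_ae_adj G hdeg x] with a ha0 ha
    refine propext ⟨fun h => ?_, fun h t ht htn => ?_⟩
    · obtain ⟨η, hη, hηv⟩ := FinWalk.exists_of_adj a n fun k _ => ha k
      refine Set.mem_iUnion.2 ⟨⟨⟨η, ?_, fun t ht htl => ?_⟩, hη⟩, fun k hk => (hηv k hk).symm⟩
      · rw [hηv 0 (Nat.zero_le _), ha0]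
      · rw [hηv t (by omega)]
        exact h t ht (by omega)
    · obtain ⟨⟨⟨η, hη⟩, hηl⟩, h⟩ := Set.mem_iUnion.1 h
      rw [h t htn]
      exact hη.2 t ht (hηl ▸ htn)
  rw [h, measure_iUnion]
  · refine tsum_congr fun ⟨⟨η, hη⟩, hηl⟩ => ?_
    dsimp only at hηl ⊢
    rw [srwLaw_pathCyl, if_pos hη.1.symm, one_mul,
      prod_stepKernel hdeg η.vert n fun k hk => η.adj_vert (hηl ▸ hk), FinWalk.weight, hηl]
  · rintro ⟨⟨η, hη⟩, hηl⟩ ⟨⟨ξ, hξ⟩, hξl⟩ hne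
    refine Set.disjoint_left.2 fun a ha ha' => hne ?_
    dsimp only at hηl hξl ha ha'
    refine Subtype.ext (Subtype.ext (FinWalk.ext (hηl.trans hξl.symm) fun k hk => ?_))
    exact (ha k (hηl ▸ hk)).symm.trans (ha' k (hηl ▸ hk))
  · exact fun η => measurableSet_pathCyl _ _

/-- Grouping the walks by length exhibits the sum as an average of `escapeUntil` over a geometric
time. -/
lemma escapeGeom_eq (hdeg : ∀ x, 0 < G.degree x) (T : ℝ) (K : Finset V) (x : V) :
    escapeGeom G T K x = geomStop T * ∑' n, geomRatio T ^ n * escapeUntil G K n x := by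
  rw [escapeGeom, ENNReal.tsum_mul_left]
  congr 1
  rw [← (Equiv.sigmaFiberEquiv fun η : avoidWalks G K x => η.1.len).tsum_eq, ENNReal.tsum_sigma']
  refine tsum_congr fun n => ?_
  rw [escapeUntil_eq_tsum hdeg, ← ENNReal.tsum_mul_left]
  refine tsum_congr fun η => ?_
  change geomRatio T ^ η.1.1.len * η.1.1.weight = _
  rw [η.2]

/-- Stopping the walk can only help it to avoid `K`. -/
lemma escape_le_escapeGeom (hdeg : ∀ x, 0 < G.degree x) {T : ℝ} (hT : 0 < T) (K : Finset V)
    (x : V) : escape G K x ≤ escapeGeom G T K x := by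
  rw [escapeGeom_eq hdeg]
  calc escape G K x = (geomStop T * ∑' n, geomRatio T ^ n) * escape G K x := by
        rw [geomStop_mul_tsum hT, one_mul]
    _ = geomStop T * ∑' n, geomRatio T ^ n * escape G K x := by
        rw [mul_assoc, ENNReal.tsum_mul_right]
    _ ≤ _ := by
        gcongr
        exact escape_le_escapeUntil G K _ x

/-- Each of the times below `N` has probability at most `geomStop T`, and from `N` on the walk has
avoided `K` at least up to time `N`. Letting `T → ∞` and then `N → ∞` gives the limit. -/
lemma escapeGeom_le (hdeg : ∀ x, 0 < G.degree x) {T : ℝ} (hT : 0 < T) (K : Finset V)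
    (x : V) (N : ℕ) : escapeGeom G T K x ≤ geomStop T * N + escapeUntil G K N x := by
  have h : ∀ n, geomRatio T ^ n * escapeUntil G K n x ≤
      (if n ∈ Finset.range N then 1 else 0) + geomRatio T ^ n * escapeUntil G K N x := by
    intro n
    split_ifs with hn
    · refine le_add_of_le_of_nonneg ?_ zero_le
      exact mul_le_one' (pow_le_one' (geomRatio_le_one hT) n) (escapeUntil_le_one G K n x)
    · rw [zero_add]
      gcongr
      exact antitone_escapeUntil G K x (by simpa using hn)
  rw [escapeGeom_eq hdeg]
  refine (mul_le_mul_right (ENNReal.tsum_le_tsum h) _).trans ?_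
  rw [ENNReal.tsum_add, mul_add, ENNReal.tsum_mul_right, ← mul_assoc, geomStop_mul_tsum hT, one_mul]
  gcongr
  rw [tsum_eq_sum (s := Finset.range N) fun n hn => if_neg hn,
    Finset.sum_congr rfl fun n hn => if_pos hn]
  simp

lemma escapeGeom_empty (hdeg : ∀ x, 0 < G.degree x) {T : ℝ} (hT : 0 < T) (x : V) :
    escapeGeom G T ∅ x = 1 := by
  rw [escapeGeom_eq hdeg]
  simp only [escapeUntil_empty, mul_one]
  exact geomStop_mul_tsum hT

lemma tendsto_escapeGeom (hdeg : ∀ x, 0 < G.degree x) (K : Finset V) (x : V) :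
    Tendsto (fun T => escapeGeom G T K x) atTop (𝓝 (escape G K x)) := by
  refine tendsto_order.2 ⟨fun a ha => ?_, fun a ha => ?_⟩
  · filter_upwards [eventually_gt_atTop 0] with T hT
    exact ha.trans_le (escape_le_escapeGeom hdeg hT K x)
  · obtain ⟨N, hN⟩ := ((tendsto_escapeUntil G K x).eventually (gt_mem_nhds ha)).exists
    have h : Tendsto (fun T => geomStop T * N + escapeUntil G K N x) atTop
        (𝓝 (0 * N + escapeUntil G K N x)) :=
      (ENNReal.Tendsto.mul_const tendsto_geomStop (Or.inr (ENNReal.natCast_ne_top N))).add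
        tendsto_const_nhds
    rw [zero_mul, zero_add] at h
    filter_upwards [eventually_gt_atTop 0, h.eventually (gt_mem_nhds hN)] with T hT hTa
    exact (escapeGeom_le hdeg hT K x N).trans_lt hTa

/-- Distinct pairs `(η, ξ)` of avoiding walks give distinct joins with trace `γ`, and their masses
sum to a product of two escape probabilities of the stopped walk. For a lower bound it is not needed
that every walk with trace `γ` arises in this way. -/
lemma le_finitaryIntensity_traceSet (hdeg : ∀ x, 0 < G.degree x) {T : ℝ} (hT : 0 < T)
    {K : Finset V} {γ : FinWalk G} (hγ : γ.vert 0 ∈ K ∧ γ.vert γ.len ∈ K) :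
    G.degree (γ.vert 0) * γ.weight * geomRatio T ^ γ.len *
      (escape G K (γ.vert 0) * escape G K (γ.vert γ.len)) ≤
      finitaryIntensity G T (projFin ⁻¹' traceSet K γ) := by
  choose J hJ using fun p : avoidWalks G K (γ.vert 0) × avoidWalks G K (γ.vert γ.len) =>
    exists_isJoin (γ := γ) p.1.2.1 p.2.2.1
  have htr : ∀ p, IsTrace K γ (shift p.1.1.len (J p).toWalkSpace) := fun p =>
    (hJ p).isTrace hγ p.1.2 p.2.2
  have hinj : Function.Injective J := by
    intro p q hpq
    have h1 := htr p
    have h2 := htr q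
    rw [← hpq] at h2
    -- Both shifts of the same walk have trace `γ`, so they agree by uniqueness; hence the two
    -- initial pieces have the same length.
    have h2' : IsTrace K γ (shift (q.1.1.len - p.1.1.len : ℤ) (shift p.1.1.len (J p).toWalkSpace)) := by
      rw [shift_shift, sub_add_cancel]
      exact h2
    have hl := (h1.unique h2').1
    have hJq := hJ q
    rw [← hpq] at hJq
    obtain ⟨e1, e2⟩ := (hJ p).unique hJq (by omega)
    exact Prod.ext (Subtype.ext e1) (Subtype.ext e2)
  calc _ ≤ G.degree (γ.vert 0) * γ.weight * geomRatio T ^ γ.len *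
        (escapeGeom G T K (γ.vert 0) * escapeGeom G T K (γ.vert γ.len)) := by
        gcongr <;> exact escape_le_escapeGeom hdeg hT _ _
    _ = ∑' p, finitaryIntensity G T {J p} := by
        rw [← tsum_join]
        exact tsum_congr fun p => (finitaryIntensity_isJoin hdeg hT (hJ p)).symm
    _ = finitaryIntensity G T (⋃ p, {J p}) := by
        refine (measure_iUnion (fun p q hpq => ?_) fun p => FinWalk.measurableSet _).symm
        exact Set.disjoint_singleton.2 (hinj.ne hpq)
    _ ≤ _ := by
        refine measure_mono (Set.iUnion_subset fun p => ?_)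
        rintro _ rfl
        exact proj_mem_traceSet.2 ⟨_, htr p⟩

/-- Every walk hitting `K` is a join at its first visit, so a union bound suffices. The
unconstrained future contributes a factor one, since the geometric weights sum to one. -/
lemma finitaryIntensity_hitFin_le (hdeg : ∀ x, 0 < G.degree x) {T : ℝ} (hT : 0 < T)
    (K : Finset V) : finitaryIntensity G T (hitFin K) ≤
      ∑ x ∈ K, (G.degree x : ℝ≥0∞) * escapeGeom G T K x := by
  choose γ hγ hγv using fun x : V => FinWalk.exists_of_adj (G := G) (fun _ => x) 0 (by simp)
  have hγ0 : ∀ x, (γ x).vert 0 = x := fun x => hγv x 0 le_rfl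
  choose J hJ using fun (x : V) (p : avoidWalks G K x × avoidWalks G ∅ x) =>
    exists_isJoin (η := p.1.1) (γ := γ x) (ξ := p.2.1) (p.1.2.1.trans (hγ0 x).symm)
      (by rw [hγ, hγ0]; exact p.2.2.1)
  have hsub : hitFin K ⊆ ⋃ x ∈ K, ⋃ p, {J x p} := by
    intro w hw
    obtain ⟨δ, η, ξ, hδ, hδl, hη, hξ, h⟩ := exists_isJoin_of_mem_hitFin hw
    simp only [Set.mem_iUnion]
    refine ⟨δ.vert 0, hδ, (⟨η, hη⟩, ⟨ξ, hξ⟩), ?_⟩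
    -- A walk of length zero is determined by its vertex, so it is the one fixed in advance.
    have hδ' : δ = γ (δ.vert 0) := FinWalk.ext (by rw [hδl, hγ]) fun k hk => by
      rw [show k = 0 by omega, hγ0]
    have h' := hJ (δ.vert 0) (⟨η, hη⟩, ⟨ξ, hξ⟩)
    rw [← hδ'] at h'
    dsimp only at h'
    obtain ⟨l1, a1, -, c1⟩ := h
    obtain ⟨l2, a2, -, c2⟩ := h'
    refine FinWalk.ext (l1.trans l2.symm) fun k hk => ?_
    rcases le_or_gt k η.len with hkη | hkη
    · have b1 := a1 (η.len - k) (by omega)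
      have b2 := a2 (η.len - k) (by omega)
      rw [show η.len - (η.len - k) = k by omega] at b1 b2
      rw [b1, b2]
    · have b1 := c1 (k - η.len) (by omega)
      have b2 := c2 (k - η.len) (by omega)
      rw [show η.len + δ.len + (k - η.len) = k by omega] at b1 b2
      rw [b1, b2]
  refine (measure_mono hsub).trans ((measure_biUnion_finset_le K _).trans ?_)
  refine Finset.sum_le_sum fun x _ => (measure_iUnion_le _).trans (le_of_eq ?_)
  have hw : (γ x).weight = 1 := by rw [FinWalk.weight, hγ, Finset.range_zero, Finset.prod_empty]
  have := tsum_join (G := G) T K ∅ x x (G.degree x)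
  rw [escapeGeom_empty hdeg hT, mul_one] at this
  rw [← this]
  refine tsum_congr fun p => ?_
  rw [finitaryIntensity_isJoin hdeg hT (hJ x p), hw, hγ, hγ0, pow_zero, mul_one, mul_one]

lemma finitaryIntensity_hitFin_lt_top (hdeg : ∀ x, 0 < G.degree x) {T : ℝ} (hT : 0 < T)
    (K : Finset V) : finitaryIntensity G T (hitFin K) < ∞ := by
  refine (finitaryIntensity_hitFin_le hdeg hT K).trans_lt (ENNReal.sum_lt_top.2 fun x _ => ?_)
  refine ENNReal.mul_lt_top (ENNReal.natCast_lt_top _) ?_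
  refine (escapeGeom_le hdeg hT K x 0).trans_lt ?_
  rw [Nat.cast_zero, mul_zero, zero_add]
  exact (escapeUntil_le_one G K 0 x).trans_lt ENNReal.one_lt_top

end Escape

/-! ### Convergence of the intensity measures -/

section Convergence

lemma projFin_preimage_hitMod {V : Type*} {G : SimpleGraph V} (K : Finset V) : projFin ⁻¹' hitMod (G := G) K = hitFin K := by
  change FinWalk.toWalkSpace ⁻¹' (proj ⁻¹' hitMod K) = _
  rw [proj_preimage_hitMod]
  rfl

variable {V : Type*} [Countable V] {G : SimpleGraph V}

/-- Lower bounds for the single traces and an upper bound for the total mass force the convergence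
of the masses of all unions of traces. -/
lemma tendsto_measure_of_isSaturated {ι : Type*} {l : Filter ι}
    {μ : ι → Measure (WalkSpaceMod G)} {μ₀ : Measure (WalkSpaceMod G)} {K : Finset V}
    {b : ι → FinWalk G → ℝ≥0∞} {U : ι → ℝ≥0∞}
    (hb : ∀ γ, Tendsto (fun t => b t γ) l (𝓝 (μ₀ (traceSet K γ))))
    (hbμ : ∀ᶠ t in l, ∀ γ, b t γ ≤ μ t (traceSet K γ))
    (hU : Tendsto U l (𝓝 (μ₀ (hitMod K)))) (hUμ : ∀ᶠ t in l, μ t (hitMod K) ≤ U t)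
    (hfin : μ₀ (hitMod K) ≠ ∞) {C : Set (WalkSpaceMod G)} (hC : IsSaturated K C) :
    Tendsto (fun t => μ t C) l (𝓝 (μ₀ C)) := by
  have hlow : ∀ {D : Set (WalkSpaceMod G)}, IsSaturated K D →
      ∀ s : Finset {γ : FinWalk G // traceSet K γ ⊆ D}, ∀ᶠ t in l, ∑ γ ∈ s, b t γ.1 ≤ μ t D := by
    intro D hD s
    filter_upwards [hbμ] with t ht
    rw [hD.measure_eq]
    exact (Finset.sum_le_sum fun γ _ => ht γ.1).trans (ENNReal.sum_le_tsum s)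
  have hlim : ∀ {D : Set (WalkSpaceMod G)} (s : Finset {γ : FinWalk G // traceSet K γ ⊆ D}),
      Tendsto (fun t => ∑ γ ∈ s, b t γ.1) l (𝓝 (∑ γ ∈ s, μ₀ (traceSet K γ.1))) :=
    fun s => tendsto_finsetSum s fun γ _ => hb γ.1
  have hsum : ∀ {D : Set (WalkSpaceMod G)}, IsSaturated K D →
      Tendsto (fun s : Finset {γ : FinWalk G // traceSet K γ ⊆ D} =>
        ∑ γ ∈ s, μ₀ (traceSet K γ.1)) atTop (𝓝 (μ₀ D)) := by
    intro D hD
    rw [hD.measure_eq]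
    exact ENNReal.summable.hasSum
  refine tendsto_order.2 ⟨fun a ha => ?_, fun a ha => ?_⟩
  · obtain ⟨s, hs⟩ := ((hsum hC).eventually (lt_mem_nhds ha)).exists
    filter_upwards [hlow hC s, (hlim s).eventually (lt_mem_nhds hs)] with t h1 h2
    exact h2.trans_le h1
  -- The upper bound on `C` comes from the lower bound on its complement in `π(𝓦_K)`, subtracted
  -- from the upper bound on the total mass. All masses involved are finite in the limit.
  · have hC' : IsSaturated K (hitMod K \ C) := (isSaturated_hitMod K).diff hC
    have hadd : ∀ m : Measure (WalkSpaceMod G), m C + m (hitMod K \ C) = m (hitMod K) := by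
      intro m
      have := measure_inter_add_sdiff (μ := m) (hitMod K) hC.measurableSet
      rwa [Set.inter_eq_right.2 hC.1] at this
    have hne : μ₀ (hitMod K \ C) ≠ ∞ :=
      ((measure_mono Set.sdiff_subset).trans_lt hfin.lt_top).ne
    have h1 : Tendsto (fun s : Finset {γ : FinWalk G // traceSet K γ ⊆ hitMod K \ C} =>
        μ₀ (hitMod K) - ∑ γ ∈ s, μ₀ (traceSet K γ.1)) atTop (𝓝 (μ₀ C)) := by
      have := ENNReal.Tendsto.sub (tendsto_const_nhds (x := μ₀ (hitMod K))) (hsum hC')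
        (Or.inl hfin)
      have hs : μ₀ (hitMod K) - μ₀ (hitMod K \ C) = μ₀ C := by
        rw [← hadd μ₀, ENNReal.add_sub_cancel_right hne]
      rwa [hs] at this
    obtain ⟨s, hs⟩ := (h1.eventually (gt_mem_nhds ha)).exists
    have h2 := ENNReal.Tendsto.sub hU (hlim s) (Or.inl hfin)
    have hsfin : ∑ γ ∈ s, μ₀ (traceSet K γ.1) < ∞ := by
      refine lt_of_le_of_lt ?_ hne.lt_top
      rw [hC'.measure_eq]
      exact ENNReal.sum_le_tsum s
    filter_upwards [hlow hC' s, hUμ, h2.eventually (gt_mem_nhds hs),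
      (hlim s).eventually (gt_mem_nhds hsfin)] with t e1 e2 e3 e4
    refine lt_of_le_of_lt (ENNReal.le_sub_of_add_le_right e4.ne ?_) e3
    exact (add_le_add le_rfl e1).trans ((hadd (μ t)).le.trans e2)

variable [MeasurableSpace V] [DiscreteMeasurableSpace V] [G.LocallyFinite]

lemma finitaryIntensity_map_hitMod_lt_top (hdeg : ∀ x, 0 < G.degree x) {T : ℝ} (hT : 0 < T)
    (K : Finset V) : (finitaryIntensity G T).map projFin (hitMod K) < ∞ := by
  rw [Measure.map_apply measurable_projFin (measurableSet_hitMod K), projFin_preimage_hitMod]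
  exact finitaryIntensity_hitFin_lt_top hdeg hT K

/-- The lower bounds on traces converge to the `Q*`-masses because `T / (T + 1) → 1` with the length
of `γ` fixed. The upper bound on the total converges to the capacity of `K`, since the stopped
escape probabilities converge. -/
lemma tendsto_finitaryIntensity (htrans : IsTransient G) (hdeg : ∀ x, 0 < G.degree x)
    {Q : Measure (WalkSpaceMod G)} (hQ : IsInterlacementIntensity G Q) {K : Finset V}
    {C : Set (WalkSpaceMod G)} (hC : IsSaturated K C) :
    Tendsto (fun T => (finitaryIntensity G T).map projFin C) atTop (𝓝 (Q C)) := by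
  classical
  have hQK : Q (hitMod K) = ∑ x ∈ K, (G.degree x : ℝ≥0∞) * escape G K x := by
    rw [← hitIntensityMod_hitMod htrans hdeg, ← hQ.apply (measurableSet_hitMod K), Set.inter_self]
  have hQγ : ∀ γ, Q (traceSet K γ) = if γ.vert 0 ∈ K ∧ γ.vert γ.len ∈ K then
      G.degree (γ.vert 0) * γ.weight * (escape G K (γ.vert 0) * escape G K (γ.vert γ.len))
      else 0 := by
    intro γ
    rw [← Set.inter_eq_left.2 (traceSet_subset_hitMod K γ), hQ.2 _ K (measurableSet_traceSet K γ),
      hitIntensity_traceSet htrans hdeg subset_rfl]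
    have : ((∃ j ≤ γ.len, γ.vert j ∈ K) ∧ γ.vert 0 ∈ K ∧ γ.vert γ.len ∈ K) ↔
        γ.vert 0 ∈ K ∧ γ.vert γ.len ∈ K :=
      and_iff_right_of_imp fun h => ⟨0, Nat.zero_le _, h.1⟩
    simp only [this, mul_assoc]
  have hw : ∀ γ : FinWalk G, γ.weight ≠ ∞ := fun γ => ENNReal.prod_ne_top fun k _ =>
    ENNReal.inv_ne_top.2 (by exact_mod_cast (hdeg _).ne')
  refine tendsto_measure_of_isSaturated
    (b := fun T γ => if γ.vert 0 ∈ K ∧ γ.vert γ.len ∈ K then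
      G.degree (γ.vert 0) * γ.weight * geomRatio T ^ γ.len *
        (escape G K (γ.vert 0) * escape G K (γ.vert γ.len)) else 0)
    (U := fun T => ∑ x ∈ K, (G.degree x : ℝ≥0∞) * escapeGeom G T K x)
    (fun γ => ?_) ?_ ?_ ?_ (hQ.hitMod_lt_top htrans hdeg K).ne hC
  · rw [hQγ]
    split_ifs
    · have h1 : Tendsto (fun T => geomRatio T ^ γ.len) atTop (𝓝 (1 ^ γ.len)) :=
        ((ENNReal.continuous_pow γ.len).tendsto 1).comp tendsto_geomRatio
      rw [one_pow] at h1
      have h2 : Tendsto (fun T => (G.degree (γ.vert 0) : ℝ≥0∞) * γ.weight * geomRatio T ^ γ.len) atTop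
          (𝓝 (G.degree (γ.vert 0) * γ.weight * 1)) :=
        ENNReal.Tendsto.const_mul h1
          (Or.inr (ENNReal.mul_ne_top (ENNReal.natCast_ne_top _) (hw γ)))
      rw [mul_one] at h2
      refine ENNReal.Tendsto.mul_const h2 (Or.inr (ENNReal.mul_ne_top ?_ ?_))
      · exact ((escape_le_one G K _).trans_lt ENNReal.one_lt_top).ne
      · exact ((escape_le_one G K _).trans_lt ENNReal.one_lt_top).ne
    · exact tendsto_const_nhds
  · filter_upwards [eventually_gt_atTop 0] with T hT γ
    split_ifs with h
    · rw [Measure.map_apply measurable_projFin (measurableSet_traceSet K γ)]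
      exact le_finitaryIntensity_traceSet hdeg hT h
    · exact zero_le
  · rw [hQK]
    exact tendsto_finsetSum K fun x _ => ENNReal.Tendsto.const_mul (tendsto_escapeGeom hdeg K x)
      (Or.inr (ENNReal.natCast_ne_top _))
  · filter_upwards [eventually_gt_atTop 0] with T hT
    rw [Measure.map_apply measurable_projFin (measurableSet_hitMod K), projFin_preimage_hitMod]
    exact finitaryIntensity_hitFin_le hdeg hT K

lemma sigmaFinite_smul_finitaryIntensity (hdeg : ∀ x, 0 < G.degree x) {T : ℝ} (hT : 0 < T)
    {c : ℝ≥0∞} (hc : c ≠ ∞) : SigmaFinite (c • finitaryIntensity G T) := by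
  refine SigmaFinite.of_map _ measurable_projFin.aemeasurable (sigmaFinite_of_hitMod fun K => ?_)
  rw [Measure.map_smul, Measure.smul_apply, smul_eq_mul]
  exact ENNReal.mul_lt_top hc.lt_top (finitaryIntensity_map_hitMod_lt_top hdeg hT K)

lemma IsInterlacementIntensity.sigmaFinite_smul (htrans : IsTransient G)
    (hdeg : ∀ x, 0 < G.degree x) {Q : Measure (WalkSpaceMod G)}
    (hQ : IsInterlacementIntensity G Q) {c : ℝ≥0∞} (hc : c ≠ ∞) : SigmaFinite (c • Q) := by
  refine sigmaFinite_of_hitMod fun K => ?_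
  rw [Measure.smul_apply, smul_eq_mul]
  exact ENNReal.mul_lt_top hc.lt_top (hQ.hitMod_lt_top htrans hdeg K)

lemma existsUnique_isPoissonLaw {ι X : Type*} [Countable ι] [MeasurableSpace X] {B : ι → Set X}
    (hB : ∀ i, MeasurableSet (B i)) (μ : Measure X) [SigmaFinite μ] (hμ : ∀ i, μ (B i) < ∞) :
    ∃! P : ProbabilityMeasure (CountingMeasure B),
      IsPoissonLaw μ (P : Measure (CountingMeasure B)) := by
  obtain ⟨P, hP⟩ := exists_isPoissonLaw hB μ hμ
  refine ⟨P, hP, fun P' hP' => Subtype.ext ?_⟩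
  have h₁ : IsProbabilityMeasure P.1 := P.2
  have h₂ : IsProbabilityMeasure P'.1 := P'.2
  exact IsPoissonLaw.unique (P := P'.1) (P' := P.1) hP' hP

theorem tendsto_finitary_interlacement (htrans : IsTransient G) (hdeg : ∀ x, 0 < G.degree x)
    {c : ℝ≥0∞} (hc : c ≠ ∞) {Q : Measure (WalkSpaceMod G)} (hQ : IsInterlacementIntensity G Q)
    {P₀ : ProbabilityMeasure (ConfigMod G)} {P : ℝ → ProbabilityMeasure (ConfigFin G)}
    (hP₀ : IsPoissonLaw (c • Q) (P₀ : Measure (ConfigMod G)))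
    (hP : ∀ T : ℝ, 0 < T →
      IsPoissonLaw (c • finitaryIntensity G T) (P T : Measure (ConfigFin G))) :
    Tendsto (fun T : ℝ => (P T).map (measurable_push (G := G)).aemeasurable) atTop (𝓝 P₀) := by
  classical
  refine tendsto_configMod fun F hF => ?_
  choose K w _ hKw using fun p : F => hF p.1 p.2
  -- All cylinder sets of the event are saturated over one common finite set, the union of theirs,
  -- and hence so are their atoms.
  have hsat : ∀ p : F, IsSaturated (Finset.univ.biUnion K) p.1.1 := fun p => by
    rw [hKw p]
    exact (isSaturated_proj_cyl (K p) (w p)).mono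
      (Finset.subset_biUnion_of_mem K (Finset.mem_univ p))
  have hlt : ∀ {μ : Measure (WalkSpaceMod G)}, (∀ L, μ (hitMod L) < ∞) → ∀ p : F,
      (c • μ) p.1.1 < ∞ := fun hμ p => by
    rw [Measure.smul_apply, smul_eq_mul]
    exact ENNReal.mul_lt_top hc.lt_top ((measure_mono (hsat p).1).trans_lt (hμ _))
  refine tendsto_counts (μ := fun T => c • (finitaryIntensity G T).map projFin) (μ₀ := c • Q)
    (P := fun T => (((P T).map (measurable_push (G := G)).aemeasurable :
      ProbabilityMeasure (ConfigMod G)) : Measure (ConfigMod G)))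
    (A := fun p : F => p.1.1) ?_ hP₀.hasPoissonCounts (fun p => (hsat p).measurableSet) ?_
    (hlt fun L => hQ.hitMod_lt_top htrans hdeg L) (fun S => ?_) (fun p => p.1.2)
  · filter_upwards [eventually_gt_atTop 0] with T hT
    have h := (hP T hT).hasPoissonCounts.map (B' := hitMod (G := G)) measurable_projFin
      (measurable_push (G := G)) fun ω => rfl
    rwa [Measure.map_smul] at h
  · filter_upwards [eventually_gt_atTop 0] with T hT
    exact hlt fun L => finitaryIntensity_map_hitMod_lt_top hdeg hT L
  · simp only [Measure.smul_apply, smul_eq_mul]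
    exact ENNReal.Tendsto.const_mul (tendsto_finitaryIntensity htrans hdeg hQ
      (IsSaturated.atom hsat S.2)) (Or.inr hc)

end Convergence

end Interlacement

/-! ### The theorem -/

theorem mainTheorem7 {V : Type*} [Countable V] [MeasurableSpace V] [DiscreteMeasurableSpace V]
    (G : SimpleGraph V) [G.LocallyFinite] (hconn : G.Connected)
    (htrans : Interlacement.IsTransient G) (u : ℝ) (hu : 0 < u) :
    (∃! Q : MeasureTheory.Measure (Interlacement.WalkSpaceMod G),
      Interlacement.IsInterlacementIntensity G Q) ∧
    ∀ Q : MeasureTheory.Measure (Interlacement.WalkSpaceMod G),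
      Interlacement.IsInterlacementIntensity G Q →
      (∃! P : MeasureTheory.ProbabilityMeasure (Interlacement.ConfigMod G),
        Interlacement.IsPoissonLaw (ENNReal.ofReal u • Q)
          (P : MeasureTheory.Measure (Interlacement.ConfigMod G))) ∧
      (∀ T : ℝ, 0 < T → ∃! P : MeasureTheory.ProbabilityMeasure (Interlacement.ConfigFin G),
        Interlacement.IsPoissonLaw (ENNReal.ofReal u • Interlacement.finitaryIntensity G T)
          (P : MeasureTheory.Measure (Interlacement.ConfigFin G))) ∧
      ∀ (PRI : MeasureTheory.ProbabilityMeasure (Interlacement.ConfigMod G))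
        (PFRI : ℝ → MeasureTheory.ProbabilityMeasure (Interlacement.ConfigFin G)),
        Interlacement.IsPoissonLaw (ENNReal.ofReal u • Q)
          (PRI : MeasureTheory.Measure (Interlacement.ConfigMod G)) →
        (∀ T : ℝ, 0 < T →
          Interlacement.IsPoissonLaw (ENNReal.ofReal u • Interlacement.finitaryIntensity G T)
            (PFRI T : MeasureTheory.Measure (Interlacement.ConfigFin G))) →
        Filter.Tendsto
          (fun T : ℝ => (PFRI T).map (Interlacement.measurable_push (G := G)).aemeasurable)
          Filter.atTop (nhds PRI) := by
  have hdeg := htrans.degree_pos hconn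
  refine ⟨?_, fun Q hQ => ⟨?_, fun T hT => ?_, fun PRI PFRI hPRI hPFRI => ?_⟩⟩
  · obtain ⟨Q, hQ⟩ := Interlacement.exists_isInterlacementIntensity htrans hdeg
    exact ⟨Q, hQ, fun Q' hQ' => hQ'.unique hQ⟩
  · have := hQ.sigmaFinite_smul htrans hdeg (ENNReal.ofReal_ne_top (r := u))
    refine Interlacement.existsUnique_isPoissonLaw Interlacement.measurableSet_hitMod _ fun K => ?_
    rw [MeasureTheory.Measure.smul_apply, smul_eq_mul]
    exact ENNReal.mul_lt_top ENNReal.ofReal_lt_top (hQ.hitMod_lt_top htrans hdeg K)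
  · have := Interlacement.sigmaFinite_smul_finitaryIntensity hdeg hT (ENNReal.ofReal_ne_top (r := u))
    refine Interlacement.existsUnique_isPoissonLaw
      (fun K => Interlacement.FinWalk.measurableSet _) _ fun K => ?_
    rw [MeasureTheory.Measure.smul_apply, smul_eq_mul]
    exact ENNReal.mul_lt_top ENNReal.ofReal_lt_top
      (Interlacement.finitaryIntensity_hitFin_lt_top hdeg hT K)
  · exact Interlacement.tendsto_finitary_interlacement htrans hdeg ENNReal.ofReal_ne_top hQ hPRI hPFRI
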